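/- Over the base theory $\mathbf{RCA}_0$ of second order arithmetic, the following are equivalent (equivalently, by G\"odel's completeness theorem: every model of $\mathbf{RCA}_0$, possibly with non-standard numbers, satisfies (i) if and only if it satisfies (ii)): (i) arithmetical comprehension, i.e. the scheme stating that $\{n\in\mathbb N\mid\varphi(n)\}$ exists for every formula $\varphi$ without set quantifiers (number and set parameters are allowed); (ii) the extended Goodstein theorem for the binary representation: for any Goodstein system $(b,c)$ and any $m<2^{b(0)}$ there is an $i\in\mathbb N$ with $G^2_{b,c,m}(i)=0$. Here a Goodstein system is a pair $(b,c)$ of a non-decreasing function $b:\mathbb N\to\mathbb N$ with $b(0)>0$ and a family $c=\langle c_i\rangle_{i\in\mathbb N}$ of strictly increasing functions $c_i:\{0,\dots,b(i)-1\}\to\{0,\dots,b(i+1)-1\}$ with the following property: for any function $d:\mathbb N\to\mathbb N$ with $d(i)<b(i)$ for all $i\in\mathbb N$ and any infinite $Y\subseteq\mathbb N$, there are $i,j\in Y$ with $i<j$ and $c_{ij}(d(i))\le d(j)$, where $c_{ij}:=c_{j-1}\circ\dots\circ c_i$. For a Goodstein system $(b,c)$ and $m<2^{b(0)}$, the Goodstein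 sequence $G^2_{b,c,m}(0),G^2_{b,c,m}(1),\dots$ is given by $G^2_{b,c,m}(0)=m$ and \[ G^2_{b,c,m}(i+1)=\begin{cases}0 & \text{if } G^2_{b,c,m}(i)=0,\\ 2^{c_i(n_0)}+\dots+2^{c_i(n_k)}-1 & \text{if } G^2_{b,c,m}(i)=2^{n_0}+\dots+2^{n_k}\text{ with } b(i)>n_0>\dots>n_k.\end{cases} \] -/

import Mathlib

universe u

/-! ## The language of second order arithmetic -/

namespace SecondOrderArithmetic

/-- Numerical terms; the number variables are indexed by `ℕ`. -/
inductive Term : Type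
  | var (x : ℕ) : Term
  | zero : Term
  | one : Term
  | add (s t : Term) : Term
  | mul (s t : Term) : Term

/-- The number variable `x` occurs in a term. -/
def Term.Occurs (x : ℕ) : Term → Prop
  | .var y => x = y
  | .zero => False
  | .one => False
  | .add s t => s.Occurs x ∨ t.Occurs x
  | .mul s t => s.Occurs x ∨ t.Occurs x

/-- Formulas of second order arithmetic. Number variables and set variables are indexed by `ℕ`
(separately). -/
inductive Formula : Type
  | eq (s t : Term) : Formula
  | lt (s t : Term) : Formula
  | mem (t : Term) (X : ℕ) : Formula
  | not (φ : Formula) : Formula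
  | and (φ ψ : Formula) : Formula
  | or (φ ψ : Formula) : Formula
  | imp (φ ψ : Formula) : Formula
  | all (x : ℕ) (φ : Formula) : Formula
  | ex (x : ℕ) (φ : Formula) : Formula
  | allSet (X : ℕ) (φ : Formula) : Formula
  | exSet (X : ℕ) (φ : Formula) : Formula

/-- Bounded quantifier formulas: all quantifiers are of the form `∀ x < t` or `∃ x < t`, for a
term `t` in which `x` does not occur. -/
inductive Formula.IsBounded : Formula → Prop
  | eq (s t : Term) : IsBounded (.eq s t)
  | lt (s t : Term) : IsBounded (.lt s t)
  | mem (t : Term) (X : ℕ) : IsBounded (.mem t X)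
  | not {φ : Formula} : IsBounded φ → IsBounded (.not φ)
  | and {φ ψ : Formula} : IsBounded φ → IsBounded ψ → IsBounded (.and φ ψ)
  | or {φ ψ : Formula} : IsBounded φ → IsBounded ψ → IsBounded (.or φ ψ)
  | imp {φ ψ : Formula} : IsBounded φ → IsBounded ψ → IsBounded (.imp φ ψ)
  | all {φ : Formula} (x : ℕ) (t : Term) : ¬ t.Occurs x → IsBounded φ →
      IsBounded (.all x (.imp (.lt (.var x) t) φ))
  | ex {φ : Formula} (x : ℕ) (t : Term) : ¬ t.Occurs x → IsBounded φ →
      IsBounded (.ex x (.and (.lt (.var x) t) φ))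

/-- `Σ⁰₁` formulas: `∃ x θ` with `θ` a bounded quantifier formula. -/
def Formula.IsSigma (φ : Formula) : Prop :=
  ∃ (x : ℕ) (θ : Formula), θ.IsBounded ∧ φ = .ex x θ

/-- `Π⁰₁` formulas: `∀ x θ` with `θ` a bounded quantifier formula. -/
def Formula.IsPi (φ : Formula) : Prop :=
  ∃ (x : ℕ) (θ : Formula), θ.IsBounded ∧ φ = .all x θ

/-- Arithmetical formulas: no set quantifiers (free set variables are allowed). -/
def Formula.IsArithmetical : Formula → Prop
  | .eq _ _ => True
  | .lt _ _ => True
  | .mem _ _ => True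
  | .not φ => φ.IsArithmetical
  | .and φ ψ => φ.IsArithmetical ∧ ψ.IsArithmetical
  | .or φ ψ => φ.IsArithmetical ∧ ψ.IsArithmetical
  | .imp φ ψ => φ.IsArithmetical ∧ ψ.IsArithmetical
  | .all _ φ => φ.IsArithmetical
  | .ex _ φ => φ.IsArithmetical
  | .allSet _ _ => False
  | .exSet _ _ => False

end SecondOrderArithmetic

open SecondOrderArithmetic

/-! ## Structures and satisfaction -/

/-- A structure for the language of second order arithmetic (general, i.e. Henkin, semantics):
number variables range over `Num` and set variables over the collection `sets` of subsets of
`Num`. Equality is interpreted as equality. -/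
structure SecondOrderStructure : Type (u + 1) where
  Num : Type u
  [instZero : Zero Num]
  [instOne : One Num]
  [instAdd : Add Num]
  [instMul : Mul Num]
  [instLT : LT Num]
  sets : Set (Set Num)
  sets_nonempty : sets.Nonempty

attribute [instance] SecondOrderStructure.instZero SecondOrderStructure.instOne
  SecondOrderStructure.instAdd SecondOrderStructure.instMul SecondOrderStructure.instLT

namespace SecondOrderStructure

/-- The value of a term under an assignment of the number variables. -/
def value (M : SecondOrderStructure.{u}) (e : ℕ → M.Num) : Term → M.Num
  | .var x => e x
  | .zero => 0
  | .one => 1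
  | .add s t => M.value e s + M.value e t
  | .mul s t => M.value e s * M.value e t

/-- Satisfaction of a formula under assignments `e` of the number variables and `E` of the set
variables. -/
def Sat (M : SecondOrderStructure.{u}) : (ℕ → M.Num) → (ℕ → M.sets) → Formula → Prop
  | e, _, .eq s t => M.value e s = M.value e t
  | e, _, .lt s t => M.value e s < M.value e t
  | e, E, .mem t X => M.value e t ∈ (E X : Set M.Num)
  | e, E, .not φ => ¬ M.Sat e E φ
  | e, E, .and φ ψ => M.Sat e E φ ∧ M.Sat e E ψ
  | e, E, .or φ ψ => M.Sat e E φ ∨ M.Sat e E ψ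
  | e, E, .imp φ ψ => M.Sat e E φ → M.Sat e E ψ
  | e, E, .all x φ => ∀ a : M.Num, M.Sat (Function.update e x a) E φ
  | e, E, .ex x φ => ∃ a : M.Num, M.Sat (Function.update e x a) E φ
  | e, E, .allSet X φ => ∀ A : M.sets, M.Sat e (Function.update E X A) φ
  | e, E, .exSet X φ => ∃ A : M.sets, M.Sat e (Function.update E X A) φ

/-! ## The axioms of `RCA₀` and arithmetical comprehension -/

/-- The basic axioms. -/
structure BasicAxioms (M : SecondOrderStructure.{u}) : Prop where
  succ_ne_zero : ∀ n : M.Num, n + 1 ≠ 0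
  succ_inj : ∀ m n : M.Num, m + 1 = n + 1 → m = n
  add_zero : ∀ m : M.Num, m + 0 = m
  add_succ : ∀ m n : M.Num, m + (n + 1) = (m + n) + 1
  mul_zero : ∀ m : M.Num, m * 0 = 0
  mul_succ : ∀ m n : M.Num, m * (n + 1) = m * n + m
  not_lt_zero : ∀ m : M.Num, ¬ m < 0
  lt_succ : ∀ m n : M.Num, m < n + 1 ↔ m < n ∨ m = n

/-- The scheme of `Σ⁰₁` induction (with number and set parameters). -/
def SigmaInduction (M : SecondOrderStructure.{u}) : Prop :=
  ∀ φ : Formula, φ.IsSigma → ∀ (x : ℕ) (e : ℕ → M.Num) (E : ℕ → M.sets),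
    M.Sat (Function.update e x 0) E φ →
    (∀ n : M.Num, M.Sat (Function.update e x n) E φ → M.Sat (Function.update e x (n + 1)) E φ) →
    ∀ n : M.Num, M.Sat (Function.update e x n) E φ

/-- The scheme of `Δ⁰₁` comprehension (with number and set parameters). -/
def DeltaComprehension (M : SecondOrderStructure.{u}) : Prop :=
  ∀ φ ψ : Formula, φ.IsSigma → ψ.IsPi → ∀ (x : ℕ) (e : ℕ → M.Num) (E : ℕ → M.sets),
    (∀ n : M.Num, M.Sat (Function.update e x n) E φ ↔ M.Sat (Function.update e x n) E ψ) →
    ∃ X ∈ M.sets, ∀ n : M.Num, n ∈ X ↔ M.Sat (Function.update e x n) E φ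

/-- `M` is a model of `RCA₀`. -/
structure ModelsRCA (M : SecondOrderStructure.{u}) : Prop where
  basic : M.BasicAxioms
  induction : M.SigmaInduction
  comprehension : M.DeltaComprehension

/-- `M` satisfies the scheme of arithmetical comprehension (with number and set parameters). -/
def ArithmeticalComprehension (M : SecondOrderStructure.{u}) : Prop :=
  ∀ φ : Formula, φ.IsArithmetical → ∀ (x : ℕ) (e : ℕ → M.Num) (E : ℕ → M.sets),
    ∃ X ∈ M.sets, ∀ n : M.Num, n ∈ X ↔ M.Sat (Function.update e x n) E φ

/-! ## The extended Goodstein theorem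

The following notions are interpreted in the structure `M`: all quantifiers range over the
numbers of `M` or over the sets in `M.sets`. -/

/-- The non-strict order between numbers. -/
def Le (M : SecondOrderStructure.{u}) (x y : M.Num) : Prop := x < y ∨ x = y

/-- The number that codes the pair of `i` and `j`. -/
def pair (M : SecondOrderStructure.{u}) (i j : M.Num) : M.Num := (i + j) * (i + j) + i

/-- `f` is (the graph of) a function from the numbers to the numbers. -/
def IsFun (M : SecondOrderStructure.{u}) (f : Set M.Num) : Prop :=
  f ∈ M.sets ∧ (∀ x ∈ f, ∃ i j, x = M.pair i j) ∧ ∀ i, ∃! j, M.pair i j ∈ f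

/-- `f(i) = j`. -/
def App (M : SecondOrderStructure.{u}) (f : Set M.Num) (i j : M.Num) : Prop := M.pair i j ∈ f

/-- `2 ^ x = y`, where exponentiation is defined by primitive recursion. -/
def Pow (M : SecondOrderStructure.{u}) (x y : M.Num) : Prop :=
  ∃ p : Set M.Num, M.IsFun p ∧ M.App p 0 1 ∧
    (∀ i u, M.App p i u → M.App p (i + 1) (u + u)) ∧ M.App p x y

/-- `c_i(n) = k`, for a family `c` of functions that is coded by the set of triples
`((i, n), k)` with `c_i(n) = k`. -/
def FamApp (M : SecondOrderStructure.{u}) (c : Set M.Num) (i n k : M.Num) : Prop :=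
  M.pair (M.pair i n) k ∈ c

/-- `c` is a family of functions `c_i : {0, …, b(i) - 1} → {0, …, b(i + 1) - 1}`. -/
structure IsFamily (M : SecondOrderStructure.{u}) (b c : Set M.Num) : Prop where
  mem_sets : c ∈ M.sets
  domain : ∀ x ∈ c, ∃ i n k u, x = M.pair (M.pair i n) k ∧ M.App b i u ∧ n < u
  total : ∀ i n u, M.App b i u → n < u → ∃! k, M.FamApp c i n k
  codomain : ∀ i n k v, M.FamApp c i n k → M.App b (i + 1) v → k < v

/-- `c_{ij}(x) = y` for `c_{ij} = c_{j-1} ∘ … ∘ c_i`: there is a sequence that leads from `x` at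
position `i` to `y` at position `j` and which proceeds from position `k` to position `k + 1`
according to `c_k`. (Only the values of `f` at the positions between `i` and `j` matter.) -/
def IterApp (M : SecondOrderStructure.{u}) (c : Set M.Num) (i j x y : M.Num) : Prop :=
  ∃ f : Set M.Num, M.IsFun f ∧ M.App f i x ∧ M.App f j y ∧
    ∀ k u v, M.Le i k → k < j → M.App f k u → M.App f (k + 1) v → M.FamApp c k u v

/-- `Y` is an infinite set of numbers. -/
def IsInfinite (M : SecondOrderStructure.{u}) (Y : Set M.Num) : Prop :=
  Y ∈ M.sets ∧ ∀ n, ∃ k ∈ Y, n < k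

/-- `(b, c)` is a Goodstein system. -/
structure GoodsteinSystem (M : SecondOrderStructure.{u}) (b c : Set M.Num) : Prop where
  isFun : M.IsFun b
  mono : ∀ i j u v, M.Le i j → M.App b i u → M.App b j v → M.Le u v
  pos : ∀ u, M.App b 0 u → 0 < u
  isFamily : M.IsFamily b c
  strictMono : ∀ i n n' k k', n < n' → M.FamApp c i n k → M.FamApp c i n' k' → k < k'
  recurrent : ∀ d Y : Set M.Num, M.IsFun d → (∀ i u v, M.App d i u → M.App b i v → u < v) →
    M.IsInfinite Y → ∃ i ∈ Y, ∃ j ∈ Y, i < j ∧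
      ∃ x y z, M.App d i x ∧ M.IterApp c i j x y ∧ M.App d j z ∧ M.Le y z

/-- `2 ^ f(0) + … + 2 ^ f(k) = s`, where `σ` is the sequence of partial sums. -/
def PowSum (M : SecondOrderStructure.{u}) (f : Set M.Num) (k s : M.Num) : Prop :=
  ∃ σ : Set M.Num, M.IsFun σ ∧ M.App σ 0 0 ∧
    (∀ j n p u, M.Le j k → M.App f j n → M.Pow n p → M.App σ j u → M.App σ (j + 1) (u + p)) ∧
    M.App σ (k + 1) s

/-- One step of a Goodstein sequence, from the value `u` at `i` to the value `v` at `i + 1`: if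
`u = 0` then `v = 0`, and if `u = 2 ^ n_0 + … + 2 ^ n_k` with `b(i) > n_0 > … > n_k` then
`v = 2 ^ c_i(n_0) + … + 2 ^ c_i(n_k) - 1`. The sequences of the exponents `n_0, …, n_k` and of the
new exponents `c_i(n_0), …, c_i(n_k)` are represented by functions `f` and `g`, of which only the
values at `0, …, k` matter. -/
def GoodsteinStep (M : SecondOrderStructure.{u}) (b c : Set M.Num) (i u v : M.Num) : Prop :=
  (u = 0 ∧ v = 0) ∨
  ∃ (k : M.Num) (f g : Set M.Num), M.IsFun f ∧ M.IsFun g ∧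
    (∀ n w, M.App f 0 n → M.App b i w → n < w) ∧
    (∀ j n n', j < k → M.App f j n → M.App f (j + 1) n' → n' < n) ∧
    M.PowSum f k u ∧
    (∀ j n n', M.Le j k → M.App f j n → M.App g j n' → M.FamApp c i n n') ∧
    M.PowSum g k (v + 1)

/-- `G` is the Goodstein sequence for binary representation with respect to `(b, c)` and the
starting value `m`. -/
structure IsGoodsteinSequence (M : SecondOrderStructure.{u}) (b c : Set M.Num) (m : M.Num)
    (G : Set M.Num) : Prop where
  isFun : M.IsFun G
  start : M.App G 0 m
  step : ∀ i u v, M.App G i u → M.App G (i + 1) v → M.GoodsteinStep b c i u v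

/-- `M` satisfies the extended Goodstein theorem for the binary representation: for any Goodstein
system `(b, c)` and any `m < 2 ^ b(0)`, the Goodstein sequence reaches zero. -/
def ExtendedGoodstein (M : SecondOrderStructure.{u}) : Prop :=
  ∀ b c : Set M.Num, M.GoodsteinSystem b c →
    ∀ m w p : M.Num, M.App b 0 w → M.Pow w p → m < p →
      ∃ G : Set M.Num, M.IsGoodsteinSequence b c m G ∧ ∃ i : M.Num, M.App G i 0

end SecondOrderStructure

/-!
Consider a Goodstein sequence that never reaches zero, and let `2 ^ t` be the last summand in the
binary representation of its value at `i`. As long as the last exponents of the later values stay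
below the image of `t` under the iterates of `c`, the other summands of the value at `i` are merely
moved along by `c`. When the last exponent reaches this image for the first time (`i` has a return),
the summand `2 ^ t` has just been used up. Given arithmetical comprehension, the indices without
return form a set. If this set is infinite, then the last exponents at its elements violate the
condition on Goodstein systems. If it is finite, then the summands of some value are used up one
after the other, and the sequence reaches zero after all.

Conversely, it suffices to decide `{n | ∃ w, Θ n w}` for a `Δ⁰₁` predicate `Θ`. We put
`b(i) = 2 * i + 1` and describe an exponent at stage `i` by its distance from `2 * i`. When `n` is
listed for the first time at stage `i`, distances above `2 * n + 1` increase by two while the others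
do not change. The sequence that starts with `1` never reaches zero, since its values are bounded
below by numbers whose base four digits record which `n` have not been listed yet. The extended
Goodstein theorem thus yields a sequence `D` and an infinite set `Y` that violate the condition on
Goodstein systems. The distances `2 * i - D(i)` for `i ∈ Y` are unbounded, and they never exceed
twice the number of candidates that remain at stage `i`. If `n` with `2 * n + 1 < 2 * i - D(i)` were
first listed after stage `i`, then too few candidates would remain, so that it can be decided
whether `n` is ever listed.
-/

namespace SecondOrderStructure

/-! ## Definability with parameters -/

section Definability

variable {M : SecondOrderStructure.{u}} {n m : ℕ}

/-- Polynomial functions of tuples, with parameters: the functions that are given by terms. -/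
inductive IsPolynomial (M : SecondOrderStructure.{u}) {n : ℕ} :
    ((Fin n → M.Num) → M.Num) → Prop
  | var (i : Fin n) : IsPolynomial M fun v ↦ v i
  | const (a : M.Num) : IsPolynomial M fun _ ↦ a
  | add {s t : (Fin n → M.Num) → M.Num} :
      IsPolynomial M s → IsPolynomial M t → IsPolynomial M fun v ↦ s v + t v
  | mul {s t : (Fin n → M.Num) → M.Num} :
      IsPolynomial M s → IsPolynomial M t → IsPolynomial M fun v ↦ s v * t v

/-- The tuple `v` extended by the last entry `a`. -/
abbrev snoc (v : Fin n → M.Num) (a : M.Num) : Fin (n + 1) → M.Num :=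
  Fin.snoc (α := fun _ ↦ M.Num) v a

/-- Predicates of tuples that are defined by bounded quantifier formulas with parameters. -/
inductive IsBounded (M : SecondOrderStructure.{u}) : {n : ℕ} → ((Fin n → M.Num) → Prop) → Prop
  | eq {n : ℕ} {s t : (Fin n → M.Num) → M.Num} :
      IsPolynomial M s → IsPolynomial M t → IsBounded M fun v ↦ s v = t v
  | lt {n : ℕ} {s t : (Fin n → M.Num) → M.Num} :
      IsPolynomial M s → IsPolynomial M t → IsBounded M fun v ↦ s v < t v
  | mem {n : ℕ} {t : (Fin n → M.Num) → M.Num} (X : M.sets) :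
      IsPolynomial M t → IsBounded M fun v ↦ t v ∈ (X : Set M.Num)
  | not {n : ℕ} {P : (Fin n → M.Num) → Prop} : IsBounded M P → IsBounded M fun v ↦ ¬ P v
  | and {n : ℕ} {P Q : (Fin n → M.Num) → Prop} :
      IsBounded M P → IsBounded M Q → IsBounded M fun v ↦ P v ∧ Q v
  | bexSnoc {n : ℕ} {t : (Fin n → M.Num) → M.Num} {P : (Fin (n + 1) → M.Num) → Prop} :
      IsPolynomial M t → IsBounded M P → IsBounded M fun v ↦ ∃ a, a < t v ∧ P (snoc v a)

theorem IsPolynomial.subst {t : (Fin n → M.Num) → M.Num} (ht : IsPolynomial M t)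
    {g : Fin n → (Fin m → M.Num) → M.Num} (hg : ∀ i, IsPolynomial M (g i)) :
    IsPolynomial M fun v ↦ t fun i ↦ g i v := by
  induction ht with
  | var i => exact hg i
  | const a => exact .const a
  | add _ _ hs ht => exact .add hs ht
  | mul _ _ hs ht => exact .mul hs ht

theorem IsPolynomial.weaken {t : (Fin n → M.Num) → M.Num} (ht : IsPolynomial M t) :
    IsPolynomial M fun v : Fin (n + 1) → M.Num ↦ t fun i ↦ v i.castSucc :=
  ht.subst fun i ↦ .var i.castSucc

theorem IsPolynomial.snoc {g : Fin n → (Fin m → M.Num) → M.Num} (hg : ∀ i, IsPolynomial M (g i))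
    {f : (Fin m → M.Num) → M.Num} (hf : IsPolynomial M f) (i : Fin (n + 1)) :
    IsPolynomial M fun v ↦ snoc (fun j ↦ g j v) (f v) i := by
  refine Fin.lastCases ?_ (fun j ↦ ?_) i
  · simpa using hf
  · simpa using hg j

theorem IsBounded.congr {P Q : (Fin n → M.Num) → Prop} (hP : IsBounded M P)
    (h : ∀ v, Q v ↔ P v) : IsBounded M Q := by
  rwa [show Q = P from funext fun v ↦ propext (h v)]

theorem IsBounded.subst {P : (Fin n → M.Num) → Prop} (hP : IsBounded M P)
    {g : Fin n → (Fin m → M.Num) → M.Num} (hg : ∀ i, IsPolynomial M (g i)) :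
    IsBounded M fun v ↦ P fun i ↦ g i v := by
  induction hP generalizing m with
  | eq hs ht => exact .eq (hs.subst hg) (ht.subst hg)
  | lt hs ht => exact .lt (hs.subst hg) (ht.subst hg)
  | mem X ht => exact .mem X (ht.subst hg)
  | not _ h => exact .not (h hg)
  | and _ _ hP hQ => exact .and (hP hg) (hQ hg)
  | bexSnoc ht _ hP =>
    refine (IsBounded.bexSnoc (ht.subst hg)
      (hP (.snoc (fun j ↦ (hg j).weaken) (.var (Fin.last m))))).congr fun v ↦ ?_
    simp

theorem IsBounded.bex {t : (Fin n → M.Num) → M.Num} {P : (Fin n → M.Num) → M.Num → Prop}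
    (ht : IsPolynomial M t)
    (hP : IsBounded M fun w : Fin (n + 1) → M.Num ↦ P (fun i ↦ w i.castSucc) (w (Fin.last n))) :
    IsBounded M fun v ↦ ∃ a, a < t v ∧ P v a :=
  (IsBounded.bexSnoc ht hP).congr fun v ↦ by simp

theorem IsBounded.or {P Q : (Fin n → M.Num) → Prop} (hP : IsBounded M P) (hQ : IsBounded M Q) :
    IsBounded M fun v ↦ P v ∨ Q v :=
  (IsBounded.not (.and (.not hP) (.not hQ))).congr fun v ↦ by tauto

theorem IsBounded.imp {P Q : (Fin n → M.Num) → Prop} (hP : IsBounded M P) (hQ : IsBounded M Q) :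
    IsBounded M fun v ↦ P v → Q v :=
  (IsBounded.not (.and hP (.not hQ))).congr fun v ↦ by tauto

theorem IsBounded.ball {t : (Fin n → M.Num) → M.Num} {P : (Fin n → M.Num) → M.Num → Prop}
    (ht : IsPolynomial M t)
    (hP : IsBounded M fun w : Fin (n + 1) → M.Num ↦ P (fun i ↦ w i.castSucc) (w (Fin.last n))) :
    IsBounded M fun v ↦ ∀ a, a < t v → P v a :=
  (IsBounded.not (.bex (P := fun v a ↦ ¬ P v a) ht (.not hP))).congr fun v ↦ by
    push Not; rfl

/-! ### Formulas for definable predicates -/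

/-- The entries of a tuple are the values of the number variables with even index. The variables
with odd index are reserved for parameters. -/
def evenEntries (n : ℕ) (e : ℕ → M.Num) : Fin n → M.Num := fun i ↦ e (2 * i)

theorem evenEntries_update (e : ℕ → M.Num) (a : M.Num) :
    evenEntries n (Function.update e (2 * n) a) = evenEntries n e :=
  funext fun i ↦ Function.update_of_ne (by lia) _ _

theorem evenEntries_succ_update (e : ℕ → M.Num) (a : M.Num) :
    evenEntries (n + 1) (Function.update e (2 * n) a) = snoc (evenEntries n e) a := by
  funext i
  refine Fin.lastCases ?_ (fun j ↦ ?_) i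
  · simp [evenEntries]
  · simp only [evenEntries, Fin.snoc_castSucc, Fin.val_castSucc]
    exact Function.update_of_ne (by lia) _ _

/-- The number variables with odd index and the set variables list the parameters `l`, starting
with the variables of number `K`. The offset `K` keeps the parameters of the two parts of a formula
apart. -/
def ListsParams (e : ℕ → M.Num) (E : ℕ → M.sets) : ℕ → List (M.Num × M.sets) → Prop
  | _, [] => True
  | K, (a, X) :: l => e (2 * K + 1) = a ∧ E K = X ∧ ListsParams e E (K + 1) l

theorem listsParams_append {e : ℕ → M.Num} {E : ℕ → M.sets} {K : ℕ}
    {l l' : List (M.Num × M.sets)} :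
    ListsParams e E K (l ++ l') ↔ ListsParams e E K l ∧ ListsParams e E (K + l.length) l' := by
  induction l generalizing K with
  | nil => simp [ListsParams]
  | cons p l ih => simp [ListsParams, ih, and_assoc, Nat.add_assoc, Nat.add_comm 1]

theorem listsParams_congr {e e' : ℕ → M.Num} {E : ℕ → M.sets} {K : ℕ}
    {l : List (M.Num × M.sets)} (h : ∀ k, e (2 * k + 1) = e' (2 * k + 1)) :
    ListsParams e E K l ↔ ListsParams e' E K l := by
  induction l generalizing K with
  | nil => rfl
  | cons p l ih => simp only [ListsParams, h, ih]

theorem exists_listsParams (K : ℕ) (l : List (M.Num × M.sets)) :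
    ∃ (e : ℕ → M.Num) (E : ℕ → M.sets), ListsParams e E K l := by
  obtain ⟨X₀, hX₀⟩ := M.sets_nonempty
  let p (k : ℕ) : M.Num × M.sets := l.getD (k - K) (0, ⟨X₀, hX₀⟩)
  suffices ∀ l' l'', l = l'' ++ l' → ListsParams (fun k ↦ (p (k / 2)).1) (fun k ↦ (p k).2)
      (K + l''.length) l' from ⟨_, _, this l [] rfl⟩
  intro l'
  induction l' with
  | nil => exact fun _ _ ↦ trivial
  | cons q l' ih =>
    intro l'' hl
    have hq : p (K + l''.length) = q := by simp [p, hl]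
    refine ⟨?_, congrArg Prod.snd hq, ?_⟩
    · simp only [show (2 * (K + l''.length) + 1) / 2 = K + l''.length by lia, hq]
    · simpa [Nat.add_assoc] using ih (l'' ++ [q]) (by simp [hl])

theorem IsPolynomial.exists_term {t : (Fin n → M.Num) → M.Num} (ht : IsPolynomial M t) (K : ℕ) :
    ∃ (s : Term) (l : List (M.Num × M.sets)), (∀ k, n ≤ k → ¬ s.Occurs (2 * k)) ∧
      ∀ e E, ListsParams e E K l → M.value e s = t (evenEntries n e) := by
  induction ht generalizing K with
  | var i =>
    refine ⟨.var (2 * i), [], fun k hk h ↦ ?_, fun _ _ _ ↦ rfl⟩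
    have : 2 * k = 2 * (i : ℕ) := h
    lia
  | const a =>
    obtain ⟨X, hX⟩ := M.sets_nonempty
    refine ⟨.var (2 * K + 1), [(a, ⟨X, hX⟩)], fun k _ h ↦ ?_, fun _ _ h ↦ h.1⟩
    have : 2 * k = 2 * K + 1 := h
    lia
  | add _ _ hs ht =>
    obtain ⟨s, l, os, hs⟩ := hs K
    obtain ⟨t, l', ot, ht⟩ := ht (K + l.length)
    refine ⟨.add s t, l ++ l', fun k hk h ↦ h.elim (os k hk) (ot k hk), fun e E h ↦ ?_⟩
    rw [listsParams_append] at h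
    rw [value, hs e E h.1, ht e E h.2]
  | mul _ _ hs ht =>
    obtain ⟨s, l, os, hs⟩ := hs K
    obtain ⟨t, l', ot, ht⟩ := ht (K + l.length)
    refine ⟨.mul s t, l ++ l', fun k hk h ↦ h.elim (os k hk) (ot k hk), fun e E h ↦ ?_⟩
    rw [listsParams_append] at h
    rw [value, hs e E h.1, ht e E h.2]

theorem IsBounded.exists_formula {P : (Fin n → M.Num) → Prop} (hP : IsBounded M P) (K : ℕ) :
    ∃ (φ : Formula) (l : List (M.Num × M.sets)), φ.IsBounded ∧
      ∀ e E, ListsParams e E K l → (M.Sat e E φ ↔ P (evenEntries n e)) := by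
  induction hP generalizing K with
  | eq hs ht =>
    obtain ⟨s, l, -, hs⟩ := hs.exists_term K
    obtain ⟨t, l', -, ht⟩ := ht.exists_term (K + l.length)
    refine ⟨.eq s t, l ++ l', .eq _ _, fun e E h ↦ ?_⟩
    rw [listsParams_append] at h
    rw [Sat, hs e E h.1, ht e E h.2]
  | lt hs ht =>
    obtain ⟨s, l, -, hs⟩ := hs.exists_term K
    obtain ⟨t, l', -, ht⟩ := ht.exists_term (K + l.length)
    refine ⟨.lt s t, l ++ l', .lt _ _, fun e E h ↦ ?_⟩
    rw [listsParams_append] at h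
    rw [Sat, hs e E h.1, ht e E h.2]
  | mem X ht =>
    obtain ⟨t, l, -, ht⟩ := ht.exists_term (K + 1)
    refine ⟨.mem t K, (0, X) :: l, .mem _ _, fun e E h ↦ ?_⟩
    rw [Sat, ht e E h.2.2, h.2.1]
  | not _ h =>
    obtain ⟨φ, l, bφ, h⟩ := h K
    exact ⟨.not φ, l, .not bφ, fun e E hl ↦ by rw [Sat, h e E hl]⟩
  | and _ _ hP hQ =>
    obtain ⟨φ, l, bφ, hφ⟩ := hP K
    obtain ⟨ψ, l', bψ, hψ⟩ := hQ (K + l.length)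
    refine ⟨.and φ ψ, l ++ l', .and bφ bψ, fun e E h ↦ ?_⟩
    rw [listsParams_append] at h
    rw [Sat, hφ e E h.1, hψ e E h.2]
  | @bexSnoc n t P ht _ hP =>
    obtain ⟨s, l, os, hs⟩ := ht.exists_term K
    obtain ⟨φ, l', bφ, hφ⟩ := hP (K + l.length)
    refine ⟨.ex (2 * n) (.and (.lt (.var (2 * n)) s) φ), l ++ l', .ex _ _ (os n le_rfl) bφ,
      fun e E h ↦ exists_congr fun a ↦ ?_⟩
    rw [listsParams_append] at h
    have hodd (k : ℕ) : Function.update e (2 * n) a (2 * k + 1) = e (2 * k + 1) :=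
      Function.update_of_ne (by lia) _ _
    rw [Sat, Sat, hs _ E ((listsParams_congr hodd).2 h.1), hφ _ E ((listsParams_congr hodd).2 h.2),
      evenEntries_update, evenEntries_succ_update, value, Function.update_self]

/-- `Σ⁰₁` predicates of tuples, with parameters. This is a class so that definability of explicitly
given predicates is found by instance search. -/
class SigmaOne (M : SecondOrderStructure.{u}) {n : ℕ} (P : (Fin n → M.Num) → Prop) : Prop where
  exists_isBounded : ∃ Q : (Fin (n + 1) → M.Num) → Prop, IsBounded M Q ∧
    ∀ v, P v ↔ ∃ a, Q (snoc v a)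

theorem SigmaOne.exists_formula {P : M.Num → Prop}
    (hP : SigmaOne M fun v : Fin 1 → M.Num ↦ P (v 0)) (K : ℕ) :
    ∃ (x : ℕ) (θ : Formula) (l : List (M.Num × M.sets)), θ.IsBounded ∧
      ∀ e E, ListsParams e E K l → ∀ a, M.Sat (Function.update e 0 a) E (.ex x θ) ↔ P a := by
  obtain ⟨Q, hQ, hPQ⟩ := hP.exists_isBounded
  obtain ⟨θ, l, hθ, hQθ⟩ := hQ.exists_formula K
  refine ⟨2 * 1, θ, l, hθ, fun e E hl a ↦ (exists_congr fun b ↦ ?_).trans (hPQ fun _ ↦ a).symm⟩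
  have hodd (k : ℕ) :
      Function.update (Function.update e 0 a) (2 * 1) b (2 * k + 1) = e (2 * k + 1) := by
    rw [Function.update_of_ne (by lia), Function.update_of_ne (by lia)]
  have heven : evenEntries 1 (Function.update e 0 a) = fun _ ↦ a :=
    funext fun i ↦ by simp [evenEntries, Fin.fin_one_eq_zero i]
  rw [hQθ _ E ((listsParams_congr hodd).2 hl), evenEntries_succ_update, heven]

theorem IsBounded.sigmaOne {P : (Fin n → M.Num) → Prop} (hP : IsBounded M P) : SigmaOne M P :=
  ⟨fun w ↦ P fun i ↦ w i.castSucc, hP.subst fun i ↦ .var i.castSucc, fun v ↦ by simp⟩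

theorem SigmaOne.congr {P Q : (Fin n → M.Num) → Prop} (hP : SigmaOne M P)
    (h : ∀ v, Q v ↔ P v) : SigmaOne M Q := by
  rwa [show Q = P from funext fun v ↦ propext (h v)]

end Definability

/-! ## Arithmetic in models of `RCA₀` -/

section Arithmetic

variable {M : SecondOrderStructure.{u}} [hM : Fact M.ModelsRCA]

theorem basicAxioms : M.BasicAxioms := hM.out.basic

theorem sigma_induction {P : M.Num → Prop} (hP : SigmaOne M fun v : Fin 1 → M.Num ↦ P (v 0))
    (zero : P 0) (succ : ∀ n, P n → P (n + 1)) (n : M.Num) : P n := by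
  obtain ⟨x, θ, l, hθ, h⟩ := hP.exists_formula 0
  obtain ⟨e, E, hl⟩ := exists_listsParams 0 l
  have h := h e E hl
  exact (h n).1 (hM.out.induction _ ⟨x, θ, hθ, rfl⟩ 0 e E ((h 0).2 zero)
    (fun k hk ↦ (h _).2 (succ k ((h k).1 hk))) n)

theorem bounded_induction {P : M.Num → Prop} (hP : IsBounded M fun v : Fin 1 → M.Num ↦ P (v 0))
    (zero : P 0) (succ : ∀ n, P n → P (n + 1)) (n : M.Num) : P n :=
  sigma_induction hP.sigmaOne zero succ n

namespace Num

protected theorem add_assoc (a b c : M.Num) : a + b + c = a + (b + c) := by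
  induction c using bounded_induction with
  | hP => exact .eq (.add (.const _) (.var 0)) (.add (.const _) (.add (.const _) (.var 0)))
  | zero => rw [basicAxioms.add_zero, basicAxioms.add_zero]
  | succ n h => rw [basicAxioms.add_succ, basicAxioms.add_succ, basicAxioms.add_succ, h]

protected theorem zero_add (a : M.Num) : 0 + a = a := by
  induction a using bounded_induction with
  | hP => exact .eq (.add (.const _) (.var 0)) (.var 0)
  | zero => rw [basicAxioms.add_zero]
  | succ n h => rw [basicAxioms.add_succ, h]

protected theorem succ_add (a b : M.Num) : a + 1 + b = a + b + 1 := by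
  induction b using bounded_induction with
  | hP => exact .eq (.add (.const _) (.var 0)) (.add (.add (.const _) (.var 0)) (.const _))
  | zero => rw [basicAxioms.add_zero, basicAxioms.add_zero]
  | succ n h => rw [basicAxioms.add_succ, basicAxioms.add_succ, h]

protected theorem add_comm (a b : M.Num) : a + b = b + a := by
  induction b using bounded_induction with
  | hP => exact .eq (.add (.const _) (.var 0)) (.add (.var 0) (.const _))
  | zero => rw [basicAxioms.add_zero, Num.zero_add]
  | succ n h => rw [basicAxioms.add_succ, Num.succ_add, h]

instance : AddCommMonoid M.Num where
  add_assoc := Num.add_assoc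
  zero_add := Num.zero_add
  add_zero := basicAxioms.add_zero
  add_comm := Num.add_comm
  nsmul := nsmulRec

protected theorem zero_mul (a : M.Num) : 0 * a = 0 := by
  induction a using bounded_induction with
  | hP => exact .eq (.mul (.const _) (.var 0)) (.const _)
  | zero => rw [basicAxioms.mul_zero]
  | succ n h => rw [basicAxioms.mul_succ, h, add_zero]

protected theorem succ_mul (a b : M.Num) : (a + 1) * b = a * b + b := by
  induction b using bounded_induction with
  | hP => exact .eq (.mul (.const _) (.var 0)) (.add (.mul (.const _) (.var 0)) (.var 0))
  | zero => rw [basicAxioms.mul_zero, basicAxioms.mul_zero, add_zero]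
  | succ n h => rw [basicAxioms.mul_succ, basicAxioms.mul_succ, h]; abel

protected theorem mul_comm (a b : M.Num) : a * b = b * a := by
  induction b using bounded_induction with
  | hP => exact .eq (.mul (.const _) (.var 0)) (.mul (.var 0) (.const _))
  | zero => rw [basicAxioms.mul_zero, Num.zero_mul]
  | succ n h => rw [basicAxioms.mul_succ, Num.succ_mul, h]

protected theorem mul_add (a b c : M.Num) : a * (b + c) = a * b + a * c := by
  induction c using bounded_induction with
  | hP =>
    exact .eq (.mul (.const _) (.add (.const _) (.var 0)))
      (.add (.const _) (.mul (.const _) (.var 0)))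
  | zero => rw [add_zero, basicAxioms.mul_zero, add_zero]
  | succ n h => rw [basicAxioms.add_succ, basicAxioms.mul_succ, basicAxioms.mul_succ, h, add_assoc]

protected theorem mul_assoc (a b c : M.Num) : a * b * c = a * (b * c) := by
  induction c using bounded_induction with
  | hP => exact .eq (.mul (.const _) (.var 0)) (.mul (.const _) (.mul (.const _) (.var 0)))
  | zero => rw [basicAxioms.mul_zero, basicAxioms.mul_zero, basicAxioms.mul_zero]
  | succ n h => rw [basicAxioms.mul_succ, basicAxioms.mul_succ, Num.mul_add, h]

protected theorem mul_one (a : M.Num) : a * 1 = a := by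
  rw [← zero_add (1 : M.Num), basicAxioms.mul_succ, basicAxioms.mul_zero, zero_add]

instance : CommSemiring M.Num where
  left_distrib := Num.mul_add
  right_distrib a b c := by
    rw [Num.mul_comm (a + b), Num.mul_add, Num.mul_comm c, Num.mul_comm c]
  zero_mul := Num.zero_mul
  mul_zero := basicAxioms.mul_zero
  mul_assoc := Num.mul_assoc
  one_mul a := by rw [Num.mul_comm, Num.mul_one]
  mul_one := Num.mul_one
  mul_comm := Num.mul_comm

protected theorem lt_trans {a b c : M.Num} (hab : a < b) : b < c → a < c := by
  induction c using bounded_induction with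
  | hP => exact .imp (.lt (.const _) (.var 0)) (.lt (.const _) (.var 0))
  | zero => exact fun h ↦ (basicAxioms.not_lt_zero _ h).elim
  | succ n h =>
    rw [basicAxioms.lt_succ, basicAxioms.lt_succ]
    rintro (h' | rfl)
    · exact .inl (h h')
    · exact .inl hab

protected theorem lt_succ_self (a : M.Num) : a < a + 1 := (basicAxioms.lt_succ _ _).2 (.inr rfl)

protected theorem succ_lt_succ {a b : M.Num} : a < b → a + 1 < b + 1 := by
  induction b using bounded_induction with
  | hP =>
    exact .imp (.lt (.const _) (.var 0))
      (.lt (.add (.const _) (.const _)) (.add (.var 0) (.const _)))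
  | zero => exact fun h ↦ (basicAxioms.not_lt_zero _ h).elim
  | succ n h =>
    intro h'
    rcases (basicAxioms.lt_succ _ _).1 h' with h' | rfl
    · exact Num.lt_trans (h h') (Num.lt_succ_self _)
    · exact Num.lt_succ_self _

protected theorem lt_irrefl (a : M.Num) : ¬ a < a := by
  induction a using bounded_induction with
  | hP => exact .not (.lt (.var 0) (.var 0))
  | zero => exact basicAxioms.not_lt_zero _
  | succ n h =>
    intro h'
    rcases (basicAxioms.lt_succ _ _).1 h' with h' | h'
    · exact h (Num.lt_trans (Num.lt_succ_self _) h')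
    · exact h (by simpa only [h'] using Num.lt_succ_self n)

protected theorem pos_or_zero_eq (a : M.Num) : 0 < a ∨ 0 = a := by
  induction a using bounded_induction with
  | hP => exact .or (.lt (.const _) (.var 0)) (.eq (.const _) (.var 0))
  | zero => exact .inr rfl
  | succ n h => exact .inl ((basicAxioms.lt_succ _ _).2 h)

protected theorem lt_trichotomy (a b : M.Num) : a < b ∨ a = b ∨ b < a := by
  induction a using bounded_induction with
  | hP =>
    exact .or (.lt (.var 0) (.const _)) (.or (.eq (.var 0) (.const _))
      (.lt (.const _) (.var 0)))
  | zero => rcases Num.pos_or_zero_eq b with h | h <;> simp [h]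
  | succ n h =>
    rcases h with h | rfl | h
    · rcases (basicAxioms.lt_succ _ _).1 (Num.succ_lt_succ h) with h | h <;> simp [h]
    · exact .inr (.inr (Num.lt_succ_self _))
    · exact .inr (.inr (Num.lt_trans h (Num.lt_succ_self _)))

noncomputable instance : LinearOrder M.Num where
  le a b := a < b ∨ a = b
  lt a b := a < b
  le_refl a := .inr rfl
  le_trans a b c := by
    rintro (h | rfl) (h' | rfl)
    · exact .inl (Num.lt_trans h h')
    · exact .inl h
    · exact .inl h'
    · exact .inr rfl
  le_antisymm a b := by
    rintro (h | rfl) (h' | h')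
    · exact (Num.lt_irrefl _ (Num.lt_trans h h')).elim
    · exact h'.symm
    · rfl
    · rfl
  le_total a b := by rcases Num.lt_trichotomy a b with h | rfl | h <;> simp [*]
  lt_iff_le_not_ge a b := by
    constructor
    · intro h
      refine ⟨.inl h, ?_⟩
      rintro (h' | rfl)
      · exact Num.lt_irrefl _ (Num.lt_trans h h')
      · exact Num.lt_irrefl _ h
    · rintro ⟨h | rfl, h'⟩
      · exact h
      · exact (h' (.inr rfl)).elim
  toDecidableLE := Classical.decRel _

noncomputable instance : SuccOrder M.Num :=
  .ofSuccLeIff (· + 1) fun {a b} ↦ by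
    rw [← not_lt, not_iff_comm, not_lt]
    exact (basicAxioms.lt_succ b a).symm

noncomputable instance : SuccAddOrder M.Num where
  succ_eq_add_one _ := rfl

instance : NoMaxOrder M.Num where
  exists_gt a := ⟨a + 1, Num.lt_succ_self a⟩

protected theorem add_lt_add_right {a b : M.Num} (h : a < b) (c : M.Num) : a + c < b + c := by
  induction c using bounded_induction with
  | hP => exact .lt (.add (.const _) (.var 0)) (.add (.const _) (.var 0))
  | zero => rwa [add_zero, add_zero]
  | succ n h => rw [← add_assoc, ← add_assoc]; exact Num.succ_lt_succ h

instance : IsOrderedCancelAddMonoid M.Num where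
  add_le_add_left a b h c := by
    rcases h with h | rfl
    · exact .inl (Num.add_lt_add_right h c)
    · exact .inr rfl
  le_of_add_le_add_left a b c := by
    rw [add_comm a, add_comm a]
    exact fun h ↦ le_of_not_gt fun h' ↦ not_lt_of_ge h (Num.add_lt_add_right h' a)

protected theorem mul_lt_mul_of_pos_right {a b : M.Num} (h : a < b) (c : M.Num) :
    0 < c → a * c < b * c := by
  induction c using bounded_induction with
  | hP =>
    exact .imp (.lt (.const _) (.var 0))
      (.lt (.mul (.const _) (.var 0)) (.mul (.const _) (.var 0)))
  | zero => exact fun h ↦ (lt_irrefl _ h).elim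
  | succ n ih =>
    intro _
    rw [mul_add, mul_add, mul_one, mul_one]
    rcases Num.pos_or_zero_eq n with hn | rfl
    · exact add_lt_add (ih hn) h
    · simpa using h

instance : IsStrictOrderedRing M.Num where
  zero_le_one := Num.pos_or_zero_eq _
  exists_pair_ne := ⟨0, 1, by simp⟩
  mul_lt_mul_of_pos_left c hc a b h := by
    rw [mul_comm c, mul_comm c]
    exact Num.mul_lt_mul_of_pos_right h c hc
  mul_lt_mul_of_pos_right c hc a b h := Num.mul_lt_mul_of_pos_right h c hc

protected theorem exists_eq_add_of_le {a b : M.Num} (h : a ≤ b) : ∃ c, b = a + c := by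
  suffices ∃ c, b < a ∨ b = a + c by
    obtain ⟨c, hc⟩ := this
    exact ⟨c, hc.resolve_left h.not_gt⟩
  clear h
  induction b using sigma_induction with
  | hP => exact ⟨fun w ↦ w 0 < a ∨ w 0 = a + w 1,
      .or (.lt (.var 0) (.const _)) (.eq (.var 0) (.add (.const _) (.var 1))), fun _ ↦ .rfl⟩
  | zero => exact ⟨0, by simpa [eq_comm] using Num.pos_or_zero_eq a⟩
  | succ n h =>
    obtain ⟨c, h | rfl⟩ := h
    · exact ⟨0, by simpa only [add_zero] using (Order.add_one_le_iff.2 h).lt_or_eq⟩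
    · exact ⟨c + 1, .inr (add_assoc _ _ _)⟩

instance : CanonicallyOrderedAdd M.Num where
  exists_add_of_le := Num.exists_eq_add_of_le
  le_add_self _ b := le_add_of_nonneg_left (Num.pos_or_zero_eq b)
  le_self_add _ b := le_add_of_nonneg_right (Num.pos_or_zero_eq b)

noncomputable instance : Sub M.Num where
  sub a b := if h : b ≤ a then (exists_add_of_le h).choose else 0

protected theorem add_sub_of_le {a b : M.Num} (h : b ≤ a) : b + (a - b) = a := by
  rw [show a - b = (exists_add_of_le h).choose from dif_pos h]
  exact (exists_add_of_le h).choose_spec.symm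

protected theorem sub_eq_zero_of_lt {a b : M.Num} (h : a < b) : a - b = 0 := dif_neg h.not_ge

instance : OrderedSub M.Num where
  tsub_le_iff_right a b _ := by
    rcases le_or_gt b a with h | h
    · conv_rhs => rw [← Num.add_sub_of_le h, add_comm]
      rw [add_le_add_iff_right]
    · simp [Num.sub_eq_zero_of_lt h, h.le.trans le_add_self]

end Num

theorem exists_eq_add_one {a : M.Num} (h : a ≠ 0) : ∃ m, a = m + 1 := by
  obtain ⟨m, rfl⟩ := exists_add_of_le (Order.one_le_iff_ne_zero.2 h)
  exact ⟨m, add_comm _ _⟩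

theorem le_of_dvd {a b : M.Num} (h : a ∣ b) (hb : b ≠ 0) : a ≤ b := by
  obtain ⟨c, rfl⟩ := h
  exact le_mul_of_one_le_right zero_le (Order.one_le_iff_ne_zero.2 (right_ne_zero_of_mul hb))

end Arithmetic

/-! ## `Σ⁰₁` and `Δ⁰₁` definability -/

section Closure

variable {M : SecondOrderStructure.{u}} {n m : ℕ}

theorem IsBounded.subst_snoc {P : (Fin (n + 1) → M.Num) → Prop} (hP : IsBounded M P)
    {g : Fin n → (Fin m → M.Num) → M.Num} (hg : ∀ i, IsPolynomial M (g i))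
    {f : (Fin m → M.Num) → M.Num} (hf : IsPolynomial M f) :
    IsBounded M fun v ↦ P (snoc (fun i ↦ g i v) (f v)) :=
  hP.subst (.snoc hg hf)

theorem SigmaOne.subst {P : (Fin n → M.Num) → Prop} (hP : SigmaOne M P)
    {g : Fin n → (Fin m → M.Num) → M.Num} (hg : ∀ i, IsPolynomial M (g i)) :
    SigmaOne M fun v ↦ P fun i ↦ g i v := by
  obtain ⟨Q, hQ, hPQ⟩ := hP.exists_isBounded
  refine ⟨_, hQ.subst_snoc (fun i ↦ (hg i).weaken) (.var (Fin.last m)), fun v ↦ ?_⟩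
  simp [hPQ]

theorem SigmaOne.subst_snoc {P : (Fin (n + 1) → M.Num) → Prop} (hP : SigmaOne M P)
    {g : Fin n → (Fin m → M.Num) → M.Num} (hg : ∀ i, IsPolynomial M (g i))
    {f : (Fin m → M.Num) → M.Num} (hf : IsPolynomial M f) :
    SigmaOne M fun v ↦ P (snoc (fun i ↦ g i v) (f v)) :=
  hP.subst (.snoc hg hf)

/-- Functions of tuples with a `Σ⁰₁` graph, with parameters. This is a class so that definability
of explicitly given functions is found by instance search. -/
class Recursive (M : SecondOrderStructure.{u}) {n : ℕ} (f : (Fin n → M.Num) → M.Num) : Prop where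
  graph : SigmaOne M fun w : Fin (n + 1) → M.Num ↦ f (fun i ↦ w i.castSucc) = w (Fin.last n)

theorem IsPolynomial.recursive {f : (Fin n → M.Num) → M.Num} (hf : IsPolynomial M f) :
    Recursive M f :=
  ⟨(IsBounded.eq hf.weaken (.var _)).sigmaOne⟩

theorem Recursive.weaken {f : (Fin n → M.Num) → M.Num} (hf : Recursive M f) :
    Recursive M fun v : Fin (n + 1) → M.Num ↦ f fun i ↦ v i.castSucc :=
  ⟨(hf.graph.subst_snoc (fun j : Fin n ↦ .var j.castSucc.castSucc)
    (.var (Fin.last (n + 1)))).congr fun v ↦ by simp⟩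

theorem Recursive.of_graph {f : (Fin n → M.Num) → M.Num} (P : (Fin n → M.Num) → M.Num → Prop)
    [hP : SigmaOne M fun w : Fin (n + 1) → M.Num ↦ P (fun i ↦ w i.castSucc) (w (Fin.last n))]
    (h : ∀ v a, f v = a ↔ P v a) : Recursive M f :=
  ⟨hP.congr fun _ ↦ h _ _⟩

/-- `Δ⁰₁` predicates of tuples, with parameters. This is a class so that definability of explicitly
given predicates is found by instance search. -/
class DeltaOne (M : SecondOrderStructure.{u}) {n : ℕ} (P : (Fin n → M.Num) → Prop) : Prop where
  sigmaOne : SigmaOne M P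
  sigmaOne_not : SigmaOne M fun v ↦ ¬ P v

attribute [instance] DeltaOne.sigmaOne

theorem DeltaOne.congr {P Q : (Fin n → M.Num) → Prop} (hP : DeltaOne M P) (h : ∀ v, Q v ↔ P v) :
    DeltaOne M Q := by
  rwa [show Q = P from funext fun v ↦ propext (h v)]

variable [hM : Fact M.ModelsRCA]

instance SigmaOne.and {P Q : (Fin n → M.Num) → Prop} [hP : SigmaOne M P] [hQ : SigmaOne M Q] :
    SigmaOne M fun v ↦ P v ∧ Q v := by
  obtain ⟨P', hP', hPP'⟩ := hP.exists_isBounded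
  obtain ⟨Q', hQ', hQQ'⟩ := hQ.exists_isBounded
  refine ⟨fun w ↦ (∃ a, a < w (Fin.last n) ∧ P' (snoc (fun i ↦ w i.castSucc) a)) ∧
      ∃ a, a < w (Fin.last n) ∧ Q' (snoc (fun i ↦ w i.castSucc) a),
    .and (.bex (.var _) (hP'.subst_snoc (fun _ ↦ .var _) (.var _)))
      (.bex (.var _) (hQ'.subst_snoc (fun _ ↦ .var _) (.var _))), fun v ↦ ?_⟩
  simp only [hPP', hQQ', Fin.snoc_last, Fin.snoc_castSucc]
  constructor
  · rintro ⟨⟨a, ha⟩, b, hb⟩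
    exact ⟨max a b + 1, ⟨a, Order.lt_add_one_iff.2 (le_max_left _ _), ha⟩,
      b, Order.lt_add_one_iff.2 (le_max_right _ _), hb⟩
  · rintro ⟨c, ⟨a, -, ha⟩, b, -, hb⟩
    exact ⟨⟨a, ha⟩, b, hb⟩

instance SigmaOne.or {P Q : (Fin n → M.Num) → Prop} [hP : SigmaOne M P] [hQ : SigmaOne M Q] :
    SigmaOne M fun v ↦ P v ∨ Q v := by
  obtain ⟨P', hP', hPP'⟩ := hP.exists_isBounded
  obtain ⟨Q', hQ', hQQ'⟩ := hQ.exists_isBounded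
  exact ⟨_, hP'.or hQ', fun v ↦ by rw [hPP', hQQ', exists_or]⟩

theorem SigmaOne.exSnoc {P : (Fin (n + 1) → M.Num) → Prop} (hP : SigmaOne M P) :
    SigmaOne M fun v ↦ ∃ a, P (snoc v a) := by
  obtain ⟨Q, hQ, hPQ⟩ := hP.exists_isBounded
  refine ⟨fun w ↦ ∃ a, a < w (Fin.last n) ∧ ∃ b, b < w (Fin.last n) ∧
      Q (snoc (snoc (fun i ↦ w i.castSucc) a) b),
    .bex (.var _) (.bex (.var (Fin.last n).castSucc) (hQ.subst_snoc
      (.snoc (fun _ ↦ .var _) (.var (Fin.last (n + 1)).castSucc)) (.var _))), fun v ↦ ?_⟩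
  simp only [hPQ, Fin.snoc_last, Fin.snoc_castSucc]
  constructor
  · rintro ⟨a, b, hb⟩
    exact ⟨max a b + 1, a, Order.lt_add_one_iff.2 (le_max_left _ _),
      b, Order.lt_add_one_iff.2 (le_max_right _ _), hb⟩
  · rintro ⟨c, a, -, b, -, hb⟩
    exact ⟨a, b, hb⟩

instance SigmaOne.ex {P : (Fin n → M.Num) → M.Num → Prop}
    [hP : SigmaOne M fun w : Fin (n + 1) → M.Num ↦ P (fun i ↦ w i.castSucc) (w (Fin.last n))] :
    SigmaOne M fun v ↦ ∃ a, P v a :=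
  hP.exSnoc.congr fun v ↦ by simp

theorem collection {R : M.Num → M.Num → Prop}
    (hR : IsBounded M fun v : Fin 2 → M.Num ↦ R (v 0) (v 1)) (c : M.Num)
    (h : ∀ a, a < c → ∃ b, R a b) : ∃ z, ∀ a, a < c → ∃ b, b < z ∧ R a b := by
  suffices ∀ d, ∃ z, ∀ a, a < d → a < c → ∃ b, b < z ∧ R a b by
    obtain ⟨z, hz⟩ := this c
    exact ⟨z, fun a ha ↦ hz a ha ha⟩
  intro d
  induction d using sigma_induction with
  | hP =>
    refine ⟨fun w ↦ ∀ a, a < w 0 → a < c → ∃ b, b < w 1 ∧ R a b, .ball (.var _)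
      (.imp (.lt (.var _) (.const _)) (.bex (.var (Fin.castSucc 1)) ?_)), fun v ↦ .rfl⟩
    exact hR.subst (g := ![fun w ↦ w (Fin.castSucc (Fin.last 2)), fun w ↦ w (Fin.last 3)])
      fun i ↦ by fin_cases i <;> exact .var _
  | zero => exact ⟨0, fun a ha ↦ (not_lt_zero ha).elim⟩
  | succ d hd =>
    obtain ⟨z, hz⟩ := hd
    by_cases hdc : d < c
    · obtain ⟨b, hb⟩ := h d hdc
      refine ⟨max z (b + 1), fun a ha hac ↦ ?_⟩
      rcases (Order.lt_add_one_iff.1 ha).lt_or_eq with ha | rfl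
      · obtain ⟨b', hb', h'⟩ := hz a ha hac
        exact ⟨b', lt_max_of_lt_left hb', h'⟩
      · exact ⟨b, lt_max_of_lt_right (lt_add_one b), hb⟩
    · exact ⟨z, fun a _ hac ↦ hz a (hac.trans_le (not_lt.1 hdc)) hac⟩

theorem SigmaOne.ball_of_isPolynomial {t : (Fin n → M.Num) → M.Num} (ht : IsPolynomial M t)
    {P : (Fin n → M.Num) → M.Num → Prop}
    (hP : SigmaOne M fun w : Fin (n + 1) → M.Num ↦ P (fun i ↦ w i.castSucc) (w (Fin.last n))) :
    SigmaOne M fun v ↦ ∀ a, a < t v → P v a := by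
  obtain ⟨Q, hQ, hPQ⟩ := hP.exists_isBounded
  refine ⟨fun w ↦ ∀ a, a < t (fun i ↦ w i.castSucc) → ∃ b, b < w (Fin.last n) ∧
      Q (snoc (snoc (fun i ↦ w i.castSucc) a) b),
    .ball ht.weaken (.bex (.var (Fin.last n).castSucc) (hQ.subst_snoc
      (.snoc (fun _ ↦ .var _) (.var (Fin.last (n + 1)).castSucc)) (.var _))), fun v ↦ ?_⟩
  have hPQ' (a : M.Num) : P v a ↔ ∃ b, Q (snoc (snoc v a) b) := by
    rw [← hPQ]
    simp
  simp only [hPQ', Fin.snoc_last, Fin.snoc_castSucc]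
  constructor
  · exact collection (hQ.subst_snoc (.snoc (fun _ ↦ .const _) (.var _)) (.var _)) _
  · rintro ⟨z, hz⟩ a ha
    obtain ⟨b, -, hb⟩ := hz a ha
    exact ⟨b, hb⟩

instance Recursive.var (i : Fin n) : Recursive M fun v : Fin n → M.Num ↦ v i :=
  (IsPolynomial.var i).recursive

instance Recursive.const (a : M.Num) : Recursive M fun _ : Fin n → M.Num ↦ a :=
  (IsPolynomial.const a).recursive

theorem SigmaOne.comp_snoc {P : (Fin (n + 1) → M.Num) → Prop} (hP : SigmaOne M P)
    {f : (Fin n → M.Num) → M.Num} (hf : Recursive M f) : SigmaOne M fun v ↦ P (snoc v (f v)) := by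
  have := hf.graph
  exact (SigmaOne.and (P := fun w ↦ f (fun i ↦ w i.castSucc) = w (Fin.last n))
    (Q := P)).exSnoc.congr fun v ↦ by simp

theorem SigmaOne.comp {k : ℕ} {P : (Fin k → M.Num) → Prop} (hP : SigmaOne M P)
    {f : Fin k → (Fin n → M.Num) → M.Num} (hf : ∀ i, Recursive M (f i)) :
    SigmaOne M fun v ↦ P fun i ↦ f i v := by
  -- Variables of `P` with index below `j` are replaced by recursive functions one after the other.
  suffices ∀ (j n : ℕ) (f : Fin k → (Fin n → M.Num) → M.Num), (∀ i, Recursive M (f i)) →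
      (∀ i : Fin k, j ≤ i → IsPolynomial M (f i)) → SigmaOne M fun v ↦ P fun i ↦ f i v from
    this k n f hf fun i hi ↦ absurd i.2 (by lia)
  intro j
  induction j with
  | zero => exact fun n f _ h ↦ hP.subst fun i ↦ h i (Nat.zero_le _)
  | succ j ih =>
    intro n f hf h
    by_cases hj : j < k
    · let g (i : Fin k) (w : Fin (n + 1) → M.Num) : M.Num :=
        if (i : ℕ) = j then w (Fin.last n) else f i fun l ↦ w l.castSucc
      have hg (i : Fin k) : Recursive M (g i) := by
        by_cases hi : (i : ℕ) = j
        · simpa only [g, hi, if_true] using Recursive.var (Fin.last n)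
        · simpa only [g, hi, if_false] using (hf i).weaken
      have hg' (i : Fin k) (hji : j ≤ i) : IsPolynomial M (g i) := by
        by_cases hi : (i : ℕ) = j
        · simpa only [g, hi, if_true] using IsPolynomial.var (Fin.last n)
        · simpa only [g, hi, if_false] using (h i (by lia)).weaken
      refine ((ih (n + 1) g hg hg').comp_snoc (hf ⟨j, hj⟩)).congr fun v ↦
        iff_of_eq (congrArg P (funext fun i ↦ ?_))
      by_cases hi : (i : ℕ) = j
      · obtain rfl : i = ⟨j, hj⟩ := Fin.ext hi
        simp [g]
      · simp [g, hi]
    · exact ih n f hf fun i hi ↦ absurd i.2 (by lia)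

theorem SigmaOne.comp₂ {P : M.Num → M.Num → Prop}
    (hP : SigmaOne M fun v : Fin 2 → M.Num ↦ P (v 0) (v 1))
    (f g : (Fin n → M.Num) → M.Num) [hf : Recursive M f] [hg : Recursive M g] :
    SigmaOne M fun v ↦ P (f v) (g v) :=
  hP.comp (f := ![f, g]) fun i ↦ by fin_cases i <;> assumption

instance SigmaOne.eq {f g : (Fin n → M.Num) → M.Num} [Recursive M f] [Recursive M g] :
    SigmaOne M fun v ↦ f v = g v :=
  SigmaOne.comp₂ (IsBounded.eq (.var _) (.var _)).sigmaOne f g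

instance SigmaOne.ne {f g : (Fin n → M.Num) → M.Num} [Recursive M f] [Recursive M g] :
    SigmaOne M fun v ↦ ¬ f v = g v :=
  SigmaOne.comp₂ (P := fun x y ↦ ¬ x = y) (IsBounded.not (.eq (.var _) (.var _))).sigmaOne f g

instance SigmaOne.lt {f g : (Fin n → M.Num) → M.Num} [Recursive M f] [Recursive M g] :
    SigmaOne M fun v ↦ f v < g v :=
  SigmaOne.comp₂ (IsBounded.lt (.var _) (.var _)).sigmaOne f g

instance SigmaOne.ball {t : (Fin n → M.Num) → M.Num} [ht : Recursive M t]
    {P : (Fin n → M.Num) → M.Num → Prop}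
    [hP : SigmaOne M fun w : Fin (n + 1) → M.Num ↦ P (fun i ↦ w i.castSucc) (w (Fin.last n))] :
    SigmaOne M fun v ↦ ∀ a, a < t v → P v a := by
  have h : SigmaOne M fun w : Fin (n + 1) → M.Num ↦
      ∀ a, a < w (Fin.last n) → P (fun i ↦ w i.castSucc) a :=
    .ball_of_isPolynomial (.var _) ((hP.subst_snoc (fun j : Fin n ↦ .var j.castSucc.castSucc)
      (.var (Fin.last (n + 1)))).congr fun v ↦ by simp)
  exact (h.comp_snoc ht).congr fun v ↦ by simp

instance DeltaOne.eq {f g : (Fin n → M.Num) → M.Num} [Recursive M f] [Recursive M g] :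
    DeltaOne M fun v ↦ f v = g v := ⟨inferInstance, inferInstance⟩

instance DeltaOne.lt {f g : (Fin n → M.Num) → M.Num} [Recursive M f] [Recursive M g] :
    DeltaOne M fun v ↦ f v < g v :=
  ⟨inferInstance, (SigmaOne.or (P := fun v ↦ g v < f v) (Q := fun v ↦ g v = f v)).congr
    fun v ↦ by rw [not_lt, le_iff_lt_or_eq]⟩

instance DeltaOne.not {P : (Fin n → M.Num) → Prop} [hP : DeltaOne M P] : DeltaOne M fun v ↦ ¬ P v :=
  ⟨hP.sigmaOne_not, hP.sigmaOne.congr fun _ ↦ not_not⟩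

instance DeltaOne.and {P Q : (Fin n → M.Num) → Prop} [hP : DeltaOne M P] [hQ : DeltaOne M Q] :
    DeltaOne M fun v ↦ P v ∧ Q v :=
  have := hP.sigmaOne_not
  have := hQ.sigmaOne_not
  ⟨inferInstance, (SigmaOne.or (P := fun v ↦ ¬ P v) (Q := fun v ↦ ¬ Q v)).congr fun v ↦ by tauto⟩

instance DeltaOne.or {P Q : (Fin n → M.Num) → Prop} [hP : DeltaOne M P] [hQ : DeltaOne M Q] :
    DeltaOne M fun v ↦ P v ∨ Q v :=
  (DeltaOne.not (P := fun v ↦ ¬ P v ∧ ¬ Q v)).congr fun v ↦ by tauto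

instance DeltaOne.imp {P Q : (Fin n → M.Num) → Prop} [hP : DeltaOne M P] [hQ : DeltaOne M Q] :
    DeltaOne M fun v ↦ P v → Q v :=
  (DeltaOne.or (P := fun v ↦ ¬ P v) (Q := Q)).congr fun v ↦ by tauto

instance DeltaOne.iff {P Q : (Fin n → M.Num) → Prop} [hP : DeltaOne M P] [hQ : DeltaOne M Q] :
    DeltaOne M fun v ↦ P v ↔ Q v :=
  (DeltaOne.and (P := fun v ↦ P v → Q v) (Q := fun v ↦ Q v → P v)).congr fun v ↦ by tauto

instance SigmaOne.imp {P Q : (Fin n → M.Num) → Prop} [hP : DeltaOne M P] [hQ : SigmaOne M Q] :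
    SigmaOne M fun v ↦ P v → Q v :=
  have := hP.sigmaOne_not
  (SigmaOne.or (P := fun v ↦ ¬ P v) (Q := Q)).congr fun v ↦ by tauto

instance DeltaOne.mem {f : (Fin n → M.Num) → M.Num} [hf : Recursive M f] (X : M.sets) :
    DeltaOne M fun v ↦ f v ∈ (X : Set M.Num) :=
  have hX : IsBounded M fun v : Fin 1 → M.Num ↦ v 0 ∈ (X : Set M.Num) := .mem X (.var 0)
  ⟨hX.sigmaOne.comp fun _ ↦ hf, hX.not.sigmaOne.comp fun _ ↦ hf⟩

instance DeltaOne.ball {t : (Fin n → M.Num) → M.Num} [ht : Recursive M t]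
    {P : (Fin n → M.Num) → M.Num → Prop}
    [hP : DeltaOne M fun w : Fin (n + 1) → M.Num ↦ P (fun i ↦ w i.castSucc) (w (Fin.last n))] :
    DeltaOne M fun v ↦ ∀ a, a < t v → P v a :=
  have := hP.sigmaOne_not
  have := ht.weaken
  ⟨inferInstance, (SigmaOne.ex (P := fun v a ↦ a < t v ∧ ¬ P v a)).congr fun v ↦ by
    push Not; rfl⟩

instance DeltaOne.bex {t : (Fin n → M.Num) → M.Num} [ht : Recursive M t]
    {P : (Fin n → M.Num) → M.Num → Prop}
    [hP : DeltaOne M fun w : Fin (n + 1) → M.Num ↦ P (fun i ↦ w i.castSucc) (w (Fin.last n))] :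
    DeltaOne M fun v ↦ ∃ a, a < t v ∧ P v a :=
  (DeltaOne.not (P := fun v ↦ ∀ a, a < t v → ¬ P v a)).congr fun v ↦ by push Not; rfl

theorem Recursive.comp {k : ℕ} {F : (Fin k → M.Num) → M.Num} (hF : Recursive M F)
    {f : Fin k → (Fin n → M.Num) → M.Num} (hf : ∀ i, Recursive M (f i)) :
    Recursive M fun v ↦ F fun i ↦ f i v := by
  refine ⟨(hF.graph.comp (f := fun i v ↦ snoc (fun j ↦ f j fun l ↦ v l.castSucc)
    (v (Fin.last n)) i) fun i ↦ ?_).congr fun v ↦ by simp⟩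
  refine Fin.lastCases ?_ (fun j ↦ ?_) i
  · simpa using Recursive.var (Fin.last n)
  · simpa using (hf j).weaken

theorem DeltaOne.comp {k : ℕ} {P : (Fin k → M.Num) → Prop} (hP : DeltaOne M P)
    {f : Fin k → (Fin n → M.Num) → M.Num} (hf : ∀ i, Recursive M (f i)) :
    DeltaOne M fun v ↦ P fun i ↦ f i v :=
  ⟨hP.sigmaOne.comp hf, hP.sigmaOne_not.comp hf⟩

/-- Recursive functions of one argument. -/
class Recursive₁ (F : M.Num → M.Num) : Prop where
  out : Recursive M fun v : Fin 1 → M.Num ↦ F (v 0)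

/-- Recursive functions of two arguments. -/
class Recursive₂ (F : M.Num → M.Num → M.Num) : Prop where
  out : Recursive M fun v : Fin 2 → M.Num ↦ F (v 0) (v 1)

/-- Recursive functions of three arguments. -/
class Recursive₃ (F : M.Num → M.Num → M.Num → M.Num) : Prop where
  out : Recursive M fun v : Fin 3 → M.Num ↦ F (v 0) (v 1) (v 2)

/-- Recursive functions of four arguments. -/
class Recursive₄ (F : M.Num → M.Num → M.Num → M.Num → M.Num) : Prop where
  out : Recursive M fun v : Fin 4 → M.Num ↦ F (v 0) (v 1) (v 2) (v 3)

/-- `Δ⁰₁` predicates of one argument. -/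
class DeltaOne₁ (P : M.Num → Prop) : Prop where
  out : DeltaOne M fun v : Fin 1 → M.Num ↦ P (v 0)

/-- `Δ⁰₁` predicates of two arguments. -/
class DeltaOne₂ (P : M.Num → M.Num → Prop) : Prop where
  out : DeltaOne M fun v : Fin 2 → M.Num ↦ P (v 0) (v 1)

instance (priority := low) Recursive₁.comp {F : M.Num → M.Num} [hF : Recursive₁ F]
    {f : (Fin n → M.Num) → M.Num} [Recursive M f] : Recursive M fun v ↦ F (f v) :=
  hF.out.comp (f := ![f]) fun i ↦ by fin_cases i; assumption

instance (priority := low) Recursive₂.comp {F : M.Num → M.Num → M.Num} [hF : Recursive₂ F]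
    {f g : (Fin n → M.Num) → M.Num} [Recursive M f] [Recursive M g] :
    Recursive M fun v ↦ F (f v) (g v) :=
  hF.out.comp (f := ![f, g]) fun i ↦ by fin_cases i <;> assumption

instance (priority := low) Recursive₃.comp {F : M.Num → M.Num → M.Num → M.Num} [hF : Recursive₃ F]
    {f g h : (Fin n → M.Num) → M.Num} [Recursive M f] [Recursive M g] [Recursive M h] :
    Recursive M fun v ↦ F (f v) (g v) (h v) :=
  hF.out.comp (f := ![f, g, h]) fun i ↦ by fin_cases i <;> assumption

instance (priority := low) Recursive₄.comp {F : M.Num → M.Num → M.Num → M.Num → M.Num}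
    [hF : Recursive₄ F] {f g h k : (Fin n → M.Num) → M.Num}
    [Recursive M f] [Recursive M g] [Recursive M h] [Recursive M k] :
    Recursive M fun v ↦ F (f v) (g v) (h v) (k v) :=
  hF.out.comp (f := ![f, g, h, k]) fun i ↦ by fin_cases i <;> assumption

instance (priority := low) DeltaOne₁.comp {P : M.Num → Prop} [hP : DeltaOne₁ P]
    {f : (Fin n → M.Num) → M.Num} [Recursive M f] : DeltaOne M fun v ↦ P (f v) :=
  hP.out.comp (f := ![f]) fun i ↦ by fin_cases i; assumption

instance (priority := low) DeltaOne₂.comp {P : M.Num → M.Num → Prop} [hP : DeltaOne₂ P]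
    {f g : (Fin n → M.Num) → M.Num} [Recursive M f] [Recursive M g] :
    DeltaOne M fun v ↦ P (f v) (g v) :=
  hP.out.comp (f := ![f, g]) fun i ↦ by fin_cases i <;> assumption

instance Recursive.add {f g : (Fin n → M.Num) → M.Num} [Recursive M f] [Recursive M g] :
    Recursive M fun v ↦ f v + g v :=
  have : Recursive₂ fun x y : M.Num ↦ x + y := ⟨(IsPolynomial.add (.var _) (.var _)).recursive⟩
  Recursive₂.comp (F := fun x y ↦ x + y)

instance Recursive.mul {f g : (Fin n → M.Num) → M.Num} [Recursive M f] [Recursive M g] :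
    Recursive M fun v ↦ f v * g v :=
  have : Recursive₂ fun x y : M.Num ↦ x * y := ⟨(IsPolynomial.mul (.var _) (.var _)).recursive⟩
  Recursive₂.comp (F := fun x y ↦ x * y)

instance Recursive.ite {P : (Fin n → M.Num) → Prop} [∀ v, Decidable (P v)]
    {f g : (Fin n → M.Num) → M.Num} [hP : DeltaOne M P] [hf : Recursive M f] [hg : Recursive M g] :
    Recursive M fun v ↦ if P v then f v else g v := by
  have := hf.graph
  have := hg.graph
  have : DeltaOne M fun w : Fin (n + 1) → M.Num ↦ P fun i ↦ w i.castSucc :=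
    hP.comp fun i ↦ inferInstance
  refine .of_graph (fun v a ↦ P v ∧ f v = a ∨ ¬ P v ∧ g v = a) fun v a ↦ ?_
  split_ifs with h <;> simp [h]

instance Recursive.sub {f g : (Fin n → M.Num) → M.Num} [Recursive M f] [Recursive M g] :
    Recursive M fun v ↦ f v - g v := by
  have : Recursive₂ fun x y : M.Num ↦ x - y := by
    refine ⟨.of_graph (fun v a ↦ v 0 = v 1 + a ∨ v 0 < v 1 ∧ a = 0) fun v a ↦ ?_⟩
    rcases le_or_gt (v 1) (v 0) with h | h
    · rw [tsub_eq_iff_eq_add_of_le h, add_comm]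
      simp [h.not_gt]
    · have : v 0 ≠ v 1 + a := (h.trans_le le_self_add).ne
      simp [tsub_eq_zero_of_le h.le, h, this, eq_comm]
  exact Recursive₂.comp (F := fun x y ↦ x - y)

instance DeltaOne.dvd {f g : (Fin n → M.Num) → M.Num} [hf : Recursive M f] [hg : Recursive M g] :
    DeltaOne M fun v ↦ f v ∣ g v := by
  have := hf.weaken
  have := hg.weaken
  have h : DeltaOne M fun v ↦ ∃ a, a < g v + 1 ∧ g v = f v * a := inferInstance
  refine h.congr fun v ↦ ⟨?_, fun ⟨a, _, ha⟩ ↦ ⟨a, ha⟩⟩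
  rintro ⟨a, ha⟩
  by_cases hf : f v = 0
  · exact ⟨0, by simp, by simp [ha, hf]⟩
  · refine ⟨a, Order.lt_add_one_iff.2 (ha ▸ le_mul_of_one_le_left zero_le ?_), ha⟩
    exact Order.one_le_iff_pos.2 (pos_iff_ne_zero.2 hf)

end Closure

/-! ### Induction, least elements and comprehension -/

section Induction

variable {M : SecondOrderStructure.{u}} [hM : Fact M.ModelsRCA]

theorem delta_strong_induction {P : M.Num → Prop} (hP : DeltaOne M fun v : Fin 1 → M.Num ↦ P (v 0))
    (ind : ∀ n, (∀ k, k < n → P k) → P n) (n : M.Num) : P n := by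
  have : DeltaOne₁ P := ⟨hP⟩
  suffices ∀ n, ∀ k, k < n → P k from ind n (this n)
  intro n
  induction n using sigma_induction with
  | hP => infer_instance
  | zero => exact fun k hk ↦ (not_lt_zero hk).elim
  | succ n hn =>
    intro k hk
    exact ind k fun l hl ↦ hn l (hl.trans_le (Order.lt_add_one_iff.1 hk))

theorem sigma_exists_least {P : M.Num → Prop} (hP : SigmaOne M fun v : Fin 1 → M.Num ↦ P (v 0))
    (h : ∃ n, P n) : ∃ n, P n ∧ ∀ k, k < n → ¬ P k := by
  by_contra! hP'
  obtain ⟨n, hn⟩ := h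
  have descent (d : M.Num) : ∃ k, P k ∧ k + d ≤ n := by
    induction d using sigma_induction with
    | hP =>
      have : SigmaOne M fun v : Fin (1 + 1) → M.Num ↦ P (v (Fin.last 1)) := hP.subst fun _ ↦ .var 1
      infer_instance
    | zero => exact ⟨n, hn, by rw [add_zero]⟩
    | succ d hd =>
      obtain ⟨k, hk, hkd⟩ := hd
      obtain ⟨l, hl, hPl⟩ := hP' k hk
      refine ⟨l, hPl, ?_⟩
      calc l + (d + 1) = l + 1 + d := by ring
        _ ≤ k + d := by gcongr; exact Order.add_one_le_iff.2 hl
        _ ≤ n := hkd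
  obtain ⟨k, -, hk⟩ := descent (n + 1)
  exact (lt_add_one n).not_ge (le_add_self.trans hk)

theorem delta_comprehension {P : M.Num → Prop} (hP : DeltaOne M fun v : Fin 1 → M.Num ↦ P (v 0)) :
    {n | P n} ∈ M.sets := by
  obtain ⟨x, φ, l, hφ, hPφ⟩ := hP.sigmaOne.exists_formula 0
  obtain ⟨y, ψ, l', hψ, hPψ⟩ := SigmaOne.exists_formula (P := fun n ↦ ¬ P n) hP.sigmaOne_not
    (0 + l.length)
  obtain ⟨e, E, hl⟩ := exists_listsParams 0 (l ++ l')
  rw [listsParams_append] at hl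
  have hφ' (n : M.Num) : M.Sat (Function.update e 0 n) E (.ex x φ) ↔ P n := hPφ e E hl.1 n
  have hψ' (n : M.Num) : M.Sat (Function.update e 0 n) E (.all y (.not ψ)) ↔ P n := by
    rw [← not_iff_not, ← hPψ e E hl.2 n]
    simp only [Sat, not_forall, not_not]
  obtain ⟨X, hX, h⟩ := hM.out.comprehension _ _ ⟨x, φ, hφ, rfl⟩ ⟨y, .not ψ, .not hψ, rfl⟩ 0 e E
    fun n ↦ (hφ' n).trans (hψ' n).symm
  rwa [show {n | P n} = X from Set.ext fun n ↦ ((h n).trans (hφ' n)).symm]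

end Induction

/-! ## Gödel's `β` function and primitive recursion -/

section Pairing

variable {M : SecondOrderStructure.{u}} [hM : Fact M.ModelsRCA]

instance : Recursive₂ M.pair := ⟨by unfold pair; infer_instance⟩

theorem pair_lt_pair_of_add_lt {i j a b : M.Num} (h : i + j < a + b) : M.pair i j < M.pair a b :=
  calc M.pair i j < M.pair i j + (i + j + j + 1) :=
        lt_add_of_pos_right _ (Order.lt_add_one_iff.2 zero_le)
    _ = (i + j + 1) * (i + j + 1) := by rw [pair]; ring
    _ ≤ (a + b) * (a + b) :=
        mul_le_mul' (Order.add_one_le_iff.2 h) (Order.add_one_le_iff.2 h)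
    _ ≤ M.pair a b := le_self_add

theorem pair_inj {i j a b : M.Num} : M.pair i j = M.pair a b ↔ i = a ∧ j = b := by
  constructor
  · intro h
    have hsum : i + j = a + b := by
      rcases lt_trichotomy (i + j) (a + b) with hlt | heq | hlt
      · exact ((pair_lt_pair_of_add_lt hlt).ne h).elim
      · exact heq
      · exact ((pair_lt_pair_of_add_lt hlt).ne' h).elim
    simp only [pair, hsum] at h
    obtain rfl := add_left_cancel h
    exact ⟨rfl, add_left_cancel hsum⟩
  · rintro ⟨rfl, rfl⟩
    rfl

theorem left_le_pair (i j : M.Num) : i ≤ M.pair i j := le_add_self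

theorem right_le_pair (i j : M.Num) : j ≤ M.pair i j := by
  rcases eq_or_ne j 0 with rfl | hj
  · exact zero_le
  · have hone : 1 ≤ i + j := (Order.one_le_iff_pos.2 (pos_iff_ne_zero.2 hj)).trans le_add_self
    calc j ≤ i + j := le_add_self
      _ ≤ (i + j) * (i + j) := le_mul_of_one_le_left zero_le hone
      _ ≤ M.pair i j := le_self_add

end Pairing

section Code

variable {M : SecondOrderStructure.{u}} [hM : Fact M.ModelsRCA]

theorem dvd_of_dvd_add_left {a b c : M.Num} (h : a ∣ b + c) (hb : a ∣ b) : a ∣ c := by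
  obtain ⟨x, hx⟩ := h
  obtain ⟨y, rfl⟩ := hb
  rcases le_total y x with hyx | hxy
  · obtain ⟨z, rfl⟩ := exists_add_of_le hyx
    rw [mul_add] at hx
    exact ⟨z, add_left_cancel hx⟩
  · have : c = 0 := le_antisymm
      ((add_le_iff_nonpos_right _).1 (hx.le.trans (mul_le_mul_right hxy a))) zero_le
    simp [this]

/-- Membership of `k` in the finite set coded by `m` and `n`, as in Gödel's `β` function: for a
suitable `m`, the numbers `m * (k + 1) + 1` are pairwise coprime. -/
def MemCode (m n k : M.Num) : Prop := m * (k + 1) + 1 ∣ n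

instance DeltaOne.memCode {l : ℕ} {f g h : (Fin l → M.Num) → M.Num} [Recursive M f] [Recursive M g]
    [Recursive M h] : DeltaOne M fun v ↦ MemCode (f v) (g v) (h v) := by
  unfold MemCode
  infer_instance

theorem not_memCode_one {m : M.Num} (hm : m ≠ 0) (k : M.Num) : ¬ MemCode m 1 k := by
  have hlt : 1 < m * (k + 1) + 1 := lt_add_of_pos_left _
    (mul_pos (pos_iff_ne_zero.2 hm) (Order.lt_add_one_iff.2 zero_le))
  exact fun h ↦ hlt.not_ge (le_of_dvd h one_ne_zero)

theorem MemCode.of_mul_base {m k a : M.Num} (h : MemCode m (a * m) k) : MemCode m a k := by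
  have h' : m * (k + 1) + 1 ∣ a * (m * (k + 1)) + a := ⟨a, by ring⟩
  refine dvd_of_dvd_add_left h' ?_
  rw [← mul_assoc]
  exact h.mul_right _

theorem MemCode.of_mul_of_ne {m K i j a : M.Num} (hm : ∀ d, d < K → d + 1 ∣ m) (hi : i < K)
    (hj : j < K) (hij : i ≠ j) (h : MemCode m (a * (m * (j + 1) + 1)) i) : MemCode m a i := by
  obtain ⟨d, hd, h⟩ : ∃ d, d < K ∧ MemCode m (a * (d + 1) * m) i := by
    rcases lt_or_gt_of_ne hij with hij | hij
    · obtain ⟨d, rfl⟩ := exists_add_of_le (Order.add_one_le_iff.2 hij)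
      have e : a * (m * (i + 1 + d + 1) + 1) = a * (m * (i + 1) + 1) + a * (d + 1) * m := by ring
      exact ⟨d, le_add_self.trans_lt hj, dvd_of_dvd_add_left (e ▸ h) (dvd_mul_left _ _)⟩
    · obtain ⟨d, rfl⟩ := exists_add_of_le (Order.add_one_le_iff.2 hij)
      have e : a * (m * (j + 1) + 1) + a * (d + 1) * m = a * (m * (j + 1 + d + 1) + 1) := by ring
      exact ⟨d, le_add_self.trans_lt hi, dvd_of_dvd_add_left (e ▸ dvd_mul_left _ _) h⟩
  obtain ⟨t, ht⟩ := hm d hd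
  refine MemCode.of_mul_base ?_
  rw [ht, ← mul_assoc, ← ht]
  exact h.of_mul_base.mul_right t

theorem exists_forall_succ_dvd (K : M.Num) : ∃ m, ¬ m = 0 ∧ ∀ d, d < K → d + 1 ∣ m := by
  induction K using sigma_induction with
  | hP => infer_instance
  | zero => exact ⟨1, one_ne_zero, fun d hd ↦ (not_lt_zero hd).elim⟩
  | succ K h =>
    obtain ⟨m, hm0, hm⟩ := h
    refine ⟨m * (K + 1), mul_ne_zero hm0 (basicAxioms.succ_ne_zero K), fun d hd ↦ ?_⟩
    rcases (Order.lt_add_one_iff.1 hd).lt_or_eq with hd | rfl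
    · exact (hm d hd).mul_right _
    · exact dvd_mul_left _ _

theorem exists_code {P : M.Num → Prop} (hP : DeltaOne M fun v : Fin 1 → M.Num ↦ P (v 0))
    (K : M.Num) : ∃ m n, ∀ k, k < K → (MemCode m n k ↔ P k) := by
  have : DeltaOne₁ P := ⟨hP⟩
  obtain ⟨m, hm0, hm⟩ := exists_forall_succ_dvd K
  suffices ∀ j, ∃ n, ∀ k, k < K → (MemCode m n k ↔ k < j ∧ P k) by
    obtain ⟨n, hn⟩ := this K
    exact ⟨m, n, fun k hk ↦ by rw [hn k hk, and_iff_right hk]⟩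
  intro j
  induction j using sigma_induction with
  | hP => infer_instance
  | zero => exact ⟨1, fun k _ ↦ iff_of_false (not_memCode_one hm0 k) fun h ↦ not_lt_zero h.1⟩
  | succ j h =>
    obtain ⟨n, hn⟩ := h
    by_cases hj : j < K ∧ P j
    · refine ⟨n * (m * (j + 1) + 1), fun k hk ↦ ?_⟩
      rcases eq_or_ne k j with rfl | hkj
      · exact iff_of_true (dvd_mul_left _ _) ⟨lt_add_one k, hj.2⟩
      · rw [Order.lt_add_one_iff, le_iff_lt_or_eq, or_iff_left hkj, ← hn k hk]
        exact ⟨.of_mul_of_ne hm hk hj.1 hkj, fun h ↦ h.mul_right _⟩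
    · refine ⟨n, fun k hk ↦ ?_⟩
      rw [hn k hk, Order.lt_add_one_iff, le_iff_lt_or_eq]
      constructor
      · exact fun h ↦ ⟨.inl h.1, h.2⟩
      · rintro ⟨h | rfl, h'⟩
        · exact ⟨h, h'⟩
        · exact (hj ⟨hk, h'⟩).elim

end Code

section PrimitiveRecursion

variable {M : SecondOrderStructure.{u}} [hM : Fact M.ModelsRCA]

/-- The elements below `K` of the set coded by `m` and `n` belong to the graph of the function
with parameters `x` and `y` that is defined by primitive recursion from `g` and `h`, and this is
witnessed within the set. -/
def IsTrace (g : M.Num → M.Num → M.Num)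
    (h : M.Num → M.Num → M.Num → M.Num → M.Num) (x y m n K : M.Num) : Prop :=
  ∀ k, k < K → MemCode m n k → k = M.pair 0 (g x y) ∨
    ∃ j, j < K ∧ ∃ a, a < K ∧ k = M.pair (j + 1) (h x y j a) ∧ M.pair j a < K ∧
      MemCode m n (M.pair j a)

/-- Some trace shows that the function with parameters `x` and `y` that is defined by primitive
recursion from `g` and `h` takes the value `a` at `j`. -/
def RecursionGraph (g : M.Num → M.Num → M.Num)
    (h : M.Num → M.Num → M.Num → M.Num → M.Num) (x y j a : M.Num) : Prop :=
  ∃ m n K, IsTrace g h x y m n K ∧ M.pair j a < K ∧ MemCode m n (M.pair j a)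

variable {g : M.Num → M.Num → M.Num} {h : M.Num → M.Num → M.Num → M.Num → M.Num}
  {x y j a a' : M.Num}

theorem IsTrace.eq_of_zero {m n K : M.Num} (H : IsTrace g h x y m n K) (hK : M.pair 0 a < K)
    (hmem : MemCode m n (M.pair 0 a)) : a = g x y := by
  rcases H _ hK hmem with e | ⟨j, -, b, -, e, -⟩
  · exact (pair_inj.1 e).2
  · exact (basicAxioms.succ_ne_zero j (pair_inj.1 e).1.symm).elim

theorem IsTrace.exists_of_succ {m n K : M.Num} (H : IsTrace g h x y m n K)
    (hK : M.pair (j + 1) a < K) (hmem : MemCode m n (M.pair (j + 1) a)) :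
    ∃ b, b < K ∧ a = h x y j b ∧ M.pair j b < K ∧ MemCode m n (M.pair j b) := by
  rcases H _ hK hmem with e | ⟨i, -, b, hb, e, hi⟩
  · exact (basicAxioms.succ_ne_zero j (pair_inj.1 e).1).elim
  · obtain ⟨e, ha⟩ := pair_inj.1 e
    obtain rfl := add_right_cancel e
    exact ⟨b, hb, ha, hi⟩

theorem IsTrace.unique {m n K m' n' K' : M.Num} (H : IsTrace g h x y m n K)
    (H' : IsTrace g h x y m' n' K') (j : M.Num) : ∀ a, a < K → ∀ a', a' < K' → M.pair j a < K →
      MemCode m n (M.pair j a) → M.pair j a' < K' → MemCode m' n' (M.pair j a') → a = a' := by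
  induction j using sigma_induction with
  | hP => infer_instance
  | zero =>
    intro a _ a' _ hK hmem hK' hmem'
    rw [H.eq_of_zero hK hmem, H'.eq_of_zero hK' hmem']
  | succ j ih =>
    intro a _ a' _ hK hmem hK' hmem'
    obtain ⟨b, hb, rfl, hbK, hbmem⟩ := H.exists_of_succ hK hmem
    obtain ⟨b', hb', rfl, hbK', hbmem'⟩ := H'.exists_of_succ hK' hmem'
    rw [ih b hb b' hb' hbK hbmem hbK' hbmem']

theorem RecursionGraph.unique (ha : RecursionGraph g h x y j a)
    (ha' : RecursionGraph g h x y j a') : a = a' := by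
  obtain ⟨m, n, K, H, hK, hmem⟩ := ha
  obtain ⟨m', n', K', H', hK', hmem'⟩ := ha'
  exact H.unique H' j a ((right_le_pair _ _).trans_lt hK) a' ((right_le_pair _ _).trans_lt hK')
    hK hmem hK' hmem'

theorem RecursionGraph.zero (g : M.Num → M.Num → M.Num) (h : M.Num → M.Num → M.Num → M.Num → M.Num)
    (x y : M.Num) : RecursionGraph g h x y 0 (g x y) := by
  obtain ⟨m, n, hmn⟩ := exists_code (P := fun k ↦ k = M.pair 0 (g x y)) inferInstance
    (M.pair 0 (g x y) + 1)
  exact ⟨m, n, _, fun k hk hk' ↦ .inl ((hmn k hk).1 hk'), lt_add_one _,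
    (hmn _ (lt_add_one _)).2 rfl⟩

theorem RecursionGraph.succ (ha : RecursionGraph g h x y j a) :
    RecursionGraph g h x y (j + 1) (h x y j a) := by
  obtain ⟨m, n, K, H, hK, hmem⟩ := ha
  let K' := max K (M.pair (j + 1) (h x y j a) + 1)
  obtain ⟨m', n', hmn⟩ := exists_code (P := fun k ↦ (k < K ∧ MemCode m n k) ∨
    k = M.pair (j + 1) (h x y j a)) (by infer_instance) K'
  have hKK' {k : M.Num} : k < K → k < K' := lt_max_of_lt_left
  have hK' : M.pair (j + 1) (h x y j a) < K' := lt_max_of_lt_right (lt_add_one _)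
  refine ⟨m', n', K', fun k hk hk' ↦ ?_, hK', (hmn _ hK').2 (.inr rfl)⟩
  rcases (hmn k hk).1 hk' with ⟨hkK, hkmem⟩ | rfl
  · rcases H k hkK hkmem with e | ⟨i, hi, b, hb, e, hbK, hbmem⟩
    · exact .inl e
    · exact .inr ⟨i, hKK' hi, b, hKK' hb, e, hKK' hbK, (hmn _ (hKK' hbK)).2 (.inl ⟨hbK, hbmem⟩)⟩
  · exact .inr ⟨j, hKK' ((left_le_pair _ _).trans_lt hK), a,
      hKK' ((right_le_pair _ _).trans_lt hK), rfl, hKK' hK, (hmn _ (hKK' hK)).2 (.inl ⟨hK, hmem⟩)⟩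

theorem RecursionGraph.exists (g : M.Num → M.Num → M.Num)
    (h : M.Num → M.Num → M.Num → M.Num → M.Num) [Recursive₄ h] (x y j : M.Num) :
    ∃ a, RecursionGraph g h x y j a := by
  induction j using sigma_induction with
  | hP =>
    simp only [RecursionGraph, IsTrace]
    infer_instance
  | zero => exact ⟨_, .zero g h x y⟩
  | succ j ih =>
    obtain ⟨a, ha⟩ := ih
    exact ⟨_, ha.succ⟩

/-- The function that is defined by primitive recursion from `g` and `h`, where the first two
arguments are parameters. -/
noncomputable def primRec (g : M.Num → M.Num → M.Num)
    (h : M.Num → M.Num → M.Num → M.Num → M.Num) [Recursive₄ h] (x y j : M.Num) : M.Num :=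
  (RecursionGraph.exists g h x y j).choose

variable (g h) [Recursive₄ h]

theorem primRec_eq_iff : primRec g h x y j = a ↔ RecursionGraph g h x y j a := by
  have hspec := (RecursionGraph.exists g h x y j).choose_spec
  exact ⟨fun e ↦ e ▸ hspec, hspec.unique⟩

instance [Recursive₂ g] : Recursive₃ (primRec g h) := by
  have : SigmaOne M fun v : Fin 4 → M.Num ↦ RecursionGraph g h (v 0) (v 1) (v 2) (v 3) := by
    simp only [RecursionGraph, IsTrace]
    infer_instance
  exact ⟨.of_graph (hP := this) (fun v a ↦ RecursionGraph g h (v 0) (v 1) (v 2) a)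
    fun v a ↦ primRec_eq_iff g h⟩

theorem primRec_zero (x y : M.Num) : primRec g h x y 0 = g x y :=
  (primRec_eq_iff g h).2 (.zero g h x y)

theorem primRec_succ (x y j : M.Num) : primRec g h x y (j + 1) = h x y j (primRec g h x y j) :=
  (primRec_eq_iff g h).2 ((primRec_eq_iff g h).1 rfl).succ

end PrimitiveRecursion

section Least

variable {M : SecondOrderStructure.{u}} [hM : Fact M.ModelsRCA] {n : ℕ}

/-- The least number with property `P`. The value is `0` if there is no such number. -/
noncomputable def least (P : M.Num → Prop) : M.Num :=
  open Classical in if h : ∃ n, P n ∧ ∀ k, k < n → ¬ P k then h.choose else 0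

theorem least_eq {P : M.Num → Prop} {n : M.Num} (h : P n) (h' : ∀ k, k < n → ¬ P k) :
    least P = n := by
  have hex : ∃ n, P n ∧ ∀ k, k < n → ¬ P k := ⟨n, h, h'⟩
  obtain ⟨hP, hlt⟩ := hex.choose_spec
  rw [least, dif_pos hex]
  exact le_antisymm (not_lt.1 fun hl ↦ hlt _ hl h) (not_lt.1 fun hl ↦ h' _ hl hP)

theorem least_spec {P : M.Num → Prop} (hP : SigmaOne M fun v : Fin 1 → M.Num ↦ P (v 0))
    (h : ∃ n, P n) : P (least P) ∧ ∀ k, k < least P → ¬ P k := by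
  obtain ⟨n, hn, hn'⟩ := sigma_exists_least hP h
  rw [least_eq hn hn']
  exact ⟨hn, hn'⟩

theorem Recursive.least {P : (Fin n → M.Num) → M.Num → Prop}
    (hP : DeltaOne M fun w : Fin (n + 1) → M.Num ↦ P (fun i ↦ w i.castSucc) (w (Fin.last n)))
    (h : ∀ v, ∃ a, P v a) : Recursive M fun v ↦ least (P v) := by
  have : DeltaOne M fun w : Fin (n + 1 + 1) → M.Num ↦
      P (fun i ↦ w i.castSucc.castSucc) (w (Fin.last (n + 1))) :=
    (hP.comp (f := fun i w ↦ snoc (fun j : Fin n ↦ w j.castSucc.castSucc) (w (Fin.last (n + 1))) i)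
      fun i ↦ (IsPolynomial.snoc (fun i ↦ .var _) (.var _) i).recursive).congr fun v ↦ by simp
  refine .of_graph (fun v a ↦ P v a ∧ ∀ b, b < a → ¬ P v b) fun v a ↦ ⟨?_, fun h ↦ ?_⟩
  · rintro rfl
    exact least_spec ((hP.sigmaOne.subst_snoc (fun i ↦ .const (v i)) (.var 0)).congr
      fun w ↦ by simp) (h v)
  · exact least_eq h.1 h.2

end Least

/-! ## Functions as sets -/

section Graph

variable {M : SecondOrderStructure.{u}} [hM : Fact M.ModelsRCA]

/-- The graph of a function, as a set of codes of pairs. The bound on `i` makes it `Δ⁰₁`. -/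
def graphOf (F : M.Num → M.Num) : Set M.Num := {x | ∃ i, i < x + 1 ∧ x = M.pair i (F i)}

theorem app_graphOf {F : M.Num → M.Num} {i j : M.Num} : M.App (graphOf F) i j ↔ j = F i := by
  constructor
  · rintro ⟨i', -, h⟩
    obtain ⟨rfl, rfl⟩ := pair_inj.1 h
    rfl
  · rintro rfl
    exact ⟨i, Order.lt_add_one_iff.2 (left_le_pair _ _), rfl⟩

theorem isFun_graphOf (F : M.Num → M.Num) [Recursive₁ F] : M.IsFun (graphOf F) := by
  refine ⟨delta_comprehension inferInstance, fun x ⟨i, _, h⟩ ↦ ⟨i, _, h⟩, fun i ↦ ⟨F i, ?_, ?_⟩⟩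
  · exact app_graphOf.2 rfl
  · exact fun j hj ↦ app_graphOf.1 hj

theorem IsFun.exists_recursive {f : Set M.Num} (hf : M.IsFun f) :
    ∃ F : M.Num → M.Num, Recursive₁ F ∧ ∀ i j, M.App f i j ↔ j = F i := by
  obtain ⟨hs, -, h⟩ := hf
  choose F hF huniq using h
  have happ (i j : M.Num) : M.App f i j ↔ j = F i := ⟨huniq i j, fun h ↦ h ▸ hF i⟩
  refine ⟨F, ⟨.of_graph (fun v a ↦ M.pair (v 0) a ∈ (⟨f, hs⟩ : M.sets).1) fun v a ↦ ?_⟩, happ⟩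
  rw [eq_comm]
  exact (happ _ _).symm

end Graph

/-! ## Binary representations -/

section Pow2

variable {M : SecondOrderStructure.{u}} [hM : Fact M.ModelsRCA]

instance : Recursive₂ (M := M) (fun _ _ ↦ 1) := ⟨inferInstance⟩

instance : Recursive₄ (M := M) (fun _ _ _ a ↦ a + a) := ⟨inferInstance⟩

/-- The powers of two in a model of `RCA₀`. -/
noncomputable def pow2 (x : M.Num) : M.Num := primRec (fun _ _ ↦ 1) (fun _ _ _ a ↦ a + a) 0 0 x

instance : Recursive₁ (M := M) pow2 := ⟨by unfold pow2; infer_instance⟩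

theorem pow2_zero : pow2 (0 : M.Num) = 1 := primRec_zero ..

theorem pow2_add_one (x : M.Num) : pow2 (x + 1) = 2 * pow2 x :=
  (primRec_succ ..).trans (two_mul _).symm

theorem pow2_one : pow2 (1 : M.Num) = 2 := by
  rw [← zero_add (1 : M.Num), pow2_add_one, pow2_zero, mul_one]

theorem pow2_add (x y : M.Num) : pow2 (x + y) = pow2 x * pow2 y := by
  induction y using sigma_induction with
  | hP => infer_instance
  | zero => rw [add_zero, pow2_zero, mul_one]
  | succ y h => rw [← add_assoc, pow2_add_one, pow2_add_one, h, mul_left_comm]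

theorem pow2_add_two (x : M.Num) : pow2 (x + 2) = 4 * pow2 x := by
  rw [← one_add_one_eq_two, ← add_assoc, pow2_add_one, pow2_add_one]
  ring

theorem pow2_pos (x : M.Num) : 0 < pow2 x := by
  induction x using sigma_induction with
  | hP => infer_instance
  | zero => rw [pow2_zero]; exact zero_lt_one
  | succ x h => rw [pow2_add_one]; exact mul_pos two_pos h

theorem one_le_pow2 (x : M.Num) : 1 ≤ pow2 x := Order.one_le_iff_pos.2 (pow2_pos x)

theorem pow2_dvd_pow2 {x y : M.Num} (h : x ≤ y) : pow2 x ∣ pow2 y := by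
  obtain ⟨z, rfl⟩ := exists_add_of_le h
  rw [pow2_add]
  exact dvd_mul_right _ _

theorem pow2_lt_pow2_add_one (x : M.Num) : pow2 x < pow2 (x + 1) := by
  rw [pow2_add_one, two_mul]
  exact lt_add_of_pos_left _ (pow2_pos x)

theorem pow2_strictMono : StrictMono (pow2 : M.Num → M.Num) := fun x y h ↦
  (pow2_lt_pow2_add_one x).trans_le
    (le_of_dvd (pow2_dvd_pow2 (Order.add_one_le_iff.2 h)) (pow2_pos y).ne')

theorem pow2_lt_pow2 {x y : M.Num} : pow2 x < pow2 y ↔ x < y := pow2_strictMono.lt_iff_lt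

theorem pow2_le_pow2 {x y : M.Num} : pow2 x ≤ pow2 y ↔ x ≤ y := pow2_strictMono.le_iff_le

theorem lt_pow2 (x : M.Num) : x < pow2 x := by
  induction x using sigma_induction with
  | hP => infer_instance
  | zero => exact pow2_pos 0
  | succ x h => exact (Order.add_one_le_iff.2 h).trans_lt (pow2_lt_pow2_add_one x)

theorem pow_iff {x y : M.Num} : M.Pow x y ↔ y = pow2 x := by
  constructor
  · rintro ⟨p, hp, h0, hs, h⟩
    obtain ⟨F, hF, hpF⟩ := hp.exists_recursive
    simp only [hpF] at h0 hs h
    suffices ∀ i, F i = pow2 i by rw [h, this]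
    intro i
    induction i using sigma_induction with
    | hP => infer_instance
    | zero => rw [← h0, pow2_zero]
    | succ i hi => rw [← hs i _ rfl, hi, pow2_add_one, two_mul]
  · rintro rfl
    refine ⟨_, isFun_graphOf pow2, ?_, fun i u h ↦ ?_, ?_⟩ <;> rw [app_graphOf] at *
    · exact pow2_zero.symm
    · rw [h, pow2_add_one, two_mul]

end Pow2

section Bit

variable {M : SecondOrderStructure.{u}} [hM : Fact M.ModelsRCA]

theorem exists_eq_mul_add {d : M.Num} (hd : 0 < d) (u : M.Num) :
    ∃ q r, u = d * q + r ∧ r < d := by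
  induction u using sigma_induction with
  | hP => infer_instance
  | zero => exact ⟨0, 0, by simp, hd⟩
  | succ u h =>
    obtain ⟨q, r, rfl, hr⟩ := h
    rcases (Order.add_one_le_iff.2 hr).lt_or_eq with h | h
    · exact ⟨q, r + 1, add_assoc .., h⟩
    · exact ⟨q + 1, 0, by rw [add_assoc, h]; ring, hd⟩

theorem mul_le_mul_add_iff {a x y r : M.Num} (hr : r < a) : a * y ≤ a * x + r ↔ y ≤ x := by
  refine ⟨fun h ↦ ?_, fun h ↦ (mul_le_mul_right h a).trans le_self_add⟩
  by_contra! hxy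
  refine h.not_gt ?_
  calc a * x + r < a * x + a := add_lt_add_right hr _
    _ = a * (x + 1) := by ring
    _ ≤ a * y := mul_le_mul_right (Order.add_one_le_iff.2 hxy) a

theorem mod_unique {a x y r s : M.Num} (hr : r < a) (hs : s < a) (h : a * x + r = a * y + s) :
    r = s := by
  have hxy : x ≤ y := (mul_le_mul_add_iff hs).1 (le_self_add.trans h.le)
  have hyx : y ≤ x := (mul_le_mul_add_iff hr).1 (le_self_add.trans h.ge)
  rw [hxy.antisymm hyx] at h
  exact add_left_cancel h

/-- The digit of `u` at position `n` in the binary representation is one. The bounds on the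
quantifiers make this `Δ⁰₁`. -/
def Bit (u n : M.Num) : Prop :=
  ∃ q, q < u + 1 ∧ ∃ r, r < pow2 n ∧ u = pow2 (n + 1) * q + (pow2 n + r)

instance : DeltaOne₂ (M := M) Bit := ⟨by unfold Bit; infer_instance⟩

theorem bit_iff {u n q s : M.Num} (hs : s < pow2 (n + 1)) (h : u = pow2 (n + 1) * q + s) :
    Bit u n ↔ pow2 n ≤ s := by
  have hpow : pow2 (n + 1) = pow2 n + pow2 n := by rw [pow2_add_one, two_mul]
  constructor
  · rintro ⟨q', -, r, hr, h'⟩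
    rw [mod_unique hs (hpow ▸ add_lt_add_right hr _) (h.symm.trans h')]
    exact le_self_add
  · intro hn
    obtain ⟨r, rfl⟩ := exists_add_of_le hn
    refine ⟨q, Order.lt_add_one_iff.2 ?_, r, lt_of_add_lt_add_left (hpow ▸ hs), h⟩
    exact h ▸ (le_mul_of_one_le_left zero_le (one_le_pow2 _)).trans le_self_add

theorem Bit.pow2_le {u n : M.Num} (h : Bit u n) : pow2 n ≤ u := by
  obtain ⟨q, -, r, -, rfl⟩ := h
  exact le_self_add.trans le_add_self

theorem not_bit_of_lt {u t n : M.Num} (h : u < pow2 t) (hn : t ≤ n) : ¬ Bit u n :=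
  fun hb ↦ h.not_ge ((pow2_le_pow2.2 hn).trans hb.pow2_le)

theorem not_bit_of_dvd {u t n : M.Num} (h : pow2 t ∣ u) (hn : n < t) : ¬ Bit u n := by
  obtain ⟨q, hq⟩ := (pow2_dvd_pow2 (Order.add_one_le_iff.2 hn)).trans h
  rw [bit_iff (pow2_pos _) (hq.trans (add_zero _).symm)]
  exact (pow2_pos n).not_ge

theorem bit_add_of_lt {U T t n : M.Num} (hU : pow2 t ∣ U) (hn : n < t) :
    Bit (U + T) n ↔ Bit T n := by
  obtain ⟨q, rfl⟩ := (pow2_dvd_pow2 (Order.add_one_le_iff.2 hn)).trans hU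
  obtain ⟨q', s, rfl, hs⟩ := exists_eq_mul_add (pow2_pos (n + 1)) T
  rw [bit_iff (q := q + q') hs (by ring), bit_iff hs rfl]

theorem bit_add_of_le {U T t n : M.Num} (hU : pow2 t ∣ U) (hT : T < pow2 t) (hn : t ≤ n) :
    Bit (U + T) n ↔ Bit U n := by
  obtain ⟨q, s, rfl, hs⟩ := exists_eq_mul_add (pow2_pos (n + 1)) U
  obtain ⟨s, rfl⟩ :=
    dvd_of_dvd_add_left hU ((pow2_dvd_pow2 (hn.trans le_self_add)).mul_right q)
  obtain ⟨d, rfl⟩ := exists_add_of_le hn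
  have hs' : pow2 t * s + T < pow2 (t + d + 1) := by
    rw [add_assoc, pow2_add] at hs ⊢
    have hlt : s < pow2 (d + 1) := lt_of_mul_lt_mul_left hs zero_le
    calc pow2 t * s + T < pow2 t * s + pow2 t := add_lt_add_right hT _
      _ = pow2 t * (s + 1) := by ring
      _ ≤ pow2 t * pow2 (d + 1) := mul_le_mul_right (Order.add_one_le_iff.2 hlt) _
  rw [bit_iff (q := q) hs' (by ring), bit_iff hs rfl, pow2_add, mul_le_mul_add_iff hT,
    mul_le_mul_iff_right₀ (pow2_pos t)]

theorem bit_pow2 {t n : M.Num} : Bit (pow2 t) n ↔ n = t := by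
  constructor
  · intro h
    rcases lt_trichotomy n t with hn | hn | hn
    · exact (not_bit_of_dvd dvd_rfl hn h).elim
    · exact hn
    · exact ((pow2_strictMono hn).not_ge h.pow2_le).elim
  · rintro rfl
    exact (bit_iff (q := 0) (pow2_lt_pow2_add_one n) (by simp)).2 le_rfl

end Bit

section Log

variable {M : SecondOrderStructure.{u}} [hM : Fact M.ModelsRCA]

/-- The position of the leading binary digit (with value `0` at `0`). -/
noncomputable def log2 (u : M.Num) : M.Num := least fun n ↦ u < pow2 (n + 1)

theorem lt_pow2_add_one (u : M.Num) : u < pow2 (u + 1) := (lt_pow2 u).trans (pow2_lt_pow2_add_one u)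

instance : Recursive₁ (M := M) log2 :=
  ⟨.least (P := fun (v : Fin 1 → M.Num) n ↦ v 0 < pow2 (n + 1)) inferInstance
    fun _ ↦ ⟨_, lt_pow2_add_one _⟩⟩

theorem log2_spec (u : M.Num) : u < pow2 (log2 u + 1) ∧ ∀ k, k < log2 u → ¬ u < pow2 (k + 1) :=
  least_spec (P := fun n ↦ u < pow2 (n + 1)) inferInstance ⟨_, lt_pow2_add_one _⟩

theorem lt_pow2_log2_add_one (u : M.Num) : u < pow2 (log2 u + 1) := (log2_spec u).1

theorem pow2_log2_le {u : M.Num} (h : u ≠ 0) : pow2 (log2 u) ≤ u := by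
  rcases eq_or_ne (log2 u) 0 with hlog | hlog
  · rw [hlog, pow2_zero]
    exact Order.one_le_iff_ne_zero.2 h
  · obtain ⟨m, hm⟩ := exists_eq_add_one hlog
    rw [hm]
    exact not_lt.1 ((log2_spec u).2 m (hm ▸ lt_add_one m))

theorem log2_lt {u t : M.Num} (h : u ≠ 0) (hu : u < pow2 t) : log2 u < t :=
  pow2_lt_pow2.1 ((pow2_log2_le h).trans_lt hu)

theorem sub_pow2_log2_lt (u : M.Num) : u - pow2 (log2 u) < pow2 (log2 u) := by
  rcases eq_or_ne u 0 with rfl | h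
  · rw [tsub_eq_zero_of_le zero_le]
    exact pow2_pos _
  · rw [tsub_lt_iff_right (pow2_log2_le h), ← two_mul, ← pow2_add_one]
    exact lt_pow2_log2_add_one u

theorem sub_pow2_log2_lt_self {u : M.Num} (h : u ≠ 0) : u - pow2 (log2 u) < u :=
  (sub_pow2_log2_lt u).trans_le (pow2_log2_le h)

/-- The exponent of the largest power of two that divides `u` (with value `0` at `0`). -/
noncomputable def val2 (u : M.Num) : M.Num := least fun n ↦ u = 0 ∨ ¬ pow2 (n + 1) ∣ u

theorem exists_eq_zero_or_not_pow2_dvd (u : M.Num) : ∃ n, u = 0 ∨ ¬ pow2 (n + 1) ∣ u :=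
  ⟨u, or_iff_not_imp_left.2 fun h hdvd ↦ (lt_pow2_add_one u).not_ge (le_of_dvd hdvd h)⟩

instance : Recursive₁ (M := M) val2 :=
  ⟨.least (P := fun (v : Fin 1 → M.Num) n ↦ v 0 = 0 ∨ ¬ pow2 (n + 1) ∣ v 0) inferInstance
    fun _ ↦ exists_eq_zero_or_not_pow2_dvd _⟩

theorem val2_spec {u : M.Num} (h : u ≠ 0) : pow2 (val2 u) ∣ u ∧ ¬ pow2 (val2 u + 1) ∣ u := by
  obtain ⟨hnot, hlt⟩ := least_spec (P := fun n ↦ u = 0 ∨ ¬ pow2 (n + 1) ∣ u) inferInstance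
    (exists_eq_zero_or_not_pow2_dvd u)
  refine ⟨?_, hnot.resolve_left h⟩
  rcases eq_or_ne (val2 u) 0 with hval | hval
  · rw [hval, pow2_zero]
    exact one_dvd _
  · obtain ⟨m, hm⟩ := exists_eq_add_one hval
    have := hlt m (hm ▸ lt_add_one m : m < val2 u)
    rw [hm]
    exact not_not.1 (not_or.1 this).2

theorem le_val2_iff {u t : M.Num} (h : u ≠ 0) : t ≤ val2 u ↔ pow2 t ∣ u := by
  refine ⟨fun ht ↦ (pow2_dvd_pow2 ht).trans (val2_spec h).1, fun ht ↦ ?_⟩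
  by_contra! hlt
  exact (val2_spec h).2 ((pow2_dvd_pow2 (Order.add_one_le_iff.2 hlt)).trans ht)

theorem val2_eq {u t : M.Num} (h : u ≠ 0) (ht : pow2 t ∣ u) (ht' : ¬ pow2 (t + 1) ∣ u) :
    val2 u = t := by
  rw [← le_val2_iff h] at ht ht'
  exact le_antisymm (Order.lt_add_one_iff.1 (not_le.1 ht')) ht

theorem exists_eq_add_pow2 {u t : M.Num} (h : pow2 t ∣ u) (h' : ¬ pow2 (t + 1) ∣ u) :
    ∃ U, u = U + pow2 t ∧ pow2 (t + 1) ∣ U := by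
  obtain ⟨q, rfl⟩ := h
  obtain ⟨k, r, rfl, hr⟩ := exists_eq_mul_add (d := (2 : M.Num)) two_pos q
  rcases (Order.lt_two_iff.1 hr).lt_or_eq with hr | rfl
  · obtain rfl := Order.lt_one_iff.1 hr
    exact (h' ⟨k, by rw [pow2_add_one]; ring⟩).elim
  · exact ⟨pow2 (t + 1) * k, by rw [pow2_add_one]; ring, dvd_mul_right _ _⟩

end Log

/-! ## Change of exponents in binary representations -/

section MapExp

variable {M : SecondOrderStructure.{u}} [hM : Fact M.ModelsRCA]

instance : Recursive₂ (M := M) (fun _ _ ↦ 0) := ⟨inferInstance⟩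

variable (C : M.Num → M.Num → M.Num) [Recursive₂ C] {i : M.Num}

open Classical in
instance : Recursive₄ (M := M) (fun i u n a ↦ a + if Bit u n then pow2 (C i n) else 0) :=
  ⟨inferInstance⟩

open Classical in
/-- The sum of the numbers `2 ^ C i m` for the non-zero binary digits `m < n` of `u`. -/
noncomputable def bitSum (i u n : M.Num) : M.Num :=
  primRec (fun _ _ ↦ 0) (fun i u n a ↦ a + if Bit u n then pow2 (C i n) else 0) i u n

instance : Recursive₃ (bitSum C) := ⟨by unfold bitSum; infer_instance⟩

theorem bitSum_zero (i u : M.Num) : bitSum C i u 0 = 0 := primRec_zero ..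

variable {C}

theorem bitSum_add_one {u n : M.Num} (h : Bit u n) :
    bitSum C i u (n + 1) = bitSum C i u n + pow2 (C i n) :=
  (primRec_succ ..).trans (by rw [if_pos h]; rfl)

theorem bitSum_add_one_of_not {u n : M.Num} (h : ¬ Bit u n) :
    bitSum C i u (n + 1) = bitSum C i u n :=
  (primRec_succ ..).trans (by rw [if_neg h, add_zero]; rfl)

theorem bitSum_lt (hC : StrictMono (C i)) (u n : M.Num) : bitSum C i u n < pow2 (C i n) := by
  induction n using sigma_induction with
  | hP => infer_instance
  | zero => rw [bitSum_zero]; exact pow2_pos _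
  | succ n h =>
    refine lt_of_lt_of_le ?_ (pow2_le_pow2.2 (Order.add_one_le_iff.2 (hC (lt_add_one n))))
    rw [pow2_add_one, two_mul]
    by_cases hb : Bit u n
    · rw [bitSum_add_one hb]
      exact add_lt_add_left h _
    · rw [bitSum_add_one_of_not hb]
      exact h.trans_le le_self_add

theorem bitSum_eq_of_le {u t s : M.Num} (hu : u < pow2 t) (hs : t ≤ s) :
    bitSum C i u s = bitSum C i u t := by
  obtain ⟨d, rfl⟩ := exists_add_of_le hs
  clear hs
  induction d using sigma_induction with
  | hP => infer_instance
  | zero => rw [add_zero]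
  | succ d h => rw [← add_assoc, bitSum_add_one_of_not (not_bit_of_lt hu le_self_add), h]

theorem bitSum_add {U T t : M.Num} (hU : pow2 t ∣ U) (hT : T < pow2 t) (n : M.Num) :
    bitSum C i (U + T) n = bitSum C i U n + bitSum C i T n := by
  induction n using sigma_induction with
  | hP => infer_instance
  | zero => simp only [bitSum_zero, add_zero]
  | succ n h =>
    rcases lt_or_ge n t with hn | hn
    · rw [bitSum_add_one_of_not (not_bit_of_dvd hU hn)]
      by_cases hb : Bit T n
      · rw [bitSum_add_one hb, bitSum_add_one ((bit_add_of_lt hU hn).2 hb), h, add_assoc]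
      · rw [bitSum_add_one_of_not hb, bitSum_add_one_of_not (mt (bit_add_of_lt hU hn).1 hb), h]
    · rw [bitSum_add_one_of_not (not_bit_of_lt hT hn)]
      by_cases hb : Bit U n
      · rw [bitSum_add_one hb, bitSum_add_one ((bit_add_of_le hU hT hn).2 hb), h, add_right_comm]
      · rw [bitSum_add_one_of_not hb, bitSum_add_one_of_not (mt (bit_add_of_le hU hT hn).1 hb), h]

theorem dvd_bitSum (hC : StrictMono (C i)) {u t : M.Num} (hu : pow2 t ∣ u) (n : M.Num) :
    pow2 (C i t) ∣ bitSum C i u n := by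
  induction n using sigma_induction with
  | hP => infer_instance
  | zero => rw [bitSum_zero]; exact dvd_zero _
  | succ n h =>
    by_cases hb : Bit u n
    · rw [bitSum_add_one hb]
      exact dvd_add h
        (pow2_dvd_pow2 (hC.monotone (not_lt.1 fun hn ↦ not_bit_of_dvd hu hn hb)))
    · rwa [bitSum_add_one_of_not hb]

theorem bitSum_pow2_eq_zero (t n : M.Num) : n ≤ t → bitSum C i (pow2 t) n = 0 := by
  induction n using sigma_induction with
  | hP => infer_instance
  | zero => exact fun _ ↦ bitSum_zero ..
  | succ n ih =>
    intro hn
    rw [bitSum_add_one_of_not (mt bit_pow2.1 (Order.add_one_le_iff.1 hn).ne),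
      ih (le_self_add.trans hn)]

variable (C) in
/-- The change of exponents `2 ^ n_0 + … + 2 ^ n_k ↦ 2 ^ C i n_0 + … + 2 ^ C i n_k` in binary
representations. -/
noncomputable def mapExp (i u : M.Num) : M.Num := bitSum C i u u

instance : Recursive₂ (mapExp C) := ⟨by unfold mapExp; infer_instance⟩

theorem mapExp_eq_bitSum {u t : M.Num} (hu : u < pow2 t) : mapExp C i u = bitSum C i u t := by
  rcases le_total t u with h | h
  · exact bitSum_eq_of_le hu h
  · exact (bitSum_eq_of_le (lt_pow2 u) h).symm

theorem mapExp_add {U T t : M.Num} (hU : pow2 t ∣ U) (hT : T < pow2 t) :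
    mapExp C i (U + T) = mapExp C i U + mapExp C i T := by
  rw [mapExp, bitSum_add hU hT, ← mapExp_eq_bitSum, ← mapExp_eq_bitSum]
  · exact (lt_pow2 T).trans_le (pow2_le_pow2.2 le_add_self)
  · exact (lt_pow2 U).trans_le (pow2_le_pow2.2 le_self_add)

theorem mapExp_lt (hC : StrictMono (C i)) {u t : M.Num} (hu : u < pow2 t) :
    mapExp C i u < pow2 (C i t) := by
  rw [mapExp_eq_bitSum hu]
  exact bitSum_lt hC _ _

theorem dvd_mapExp (hC : StrictMono (C i)) {u t : M.Num} (hu : pow2 t ∣ u) :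
    pow2 (C i t) ∣ mapExp C i u :=
  dvd_bitSum hC hu _

theorem mapExp_zero : mapExp C i 0 = 0 := bitSum_zero C i 0

theorem mapExp_pow2 (t : M.Num) : mapExp C i (pow2 t) = pow2 (C i t) := by
  rw [mapExp_eq_bitSum (pow2_lt_pow2_add_one t), bitSum_add_one (bit_pow2.2 rfl),
    bitSum_pow2_eq_zero t t le_rfl, zero_add]

theorem mapExp_eq_add {u : M.Num} (h : u ≠ 0) :
    mapExp C i u = mapExp C i (u - pow2 (log2 u)) + pow2 (C i (log2 u)) := by
  conv_lhs => rw [← add_tsub_cancel_of_le (pow2_log2_le h)]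
  rw [mapExp_add dvd_rfl (sub_pow2_log2_lt u), mapExp_pow2, add_comm]

theorem mapExp_pos {u : M.Num} (h : u ≠ 0) : 0 < mapExp C i u := by
  rw [mapExp_eq_add h]
  exact add_pos_of_nonneg_of_pos zero_le (pow2_pos _)

theorem mapExp_eq_four_mul {p : M.Num} (hC : ∀ x, p ≤ x → C i x = x + 2) (u : M.Num) :
    pow2 p ∣ u → mapExp C i u = 4 * u := by
  induction u using delta_strong_induction with
  | hP => infer_instance
  | ind u ih =>
    intro hp
    rcases eq_or_ne u 0 with rfl | hu
    · rw [mapExp_zero, mul_zero]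
    have hlog : p ≤ log2 u := Order.lt_add_one_iff.1
      (pow2_lt_pow2.1 ((le_of_dvd hp hu).trans_lt (lt_pow2_log2_add_one u)))
    have hsum : pow2 (log2 u) + (u - pow2 (log2 u)) = u := add_tsub_cancel_of_le (pow2_log2_le hu)
    have hdvd : pow2 p ∣ u - pow2 (log2 u) :=
      dvd_of_dvd_add_left (hp.trans hsum.symm.dvd) (pow2_dvd_pow2 hlog)
    rw [mapExp_eq_add hu, ih _ (sub_pow2_log2_lt_self hu) hdvd, hC _ hlog, pow2_add_two, ← mul_add,
      add_comm, hsum]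

end MapExp

section Step

variable {M : SecondOrderStructure.{u}} [hM : Fact M.ModelsRCA]

theorem PowSum.exists_recursive {f : Set M.Num} {F : M.Num → M.Num} {k s : M.Num}
    (hF : ∀ i j, M.App f i j ↔ j = F i) (h : M.PowSum f k s) :
    ∃ S : M.Num → M.Num, Recursive₁ S ∧ S 0 = 0 ∧ (∀ j, j ≤ k → S (j + 1) = S j + pow2 (F j)) ∧
      S (k + 1) = s := by
  obtain ⟨σ, hσ, hzero, hstep, hlast⟩ := h
  obtain ⟨S, hS, hσS⟩ := hσ.exists_recursive
  simp only [hσS, hF, pow_iff] at hzero hstep hlast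
  exact ⟨S, hS, hzero.symm, fun j hj ↦ (hstep j _ _ _ hj.lt_or_eq rfl rfl rfl).symm, hlast.symm⟩

/-- Here `T j` stands for the sum of the powers `2 ^ F(j), …, 2 ^ F(k)`. -/
theorem PowSum.of_tail {F T : M.Num → M.Num} [Recursive₁ T] {k : M.Num}
    (hT : ∀ j, j ≤ k → T j = T (j + 1) + pow2 (F j)) (hlast : T (k + 1) = 0) :
    M.PowSum (graphOf F) k (T 0) := by
  have hle (j : M.Num) : j ≤ k + 1 → T j ≤ T 0 := by
    induction j using sigma_induction with
    | hP => infer_instance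
    | zero => exact fun _ ↦ le_rfl
    | succ j ih =>
      intro hj
      refine le_trans ?_ (ih (le_self_add.trans hj))
      rw [hT j ((add_le_add_iff_right 1).1 hj)]
      exact le_self_add
  have : Recursive₁ fun j ↦ T 0 - T j := ⟨inferInstance⟩
  refine ⟨_, isFun_graphOf fun j ↦ T 0 - T j, app_graphOf.2 (tsub_self _).symm,
    fun j n p v hj hn hp hv ↦ ?_, app_graphOf.2 (by rw [hlast, tsub_zero])⟩
  have hj : j ≤ k := le_iff_lt_or_eq.2 hj
  rw [app_graphOf] at *
  rw [hv, pow_iff.1 hp, hn, eq_comm, tsub_eq_iff_eq_add_of_le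
    (hle _ ((add_le_add_iff_right 1).2 hj)), add_assoc, add_comm (pow2 _), ← hT j hj,
    tsub_add_cancel_of_le (hle _ (hj.trans le_self_add))]

variable {b c : Set M.Num} {B : M.Num → M.Num} {C : M.Num → M.Num → M.Num} [Recursive₂ C]

theorem GoodsteinStep.eq_mapExp (hC : ∀ i n k, M.FamApp c i n k → k = C i n) {i u v : M.Num}
    (h : M.GoodsteinStep b c i u v) (hu : u ≠ 0) : v + 1 = mapExp C i u := by
  rcases h with h | ⟨k, f, g, hf, hg, -, hdec, hu', hfg, hv⟩
  · exact (hu h.1).elim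
  obtain ⟨F, _, hF⟩ := hf.exists_recursive
  obtain ⟨G, _, hG⟩ := hg.exists_recursive
  obtain ⟨S, _, hS0, hS, rfl⟩ := hu'.exists_recursive hF
  obtain ⟨T, _, hT0, hT, hTv⟩ := hv.exists_recursive hG
  simp only [hF, hG] at hdec hfg
  suffices ∀ j, j ≤ k → T (j + 1) = mapExp C i (S (j + 1)) ∧ pow2 (F j) ∣ S (j + 1) from
    hTv ▸ (this k le_rfl).1
  intro j
  induction j using sigma_induction with
  | hP => infer_instance
  | zero =>
    intro h
    rw [hS 0 h, hT 0 h, hS0, hT0, zero_add, zero_add, mapExp_pow2,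
      hC _ _ _ (hfg 0 _ _ h.lt_or_eq rfl rfl)]
    exact ⟨rfl, dvd_rfl⟩
  | succ j ih =>
    intro h
    obtain ⟨hTS, hdvd⟩ := ih (le_self_add.trans h)
    have hlt := hdec j _ _ (Order.add_one_le_iff.1 h) rfl rfl
    rw [hS _ h, hT _ h, mapExp_add hdvd (pow2_lt_pow2.2 hlt), mapExp_pow2, hTS,
      hC _ _ _ (hfg _ _ _ h.lt_or_eq rfl rfl)]
    exact ⟨rfl, dvd_add ((pow2_dvd_pow2 hlt.le).trans hdvd) dvd_rfl⟩

instance : Recursive₂ (M := M) (fun u _ ↦ u) := ⟨inferInstance⟩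

instance : Recursive₄ (M := M) (fun _ _ _ a ↦ a - pow2 (log2 a)) := ⟨inferInstance⟩

/-- The number that remains when the `j` leading summands of the binary representation of `u` are
removed. -/
noncomputable def digitTail (u j : M.Num) : M.Num :=
  primRec (fun u _ ↦ u) (fun _ _ _ a ↦ a - pow2 (log2 a)) u 0 j

instance : Recursive₂ (M := M) digitTail := ⟨by unfold digitTail; infer_instance⟩

theorem digitTail_zero (u : M.Num) : digitTail u 0 = u := primRec_zero ..

theorem digitTail_add_one (u j : M.Num) :
    digitTail u (j + 1) = digitTail u j - pow2 (log2 (digitTail u j)) := primRec_succ ..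

theorem digitTail_le (u j : M.Num) : digitTail u j ≤ u := by
  induction j using sigma_induction with
  | hP => infer_instance
  | zero => rw [digitTail_zero]
  | succ j h => rw [digitTail_add_one]; exact tsub_le_self.trans h

theorem digitTail_eq_add {u j : M.Num} (h : digitTail u j ≠ 0) :
    digitTail u j = digitTail u (j + 1) + pow2 (log2 (digitTail u j)) := by
  rw [digitTail_add_one, tsub_add_cancel_of_le (pow2_log2_le h)]

theorem exists_digitTail_eq_zero (u : M.Num) : ∃ j, digitTail u j = 0 := by
  suffices ∀ j, digitTail u j = 0 ∨ digitTail u j + j ≤ u from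
    ⟨u + 1, (this _).resolve_right fun h ↦ (le_add_self.trans h).not_gt (lt_add_one u)⟩
  intro j
  induction j using sigma_induction with
  | hP => infer_instance
  | zero => exact .inr (by rw [digitTail_zero, add_zero])
  | succ j ih =>
    rcases eq_or_ne (digitTail u j) 0 with h | h
    · left
      rw [digitTail_add_one, h, tsub_eq_zero_of_le zero_le]
    · right
      calc digitTail u (j + 1) + (j + 1) = digitTail u (j + 1) + 1 + j := by ring
        _ ≤ digitTail u (j + 1) + pow2 (log2 (digitTail u j)) + j := by
          gcongr
          exact one_le_pow2 _
        _ = digitTail u j + j := by rw [← digitTail_eq_add h]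
        _ ≤ u := ih.resolve_left h

theorem GoodsteinStep.of_eq_mapExp (hB : ∀ i u, M.App b i u ↔ u = B i)
    (hC : ∀ i n, n < B i → M.FamApp c i n (C i n)) {i u v : M.Num} (hu : u ≠ 0)
    (huB : u < pow2 (B i)) (h : v + 1 = mapExp C i u) : M.GoodsteinStep b c i u v := by
  obtain ⟨K, hK, hlt⟩ := sigma_exists_least (P := fun j ↦ digitTail u j = 0) inferInstance
    (exists_digitTail_eq_zero u)
  obtain ⟨k, rfl⟩ : ∃ k, K = k + 1 := exists_eq_add_one fun h ↦ hu (by rw [← hK, h, digitTail_zero])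
  have hne (j) (hj : j ≤ k) : digitTail u j ≠ 0 := hlt j (Order.lt_add_one_iff.2 hj)
  have : Recursive₁ fun j ↦ log2 (digitTail u j) := ⟨inferInstance⟩
  have : Recursive₁ fun j ↦ C i (log2 (digitTail u j)) := ⟨inferInstance⟩
  have : Recursive₁ fun j ↦ mapExp C i (digitTail u j) := ⟨inferInstance⟩
  have : Recursive₁ (digitTail u) := ⟨inferInstance⟩
  refine .inr ⟨k, graphOf fun j ↦ log2 (digitTail u j), graphOf fun j ↦ C i (log2 (digitTail u j)),
    isFun_graphOf _, isFun_graphOf _, ?_, ?_, ?_, ?_, ?_⟩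
  · simp only [app_graphOf, hB]
    rintro _ _ rfl rfl
    rw [digitTail_zero]
    exact log2_lt hu huB
  · simp only [app_graphOf]
    rintro j _ _ hj rfl rfl
    refine log2_lt (hne _ (Order.add_one_le_iff.2 hj)) ?_
    rw [digitTail_add_one]
    exact sub_pow2_log2_lt _
  · have := PowSum.of_tail (T := digitTail u) (fun j hj ↦ digitTail_eq_add (hne j hj)) hK
    rwa [digitTail_zero] at this
  · simp only [app_graphOf]
    rintro j _ _ hj rfl rfl
    exact hC _ _ (log2_lt (hne j (le_iff_lt_or_eq.2 hj)) ((digitTail_le u j).trans_lt huB))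
  · have := PowSum.of_tail (k := k) (F := fun j ↦ C i (log2 (digitTail u j)))
      (T := fun j ↦ mapExp C i (digitTail u j))
      (fun j hj ↦ by rw [digitTail_add_one]; exact mapExp_eq_add (hne j hj))
      (by rw [hK, mapExp_zero])
    rwa [digitTail_zero, ← h] at this

end Step

/-! ## Termination of Goodstein sequences -/

section Iteration

variable {M : SecondOrderStructure.{u}} [hM : Fact M.ModelsRCA]

instance : Recursive₂ (M := M) (fun _ x ↦ x) := ⟨inferInstance⟩

variable (D : M.Num → M.Num → M.Num) [Recursive₂ D]

open Classical in
instance : Recursive₄ (M := M) (fun i x k a ↦ if k < i then x else D k a) := ⟨inferInstance⟩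

open Classical in
/-- The value of `D (k - 1) ∘ … ∘ D i` at `x` (which is `x` if `k ≤ i`). -/
noncomputable def iter (i x k : M.Num) : M.Num :=
  primRec (fun _ x ↦ x) (fun i x k a ↦ if k < i then x else D k a) i x k

instance : Recursive₃ (iter D) := ⟨by unfold iter; infer_instance⟩

variable {D}

theorem iter_of_le {i x k : M.Num} (h : k ≤ i) : iter D i x k = x := by
  induction k using sigma_induction with
  | hP => infer_instance
  | zero => exact primRec_zero ..
  | succ k _ => exact (primRec_succ ..).trans (if_pos (Order.add_one_le_iff.1 h))

theorem iter_add_one {i k : M.Num} (h : i ≤ k) (x : M.Num) :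
    iter D i x (k + 1) = D k (iter D i x k) :=
  (primRec_succ ..).trans (if_neg h.not_gt)

theorem iter_strictMono (hD : ∀ i, StrictMono (D i)) (i k : M.Num) :
    StrictMono fun x ↦ iter D i x k := by
  intro x y hxy
  induction k using sigma_induction with
  | hP => infer_instance
  | zero => simpa only [iter_of_le zero_le] using hxy
  | succ k ih =>
    rcases lt_or_ge k i with h | h
    · simpa only [iter_of_le (Order.add_one_le_iff.2 h)] using hxy
    · simpa only [iter_add_one h] using hD k ih

theorem iter_iter {i j k : M.Num} (hij : i ≤ j) (hjk : j ≤ k) (x : M.Num) :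
    iter D j (iter D i x j) k = iter D i x k := by
  obtain ⟨d, rfl⟩ := exists_add_of_le hjk
  clear hjk
  induction d using sigma_induction with
  | hP => infer_instance
  | zero => rw [add_zero, iter_of_le le_rfl]
  | succ d ih =>
    rw [← add_assoc, iter_add_one le_self_add, ih, iter_add_one (hij.trans le_self_add)]

variable {C : M.Num → M.Num → M.Num} [Recursive₂ C]

theorem IterApp.eq_iter {c : Set M.Num} (hc : ∀ i n k, M.FamApp c i n k → k = C i n)
    {i j x y : M.Num} (h : M.IterApp c i j x y) (hij : i ≤ j) : y = iter C i x j := by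
  obtain ⟨f, hf, hx, hy, h⟩ := h
  obtain ⟨F, _, hF⟩ := hf.exists_recursive
  simp only [hF] at hx hy h
  obtain ⟨d, rfl⟩ := exists_add_of_le hij
  suffices ∀ e, e ≤ d → F (i + e) = iter C i x (i + e) by rw [hy, this d le_rfl]
  intro e
  induction e using sigma_induction with
  | hP => infer_instance
  | zero => intro _; rw [add_zero, iter_of_le le_rfl, hx]
  | succ e ih =>
    intro he
    rw [← add_assoc, iter_add_one le_self_add, ← ih (le_self_add.trans he)]
    exact hc _ _ _ (h (i + e) _ _ (le_self_add (a := i)).lt_or_eq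
      (add_lt_add_right (Order.add_one_le_iff.1 he) _) rfl rfl)

theorem iter_lt {B : M.Num → M.Num} [Recursive₁ B] (hC : ∀ i n, n < B i → C i n < B (i + 1))
    {i x k : M.Num} (hx : x < B i) (hik : i ≤ k) : iter C i x k < B k := by
  obtain ⟨d, rfl⟩ := exists_add_of_le hik
  clear hik
  induction d using sigma_induction with
  | hP => infer_instance
  | zero => rwa [add_zero, iter_of_le le_rfl]
  | succ d ih => rw [← add_assoc, iter_add_one le_self_add]; exact hC _ _ ih

theorem iterApp_iter {c : Set M.Num} {B : M.Num → M.Num} [Recursive₁ B]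
    (hc : ∀ i n, n < B i → M.FamApp c i n (C i n)) (hC : ∀ i n, n < B i → C i n < B (i + 1))
    {i x : M.Num} (hx : x < B i) (j : M.Num) : M.IterApp c i j x (iter C i x j) := by
  have : Recursive₁ (iter C i x) := ⟨inferInstance⟩
  refine ⟨_, isFun_graphOf (iter C i x), ?_, app_graphOf.2 rfl, fun k u v hik _ hu hv ↦ ?_⟩
  · rw [app_graphOf, iter_of_le le_rfl]
  · have hik : i ≤ k := le_iff_lt_or_eq.2 hik
    rw [app_graphOf] at hu hv
    rw [hu, hv, iter_add_one hik]
    exact hc _ _ (iter_lt hC hx hik)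

theorem iter_mapExp_add (hC : ∀ i, StrictMono (C i)) {i U T t : M.Num} (hU : pow2 t ∣ U)
    (hT : T < pow2 t) {k : M.Num} (hik : i ≤ k) :
    pow2 (iter C i t k) ∣ iter (mapExp C) i U k ∧ iter (mapExp C) i T k < pow2 (iter C i t k) ∧
      iter (mapExp C) i (U + T) k = iter (mapExp C) i U k + iter (mapExp C) i T k := by
  obtain ⟨d, rfl⟩ := exists_add_of_le hik
  clear hik
  induction d using sigma_induction with
  | hP => infer_instance
  | zero => simp only [add_zero, iter_of_le le_rfl, hU, hT, and_self]
  | succ d ih =>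
    obtain ⟨hdvd, hlt, hadd⟩ := ih
    simp only [← add_assoc, iter_add_one (le_self_add (a := i))]
    exact ⟨dvd_mapExp (hC _) hdvd, mapExp_lt (hC _) hlt, by rw [hadd, mapExp_add hdvd hlt]⟩

theorem iter_mapExp_pow2 {i t k : M.Num} (hik : i ≤ k) :
    iter (mapExp C) i (pow2 t) k = pow2 (iter C i t k) := by
  obtain ⟨d, rfl⟩ := exists_add_of_le hik
  clear hik
  induction d using sigma_induction with
  | hP => infer_instance
  | zero => simp only [add_zero, iter_of_le le_rfl]
  | succ d ih => simp only [← add_assoc, iter_add_one (le_self_add (a := i)), ih, mapExp_pow2]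

theorem iter_mapExp_zero {i k : M.Num} : iter (mapExp C) i 0 k = 0 := by
  induction k using sigma_induction with
  | hP => infer_instance
  | zero => exact iter_of_le zero_le
  | succ k ih =>
    rcases lt_or_ge k i with h | h
    · exact iter_of_le (Order.add_one_le_iff.2 h)
    · rw [iter_add_one h, ih, mapExp_zero]

theorem pow2_iter_add_one_dvd (hC : ∀ i, StrictMono (C i)) {i U t : M.Num}
    (hU : pow2 (t + 1) ∣ U) {k : M.Num} (hik : i ≤ k) :
    pow2 (iter C i t k + 1) ∣ iter (mapExp C) i U k :=
  (pow2_dvd_pow2 (Order.add_one_le_iff.2 (iter_strictMono hC i k (lt_add_one t)))).trans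
    (iter_mapExp_add hC hU (pow2_pos _) hik).1

end Iteration

section Goodstein

variable {M : SecondOrderStructure.{u}} [hM : Fact M.ModelsRCA]
  {C : M.Num → M.Num → M.Num} [Recursive₂ C]

instance : Recursive₄ (M := M) (fun _ _ i a ↦ mapExp C i a - 1) := ⟨inferInstance⟩

variable (C) in
/-- The Goodstein sequence with starting value `m`, for exponents that are changed by `C i` in
step `i`. -/
noncomputable def goodstein (m i : M.Num) : M.Num :=
  primRec (fun u _ ↦ u) (fun _ _ i a ↦ mapExp C i a - 1) m 0 i

instance : Recursive₂ (goodstein C) := ⟨by unfold goodstein; infer_instance⟩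

theorem goodstein_zero (m : M.Num) : goodstein C m 0 = m := primRec_zero ..

theorem goodstein_add_one (m i : M.Num) :
    goodstein C m (i + 1) = mapExp C i (goodstein C m i) - 1 := primRec_succ ..

theorem goodstein_add_one_add_one {m i : M.Num} (h : goodstein C m i ≠ 0) :
    goodstein C m (i + 1) + 1 = mapExp C i (goodstein C m i) := by
  rw [goodstein_add_one]
  exact tsub_add_cancel_of_le (Order.one_le_iff_pos.2 (mapExp_pos h))

theorem goodstein_lt {B : M.Num → M.Num} [Recursive₁ B] (hC : ∀ i, StrictMono (C i))
    (hB : ∀ i, C i (B i) = B (i + 1)) {m : M.Num} (hm : m < pow2 (B 0)) (i : M.Num) :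
    goodstein C m i < pow2 (B i) := by
  induction i using sigma_induction with
  | hP => infer_instance
  | zero => rwa [goodstein_zero]
  | succ i h =>
    rw [goodstein_add_one, ← hB]
    exact tsub_le_self.trans_lt (mapExp_lt (hC i) h)

theorem val2_goodstein_lt {B : M.Num → M.Num} [Recursive₁ B] (hC : ∀ i, StrictMono (C i))
    (hB : ∀ i, C i (B i) = B (i + 1)) {m i : M.Num} (hm : m < pow2 (B 0))
    (h : goodstein C m i ≠ 0) : val2 (goodstein C m i) < B i :=
  pow2_lt_pow2.1 ((le_of_dvd (val2_spec h).1 h).trans_lt (goodstein_lt hC hB hm i))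

theorem exists_goodstein_add_one_eq {m i V T s : M.Num} (hG : goodstein C m i = V + T)
    (hV : pow2 s ∣ V) (hT : T < pow2 s) (hT0 : T ≠ 0) :
    ∃ S, S < mapExp C i T ∧ goodstein C m (i + 1) = mapExp C i V + S := by
  have hG0 : goodstein C m i ≠ 0 := hG ▸ (add_pos_of_nonneg_of_pos zero_le
    (pos_iff_ne_zero.2 hT0)).ne'
  obtain ⟨S, hS⟩ := exists_eq_add_one (mapExp_pos (C := C) (i := i) hT0).ne'
  have h := goodstein_add_one_add_one hG0
  rw [hG, mapExp_add hV hT, hS, ← add_assoc] at h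
  exact ⟨S, hS ▸ lt_add_one S, add_right_cancel h⟩

theorem goodstein_eq_iter_add (hC : ∀ i, StrictMono (C i)) {m j j' U t : M.Num}
    (h0 : ∀ i, goodstein C m i ≠ 0) (hU : pow2 (t + 1) ∣ U) (hG : goodstein C m j = U + pow2 t)
    (hlt : ∀ k, j < k → k < j' → val2 (goodstein C m k) < iter C j t k) (d : M.Num) :
    j + 1 + d ≤ j' → ∃ T, goodstein C m (j + 1 + d) = iter (mapExp C) j U (j + 1 + d) + T ∧
      T < pow2 (iter C j t (j + 1 + d)) := by
  induction d using sigma_induction with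
  | hP => infer_instance
  | zero =>
    intro _
    obtain ⟨T, hT, hGT⟩ :=
      exists_goodstein_add_one_eq hG hU (pow2_lt_pow2_add_one t) (pow2_pos t).ne'
    rw [mapExp_pow2] at hT
    rw [add_zero, iter_add_one le_rfl, iter_add_one le_rfl, iter_of_le le_rfl, iter_of_le le_rfl]
    exact ⟨T, hGT, hT⟩
  | succ d ih =>
    intro hd
    rw [← add_assoc] at hd ⊢
    have hjd : j ≤ j + 1 + d := le_self_add.trans le_self_add
    have hdvd := pow2_iter_add_one_dvd hC hU hjd
    have hdvd' := (pow2_dvd_pow2 le_self_add).trans hdvd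
    obtain ⟨T, hGT, hT⟩ := ih (le_self_add.trans hd)
    have hT0 : T ≠ 0 := by
      rintro rfl
      refine (hlt (j + 1 + d) ((lt_add_one j).trans_le le_self_add)
        (Order.add_one_le_iff.1 hd)).not_ge ?_
      rwa [le_val2_iff (h0 _), hGT, add_zero]
    obtain ⟨S, hS, hGS⟩ := exists_goodstein_add_one_eq hGT hdvd' hT hT0
    rw [iter_add_one hjd, iter_add_one hjd]
    exact ⟨S, hGS, hS.trans (mapExp_lt (hC _) hT)⟩

theorem goodstein_eq_iter_of_first_return (hC : ∀ i, StrictMono (C i)) {m j j' U t : M.Num}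
    (h0 : ∀ i, goodstein C m i ≠ 0) (hU : pow2 (t + 1) ∣ U) (hG : goodstein C m j = U + pow2 t)
    (hj : j < j') (hlt : ∀ k, j < k → k < j' → val2 (goodstein C m k) < iter C j t k)
    (hle : iter C j t j' ≤ val2 (goodstein C m j')) :
    goodstein C m j' = iter (mapExp C) j U j' := by
  obtain ⟨d, rfl⟩ := exists_add_of_le (Order.add_one_le_iff.2 hj)
  obtain ⟨T, hGT, hT⟩ := goodstein_eq_iter_add hC h0 hU hG hlt d le_rfl
  rw [le_val2_iff (h0 _), hGT] at hle
  have hdvd : pow2 (iter C j t (j + 1 + d)) ∣ T := dvd_of_dvd_add_left hle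
    ((pow2_dvd_pow2 le_self_add).trans (pow2_iter_add_one_dvd hC hU hj.le))
  have hT0 : T = 0 := by_contra fun h ↦ hT.not_ge (le_of_dvd hdvd h)
  rw [hGT, hT0, add_zero]

variable (C) in
/-- The last exponent in the binary representation of the value at `j`, carried along by `C`, is
bounded by the last exponent of some later value. -/
def HasReturn (m j : M.Num) : Prop :=
  ∃ j', j < j' ∧ iter C j (val2 (goodstein C m j)) j' ≤ val2 (goodstein C m j')

theorem HasReturn.exists_goodstein_eq_iter (hC : ∀ i, StrictMono (C i)) {m i j V t : M.Num}
    (h0 : ∀ i, goodstein C m i ≠ 0) (hij : i ≤ j) (hV : pow2 (t + 1) ∣ V)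
    (hG : goodstein C m j = iter (mapExp C) i (V + pow2 t) j) (hret : HasReturn C m j) :
    ∃ j', i ≤ j' ∧ goodstein C m j' = iter (mapExp C) i V j' := by
  rw [(iter_mapExp_add hC hV (pow2_lt_pow2_add_one t) hij).2.2, iter_mapExp_pow2 hij] at hG
  have hdvd := pow2_iter_add_one_dvd hC hV hij
  have hval : val2 (goodstein C m j) = iter C i t j := by
    refine val2_eq (h0 j) ?_ fun h ↦ ?_
    · rw [hG]
      exact dvd_add ((pow2_dvd_pow2 le_self_add).trans hdvd) dvd_rfl
    · rw [hG] at h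
      exact (pow2_lt_pow2_add_one _).not_ge
        (le_of_dvd (dvd_of_dvd_add_left h hdvd) (pow2_pos _).ne')
  obtain ⟨j', ⟨hjj', hle⟩, hmin⟩ := sigma_exists_least (by infer_instance) hret
  rw [hval] at hle hmin
  refine ⟨j', hij.trans hjj'.le, ?_⟩
  rw [← iter_iter hij hjj'.le]
  exact goodstein_eq_iter_of_first_return hC h0 hdvd hG hjj'
    (fun k hk hk' ↦ not_le.1 fun hle ↦ hmin k hk' ⟨hk, hle⟩) hle

theorem exists_goodstein_eq_zero {B : M.Num → M.Num} [Recursive₁ B] (hC : ∀ i, StrictMono (C i))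
    (hB : ∀ i, C i (B i) = B (i + 1)) {m : M.Num} (hm : m < pow2 (B 0)) {i : M.Num}
    (hret : ∀ j, i ≤ j → HasReturn C m j) : ∃ j, goodstein C m j = 0 := by
  by_contra! h0
  -- One after the other, the summands of the value at `i` are used up, beginning with the last.
  have key (t : M.Num) : ∃ j, i ≤ j ∧ ∃ U, pow2 t ∣ U ∧ U ≤ goodstein C m i ∧
      goodstein C m j = iter (mapExp C) i U j := by
    induction t using sigma_induction with
    | hP => infer_instance
    | zero =>
      exact ⟨i, le_rfl, _, by rw [pow2_zero]; exact one_dvd _, le_rfl, (iter_of_le le_rfl).symm⟩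
    | succ t ih =>
      obtain ⟨j, hj, U, hU, hUle, hG⟩ := ih
      by_cases hUt : pow2 (t + 1) ∣ U
      · exact ⟨j, hj, U, hUt, hUle, hG⟩
      · obtain ⟨V, rfl, hV⟩ := exists_eq_add_pow2 hU hUt
        obtain ⟨j', hj', hG'⟩ := (hret j hj).exists_goodstein_eq_iter hC h0 hj hV hG
        exact ⟨j', hj', V, hV, le_self_add.trans hUle, hG'⟩
  obtain ⟨j, _, U, hU, hUle, hG⟩ := key (B i)
  have hU0 : U = 0 :=
    by_contra fun h ↦ (hUle.trans_lt (goodstein_lt hC hB hm i)).not_ge (le_of_dvd hU h)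
  rw [hU0, iter_mapExp_zero] at hG
  exact h0 j hG

end Goodstein

section OfComprehension

variable {M : SecondOrderStructure.{u}} [hM : Fact M.ModelsRCA] {b c : Set M.Num}
  {B : M.Num → M.Num} {C : M.Num → M.Num → M.Num}

theorem IsFamily.exists_recursive [Recursive₁ B] (h : M.IsFamily b c)
    (hB : ∀ i u, M.App b i u ↔ u = B i) : ∃ C : M.Num → M.Num → M.Num, Recursive₂ C ∧
      (∀ i n k, M.FamApp c i n k ↔ n < B i ∧ k = C i n) ∧
      ∀ i n, B i ≤ n → C i n = B (i + 1) + (n - B i) := by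
  have hlt {i n k : M.Num} (hk : M.FamApp c i n k) : n < B i := by
    obtain ⟨i', n', k', u, hx, hu, hn⟩ := h.domain _ hk
    obtain ⟨hin, rfl⟩ := pair_inj.1 hx
    obtain ⟨rfl, rfl⟩ := pair_inj.1 hin
    rwa [(hB _ _).1 hu] at hn
  have htotal (i n : M.Num) :
      ∃! k, M.FamApp c i n k ∨ B i ≤ n ∧ k = B (i + 1) + (n - B i) := by
    rcases lt_or_ge n (B i) with hn | hn
    · obtain ⟨k, hk, huniq⟩ := h.total i n _ ((hB _ _).2 rfl) hn
      exact ⟨k, .inl hk, fun k' hk' ↦ huniq k' (hk'.resolve_right fun hk' ↦ hk'.1.not_gt hn)⟩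
    · exact ⟨_, .inr ⟨hn, rfl⟩, fun k' hk' ↦ (hk'.resolve_left fun hk' ↦ hn.not_gt (hlt hk')).2⟩
  choose C hC huniq using htotal
  refine ⟨C, ⟨.of_graph (fun v a ↦
    M.pair (M.pair (v 0) (v 1)) a ∈ (⟨c, h.mem_sets⟩ : M.sets).1 ∨
    B (v 0) ≤ v 1 ∧ a = B (v 0 + 1) + (v 1 - B (v 0))) fun v a ↦ ?_⟩, fun i n k ↦ ?_,
    fun i n hn ↦ (huniq i n _ (.inr ⟨hn, rfl⟩)).symm⟩
  · exact ⟨fun e ↦ e ▸ hC _ _, fun h ↦ (huniq _ _ _ h).symm⟩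
  · refine ⟨fun hk ↦ ⟨hlt hk, huniq i n k (.inl hk)⟩, ?_⟩
    rintro ⟨hn, rfl⟩
    exact (hC i n).resolve_right fun h ↦ h.1.not_gt hn

/-- The functions `c_i` are extended to all numbers, with `c_i(b(i) + n) = b(i + 1) + n`. -/
theorem GoodsteinSystem.exists_recursive (h : M.GoodsteinSystem b c) :
    ∃ (B : M.Num → M.Num) (C : M.Num → M.Num → M.Num), Recursive₁ B ∧ Recursive₂ C ∧
      (∀ i u, M.App b i u ↔ u = B i) ∧ (∀ i n k, M.FamApp c i n k ↔ n < B i ∧ k = C i n) ∧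
      (∀ i, StrictMono (C i)) ∧ ∀ i, C i (B i) = B (i + 1) := by
  obtain ⟨B, _, hB⟩ := h.isFun.exists_recursive
  obtain ⟨C, _, hfam, hge⟩ := h.isFamily.exists_recursive hB
  refine ⟨B, C, ‹_›, ‹_›, hB, hfam, fun i x y hxy ↦ ?_, fun i ↦ ?_⟩
  · rcases lt_or_ge y (B i) with hy | hy
    · exact h.strictMono i x y _ _ hxy ((hfam _ _ _).2 ⟨hxy.trans hy, rfl⟩)
        ((hfam _ _ _).2 ⟨hy, rfl⟩)
    rw [hge i y hy]
    rcases lt_or_ge x (B i) with hx | hx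
    · exact (h.isFamily.codomain i x _ _ ((hfam _ _ _).2 ⟨hx, rfl⟩) ((hB _ _).2 rfl)).trans_le
        le_self_add
    · rw [hge i x hx]
      exact add_lt_add_right (tsub_lt_tsub_right_of_le hx hxy) _
  · rw [hge i _ le_rfl, tsub_self, add_zero]

theorem isGoodsteinSequence_goodstein [Recursive₁ B] [Recursive₂ C]
    (hB : ∀ i u, M.App b i u ↔ u = B i) (hfam : ∀ i n, n < B i → M.FamApp c i n (C i n))
    (hC : ∀ i, StrictMono (C i)) (hCB : ∀ i, C i (B i) = B (i + 1)) {m : M.Num}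
    (hm : m < pow2 (B 0)) : M.IsGoodsteinSequence b c m (graphOf (goodstein C m)) := by
  have : Recursive₁ (goodstein C m) := ⟨inferInstance⟩
  refine ⟨isFun_graphOf _, app_graphOf.2 (goodstein_zero m).symm, fun i u v hu hv ↦ ?_⟩
  obtain rfl := app_graphOf.1 hu
  obtain rfl := app_graphOf.1 hv
  rcases eq_or_ne (goodstein C m i) 0 with h | h
  · exact .inl ⟨h, by rw [goodstein_add_one, h, mapExp_zero, tsub_eq_zero_of_le zero_le]⟩
  · exact .of_eq_mapExp hB hfam h (goodstein_lt hC hCB hm i) (goodstein_add_one_add_one h)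

theorem GoodsteinSystem.exists_hasReturn [Recursive₁ B] [Recursive₂ C] (h : M.GoodsteinSystem b c)
    (hB : ∀ i u, M.App b i u ↔ u = B i) (hfam : ∀ i n k, M.FamApp c i n k → k = C i n)
    (hC : ∀ i, StrictMono (C i)) (hCB : ∀ i, C i (B i) = B (i + 1)) {m : M.Num}
    (hm : m < pow2 (B 0)) (h0 : ∀ i, goodstein C m i ≠ 0) {Y : Set M.Num}
    (hY : M.IsInfinite Y) : ∃ i ∈ Y, HasReturn C m i := by
  have : Recursive₁ fun i ↦ val2 (goodstein C m i) := ⟨inferInstance⟩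
  have hlt (i u v : M.Num) (hu : M.App (graphOf fun i ↦ val2 (goodstein C m i)) i u)
      (hv : M.App b i v) : u < v := by
    rw [app_graphOf.1 hu, (hB _ _).1 hv]
    exact val2_goodstein_lt hC hCB hm (h0 i)
  obtain ⟨i, hi, j, -, hij, x, y, z, hx, hy, hz, hyz⟩ := h.recurrent _ Y (isFun_graphOf _) hlt hY
  refine ⟨i, hi, j, hij, ?_⟩
  rw [← app_graphOf.1 hx, ← app_graphOf.1 hz, ← hy.eq_iter hfam hij.le]
  exact le_iff_lt_or_eq.2 hyz

/-- Every set that is defined by a `Σ⁰₁` formula with parameters belongs to the model. -/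
def SigmaOneComprehension (M : SecondOrderStructure.{u}) : Prop :=
  ∀ P : M.Num → Prop, (SigmaOne M fun v : Fin 1 → M.Num ↦ P (v 0)) → {n | P n} ∈ M.sets

theorem SigmaOneComprehension.extendedGoodstein (h : M.SigmaOneComprehension) :
    M.ExtendedGoodstein := by
  intro b c hbc m w p hw hp hm
  obtain ⟨B, C, _, _, hB, hfam, hC, hCB⟩ := hbc.exists_recursive
  rw [pow_iff.1 hp, (hB _ _).1 hw] at hm
  refine ⟨_, isGoodsteinSequence_goodstein hB (fun i n hn ↦ (hfam _ _ _).2 ⟨hn, rfl⟩) hC hCB hm, ?_⟩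
  by_contra! h0
  replace h0 (i : M.Num) : goodstein C m i ≠ 0 := fun hi ↦ h0 i (app_graphOf.2 hi.symm)
  obtain ⟨X, hX⟩ : ∃ X : M.sets, ∀ i, i ∈ (X : Set M.Num) ↔ HasReturn C m i :=
    ⟨⟨_, h (HasReturn C m) (by unfold HasReturn; infer_instance)⟩, fun _ ↦ .rfl⟩
  have hnot : {i | i ∉ (X : Set M.Num)} ∈ M.sets := delta_comprehension inferInstance
  by_cases hinf : ∀ n, ∃ k ∈ {i | i ∉ (X : Set M.Num)}, n < k
  · obtain ⟨i, hi, hret⟩ := hbc.exists_hasReturn hB (fun i n k hk ↦ ((hfam _ _ _).1 hk).2) hC hCB hm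
      h0 ⟨hnot, hinf⟩
    exact hi ((hX i).2 hret)
  · push Not at hinf
    obtain ⟨N, hN⟩ := hinf
    obtain ⟨i, hi⟩ := exists_goodstein_eq_zero hC hCB hm (i := N + 1) fun j hj ↦
      by_contra fun hret ↦ (hN j (mt (hX j).1 hret)).not_gt (Order.add_one_le_iff.1 hj)
    exact h0 i hi

end OfComprehension

/-! ## The Goodstein system of an enumeration -/

section Family

variable {M : SecondOrderStructure.{u}} [hM : Fact M.ModelsRCA]

/-- The set that codes the restrictions of the functions `C i` to the numbers below `B i`. The
bounds on `i` and `n` make it `Δ⁰₁`. -/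
def familyOf (B : M.Num → M.Num) (C : M.Num → M.Num → M.Num) : Set M.Num :=
  {x | ∃ i, i < x + 1 ∧ ∃ n, n < x + 1 ∧ n < B i ∧ x = M.pair (M.pair i n) (C i n)}

variable {B : M.Num → M.Num} {C : M.Num → M.Num → M.Num}

theorem famApp_familyOf {i n k : M.Num} :
    M.FamApp (familyOf B C) i n k ↔ n < B i ∧ k = C i n := by
  constructor
  · rintro ⟨i', -, n', -, h, hx⟩
    obtain ⟨hin, rfl⟩ := pair_inj.1 hx
    obtain ⟨rfl, rfl⟩ := pair_inj.1 hin
    exact ⟨h, rfl⟩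
  · rintro ⟨h, rfl⟩
    exact ⟨i, Order.lt_add_one_iff.2 ((left_le_pair _ _).trans (left_le_pair _ _)),
      n, Order.lt_add_one_iff.2 ((right_le_pair _ _).trans (left_le_pair _ _)), h, rfl⟩

variable [Recursive₁ B] [Recursive₂ C]

theorem isFamily_familyOf (h : ∀ i n, n < B i → C i n < B (i + 1)) :
    M.IsFamily (graphOf B) (familyOf B C) where
  mem_sets := delta_comprehension inferInstance
  domain := by
    rintro x ⟨i, -, n, -, hn, hx⟩
    exact ⟨i, n, _, _, hx, app_graphOf.2 rfl, hn⟩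
  total i n u hu hn :=
    ⟨C i n, famApp_familyOf.2 ⟨app_graphOf.1 hu ▸ hn, rfl⟩, fun _ hk ↦ (famApp_familyOf.1 hk).2⟩
  codomain i n k v hk hv := by
    obtain ⟨hn, rfl⟩ := famApp_familyOf.1 hk
    exact app_graphOf.1 hv ▸ h i n hn

variable (B C) in
/-- The sequence `D` below `B` and the infinite set `Y` violate the condition on Goodstein systems
for the functions `C i`. -/
structure IsBadSequence (D : M.Num → M.Num) (Y : M.sets) : Prop where
  lt : ∀ i, D i < B i
  isInfinite : M.IsInfinite Y
  lt_iter : ∀ i ∈ (Y : Set M.Num), ∀ j ∈ (Y : Set M.Num), i < j → D j < iter C i (D i) j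

theorem goodsteinSystem_familyOf (hB : Monotone B) (hpos : 0 < B 0)
    (hBC : ∀ i n, n < B i → C i n < B (i + 1)) (hC : ∀ i, StrictMono (C i))
    (hbad : ∀ (D : M.Num → M.Num) (Y : M.sets), Recursive₁ D → ¬ IsBadSequence B C D Y) :
    M.GoodsteinSystem (graphOf B) (familyOf B C) where
  isFun := isFun_graphOf B
  mono i j u v hij hu hv := by
    rw [app_graphOf.1 hu, app_graphOf.1 hv]
    exact le_iff_lt_or_eq.1 (hB (le_iff_lt_or_eq.2 hij))
  pos u hu := app_graphOf.1 hu ▸ hpos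
  isFamily := isFamily_familyOf hBC
  strictMono i n n' k k' hn hk hk' := by
    rw [(famApp_familyOf.1 hk).2, (famApp_familyOf.1 hk').2]
    exact hC i hn
  recurrent d Y hd hdB hY := by
    obtain ⟨D, hD, hdD⟩ := hd.exists_recursive
    have hDB (i : M.Num) : D i < B i := hdB i _ _ ((hdD _ _).2 rfl) (app_graphOf.2 rfl)
    by_contra! hcon
    refine hbad D ⟨Y, hY.1⟩ hD ⟨hDB, hY, fun i hi j hj hij ↦ not_le.1 fun hle ↦ ?_⟩
    exact hcon i hi j hj hij _ _ _ ((hdD _ _).2 rfl)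
      (iterApp_iter (fun i n hn ↦ famApp_familyOf.2 ⟨hn, rfl⟩) hBC (hDB i) j) ((hdD _ _).2 rfl)
      (le_iff_lt_or_eq.1 hle)

theorem ExtendedGoodstein.exists_isBadSequence (h : M.ExtendedGoodstein) (hB : Monotone B)
    (hpos : 0 < B 0) (hBC : ∀ i n, n < B i → C i n < B (i + 1)) (hC : ∀ i, StrictMono (C i))
    {m : M.Num} (hm : m < pow2 (B 0)) (h0 : ∀ i, goodstein C m i ≠ 0) :
    ∃ (D : M.Num → M.Num) (Y : M.sets), Recursive₁ D ∧ IsBadSequence B C D Y := by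
  by_contra! hbad
  obtain ⟨G', ⟨hfun, hstart, hstep⟩, i, hi⟩ := h _ _ (goodsteinSystem_familyOf hB hpos hBC hC hbad)
    m _ _ (app_graphOf.2 rfl) (pow_iff.2 rfl) hm
  obtain ⟨G, _, hG⟩ := hfun.exists_recursive
  simp only [hG] at hstart hstep hi
  suffices ∀ j, G j = goodstein C m j from h0 i (hi.trans (this i)).symm
  intro j
  induction j using sigma_induction with
  | hP => infer_instance
  | zero => rw [goodstein_zero, hstart]
  | succ j ih =>
    refine add_right_cancel (b := 1) ?_
    rw [goodstein_add_one_add_one (h0 j), ← ih]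
    exact (hstep j _ _ rfl rfl).eq_mapExp (fun i n k hk ↦ (famApp_familyOf.1 hk).2) (ih ▸ h0 j)

theorem pow2_add_two_mul_le_mapExp {i p q u : M.Num} (hC : ∀ x, p ≤ x → C i x = x + 2)
    (h : pow2 p * q ≤ u) : pow2 (p + 2) * q ≤ mapExp C i u := by
  obtain ⟨k, r, rfl, hr⟩ := exists_eq_mul_add (pow2_pos p) u
  have hk : q ≤ k := (mul_le_mul_add_iff hr).1 h
  rw [mapExp_add (dvd_mul_right _ _) hr, mapExp_eq_four_mul hC _ (dvd_mul_right _ _), ← mul_assoc,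
    ← pow2_add_two]
  exact (mul_le_mul_right hk _).trans le_self_add

end Family

section Enumeration

variable {M : SecondOrderStructure.{u}} [hM : Fact M.ModelsRCA] (Θ : M.Num → M.Num → Prop)

/-- In the enumeration that lists `n` at all stages `w` with `Θ n w`, the number `n` has been listed
before stage `s`. -/
def ListedBefore (s n : M.Num) : Prop := ∃ w, w < s ∧ Θ n w

variable {Θ} in
theorem ListedBefore.mono {s t n : M.Num} (h : ListedBefore Θ s n) (hst : s ≤ t) :
    ListedBefore Θ t n := by
  obtain ⟨w, hw, h⟩ := h
  exact ⟨w, hw.trans_le hst, h⟩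

variable [DeltaOne₂ Θ]

instance : DeltaOne₂ (ListedBefore Θ) := ⟨by unfold ListedBefore; infer_instance⟩

/-- The least number below `l` that is listed for the first time at stage `i`. The value is `l` if
there is no such number. -/
noncomputable def cut (i l : M.Num) : M.Num :=
  least fun n ↦ n = l ∨ ListedBefore Θ (i + 1) n ∧ ¬ ListedBefore Θ i n

instance : Recursive₂ (cut Θ) :=
  ⟨.least (P := fun (v : Fin 2 → M.Num) n ↦
    n = v 1 ∨ ListedBefore Θ (v 0 + 1) n ∧ ¬ ListedBefore Θ (v 0) n)
    inferInstance fun _ ↦ ⟨_, .inl rfl⟩⟩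

theorem cut_spec (i l : M.Num) :
    (cut Θ i l = l ∨
      cut Θ i l < l ∧ ListedBefore Θ (i + 1) (cut Θ i l) ∧ ¬ ListedBefore Θ i (cut Θ i l)) ∧
    ∀ n, n < cut Θ i l → ListedBefore Θ (i + 1) n → ListedBefore Θ i n := by
  obtain ⟨hcut, hmin⟩ :=
    least_spec (P := fun n ↦ n = l ∨ ListedBefore Θ (i + 1) n ∧ ¬ ListedBefore Θ i n)
      (by infer_instance) ⟨l, .inl rfl⟩
  have hle : cut Θ i l ≤ l := not_lt.1 fun h ↦ hmin l h (.inl rfl)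
  refine ⟨?_, fun n hn h ↦ by_contra fun h' ↦ hmin n hn (.inr ⟨h, h'⟩)⟩
  rcases hle.eq_or_lt with h | h
  · exact .inl h
  · exact .inr ⟨h, hcut.resolve_left h.ne⟩

instance : Recursive₄ (M := M) (fun _ _ i l ↦ cut Θ i l + 1) := ⟨inferInstance⟩

/-- The number of candidates at stage `i`: whenever a candidate is listed, the larger ones are
dropped, and one candidate is added at each stage. -/
noncomputable def height (i : M.Num) : M.Num :=
  primRec (fun _ _ ↦ 0) (fun _ _ i l ↦ cut Θ i l + 1) 0 0 i

instance : Recursive₁ (height Θ) := ⟨by unfold height; infer_instance⟩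

theorem height_zero : height Θ 0 = 0 := primRec_zero ..

theorem height_add_one (i : M.Num) : height Θ (i + 1) = cut Θ i (height Θ i) + 1 := primRec_succ ..

open Classical in
/-- The exponents at distance at most `keep Θ i` from the bound `2 * i` are those that keep their
distance in step `i`. -/
noncomputable def keep (i : M.Num) : M.Num :=
  2 * cut Θ i (height Θ i) + if cut Θ i (height Θ i) < height Θ i then 1 else 0

open Classical in
instance : Recursive₁ (keep Θ) := ⟨by unfold keep; infer_instance⟩

theorem keep_of_eq {i : M.Num} (h : cut Θ i (height Θ i) = height Θ i) :
    keep Θ i = 2 * height Θ i := by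
  rw [keep, if_neg h.not_lt, add_zero, h]

theorem keep_of_lt {i : M.Num} (h : cut Θ i (height Θ i) < height Θ i) :
    keep Θ i = 2 * cut Θ i (height Θ i) + 1 := by
  rw [keep, if_pos h]

theorem two_mul_add_one_le {x y : M.Num} (h : x < y) : 2 * x + 1 ≤ 2 * y :=
  Order.add_one_le_iff.2 (mul_lt_mul_of_pos_left h two_pos)

theorem keep_le (i : M.Num) : keep Θ i ≤ 2 * height Θ i := by
  rcases (cut_spec Θ i (height Θ i)).1 with h | ⟨h, -⟩
  · exact (keep_of_eq Θ h).le
  · rw [keep_of_lt Θ h]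
    exact two_mul_add_one_le h

theorem height_add_one_le (i : M.Num) : height Θ (i + 1) ≤ height Θ i + 1 := by
  rw [height_add_one]
  rcases (cut_spec Θ i (height Θ i)).1 with h | ⟨h, -⟩
  · rw [h]
  · gcongr

open Classical in
/-- The functions of the Goodstein system. Exponents that are close to the bound keep their distance
from it, while the others stay fixed. -/
noncomputable def shift (i x : M.Num) : M.Num := if 2 * i ≤ x + keep Θ i then x + 2 else x

open Classical in
instance : Recursive₂ (shift Θ) := ⟨by unfold shift; infer_instance⟩

theorem shift_of_le {i x : M.Num} (h : 2 * i ≤ x + keep Θ i) : shift Θ i x = x + 2 := if_pos h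

theorem shift_of_lt {i x : M.Num} (h : x + keep Θ i < 2 * i) : shift Θ i x = x := if_neg h.not_ge

theorem shift_strictMono (i : M.Num) : StrictMono (shift Θ i) := by
  intro x y hxy
  rcases le_or_gt (2 * i) (x + keep Θ i) with h | h
  · rw [shift_of_le Θ h, shift_of_le Θ (h.trans (by gcongr))]
    gcongr
  · rw [shift_of_lt Θ h]
    rcases le_or_gt (2 * i) (y + keep Θ i) with h' | h'
    · rw [shift_of_le Θ h']
      exact hxy.trans_le le_self_add
    · rwa [shift_of_lt Θ h']

theorem shift_lt {i x : M.Num} (h : x < 2 * i + 1) : shift Θ i x < 2 * (i + 1) + 1 := by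
  rcases le_or_gt (2 * i) (x + keep Θ i) with h' | h'
  · rw [shift_of_le Θ h']
    calc x + 2 < 2 * i + 1 + 2 := by gcongr
      _ = 2 * (i + 1) + 1 := by ring
  · rw [shift_of_lt Θ h']
    exact h.trans (by gcongr; exact lt_add_one i)

open Classical in
instance : Recursive₄ (M := M) (fun s _ n a ↦ 4 * a + if ListedBefore Θ s n then 0 else 1) :=
  ⟨inferInstance⟩

open Classical in
/-- The number with base four digits that indicate which numbers below `n` have not been listed
before stage `s`. -/
noncomputable def missing (s n : M.Num) : M.Num :=
  primRec (fun _ _ ↦ 0) (fun s _ n a ↦ 4 * a + if ListedBefore Θ s n then 0 else 1) s 0 n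

instance : Recursive₂ (missing Θ) := ⟨by unfold missing; infer_instance⟩

theorem missing_zero (s : M.Num) : missing Θ s 0 = 0 := primRec_zero ..

variable {Θ}

theorem missing_add_one_of_listed {s n : M.Num} (h : ListedBefore Θ s n) :
    missing Θ s (n + 1) = 4 * missing Θ s n :=
  (primRec_succ ..).trans (by rw [if_pos h, add_zero]; rfl)

theorem missing_add_one_of_not_listed {s n : M.Num} (h : ¬ ListedBefore Θ s n) :
    missing Θ s (n + 1) = 4 * missing Θ s n + 1 :=
  (primRec_succ ..).trans (by rw [if_neg h]; rfl)

theorem four_mul_missing_le (s n : M.Num) : 4 * missing Θ s n ≤ missing Θ s (n + 1) := by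
  by_cases h : ListedBefore Θ s n
  · rw [missing_add_one_of_listed h]
  · rw [missing_add_one_of_not_listed h]
    exact le_self_add

theorem missing_add_one_le (s n : M.Num) : missing Θ s (n + 1) ≤ 4 * missing Θ s n + 1 := by
  by_cases h : ListedBefore Θ s n
  · rw [missing_add_one_of_listed h]
    exact le_self_add
  · rw [missing_add_one_of_not_listed h]

theorem missing_anti {s t : M.Num} (h : s ≤ t) (n : M.Num) : missing Θ t n ≤ missing Θ s n := by
  induction n using sigma_induction with
  | hP => infer_instance
  | zero => rw [missing_zero, missing_zero]
  | succ n ih =>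
    by_cases hs : ListedBefore Θ s n
    · rw [missing_add_one_of_listed hs, missing_add_one_of_listed (hs.mono h)]
      gcongr
    · rw [missing_add_one_of_not_listed hs]
      exact (missing_add_one_le t n).trans (by gcongr)

theorem pow2_mul_missing_le (s n e : M.Num) :
    pow2 (2 * e) * missing Θ s n ≤ missing Θ s (n + e) := by
  induction e using sigma_induction with
  | hP => infer_instance
  | zero => rw [mul_zero, pow2_zero, one_mul, add_zero]
  | succ e ih =>
    rw [← add_assoc, mul_add, mul_one, pow2_add_two, mul_assoc]
    exact (mul_le_mul_right ih 4).trans (four_mul_missing_le _ _)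

theorem mul_le_of_mul_add_one_le {x y z : M.Num} (hx : 0 < x) (h : x * (y + 1) ≤ z + 1) :
    x * y ≤ z := by
  refine Order.lt_add_one_iff.1 (lt_of_lt_of_le ?_ h)
  gcongr
  exact lt_add_one y

theorem pow2_add_two_mul_le_goodstein_add_one {m i p q : M.Num} (hq : 0 < q)
    (hp : 2 * i ≤ p + keep Θ i) (h : pow2 p * q ≤ goodstein (shift Θ) m i) :
    pow2 (p + 2) * q ≤ goodstein (shift Θ) m (i + 1) + 1 := by
  rw [goodstein_add_one_add_one ((mul_pos (pow2_pos p) hq).trans_le h).ne']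
  exact pow2_add_two_mul_le_mapExp (fun x hx ↦ shift_of_le Θ (hp.trans (by gcongr))) h

theorem missing_le_goodstein_of_cut_eq {m i d : M.Num} (hd : i = height Θ i + d)
    (hcut : cut Θ i (height Θ i) = height Θ i)
    (h : pow2 (2 * d) * (2 * missing Θ i (height Θ i) + 1) ≤ goodstein (shift Θ) m i) :
    pow2 (2 * d) * (2 * missing Θ (i + 1) (height Θ i + 1) + 1) ≤
      goodstein (shift Θ) m (i + 1) := by
  have hp : 2 * i ≤ 2 * d + keep Θ i := by
    rw [keep_of_eq Θ hcut, ← mul_add, add_comm, ← hd]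
  refine mul_le_of_mul_add_one_le (pow2_pos _) ?_
  calc pow2 (2 * d) * (2 * missing Θ (i + 1) (height Θ i + 1) + 1 + 1)
      ≤ pow2 (2 * d) * (2 * (4 * missing Θ i (height Θ i) + 1) + 1 + 1) := by
        gcongr
        refine (missing_add_one_le _ _).trans ?_
        gcongr
        exact missing_anti (lt_add_one i).le _
    _ = pow2 (2 * d + 2) * (2 * missing Θ i (height Θ i) + 1) := by rw [pow2_add_two]; ring
    _ ≤ goodstein (shift Θ) m (i + 1) + 1 :=
        pow2_add_two_mul_le_goodstein_add_one (Order.lt_add_one_iff.2 zero_le) hp h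

theorem missing_le_goodstein_of_cut_lt {m i k d e : M.Num} (hd : i = height Θ i + d)
    (hcut : cut Θ i (height Θ i) = k) (hk : height Θ i = k + 1 + e)
    (h : pow2 (2 * d) * (2 * missing Θ i (height Θ i) + 1) ≤ goodstein (shift Θ) m i) :
    pow2 (2 * (d + e + 1)) * (2 * missing Θ (i + 1) (k + 1) + 1) ≤
      goodstein (shift Θ) m (i + 1) := by
  have hlt : k < height Θ i := hk ▸ (lt_add_one k).trans_le le_self_add
  obtain ⟨hlisted, hnot⟩ : ListedBefore Θ (i + 1) k ∧ ¬ ListedBefore Θ i k := by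
    have hspec := (cut_spec Θ i (height Θ i)).1
    rw [hcut] at hspec
    exact (hspec.resolve_left hlt.ne).2
  have hp : 2 * i ≤ 2 * (d + e) + 1 + keep Θ i := by
    rw [keep_of_lt Θ (hcut ▸ hlt), hcut]
    refine le_of_eq ?_
    conv_lhs => rw [hd, hk]
    ring
  have hG : pow2 (2 * (d + e) + 1) * (4 * missing Θ i k + 1) ≤ goodstein (shift Θ) m i :=
    calc pow2 (2 * (d + e) + 1) * (4 * missing Θ i k + 1)
        = pow2 (2 * d) * (2 * (pow2 (2 * e) * missing Θ i (k + 1))) := by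
          rw [missing_add_one_of_not_listed hnot, pow2_add_one, mul_add 2 d e,
            pow2_add]
          ring
      _ ≤ pow2 (2 * d) * (2 * missing Θ i (height Θ i) + 1) := by
          rw [hk]
          exact mul_le_mul_right ((mul_le_mul_right (pow2_mul_missing_le _ _ _) 2).trans
            le_self_add) _
      _ ≤ goodstein (shift Θ) m i := h
  refine mul_le_of_mul_add_one_le (pow2_pos _) ?_
  calc pow2 (2 * (d + e + 1)) * (2 * missing Θ (i + 1) (k + 1) + 1 + 1)
      ≤ pow2 (2 * (d + e + 1)) * (2 * (4 * missing Θ i k) + 1 + 1) := by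
        rw [missing_add_one_of_listed hlisted]
        gcongr
        exact missing_anti (lt_add_one i).le _
    _ = pow2 (2 * (d + e) + 1 + 2) * (4 * missing Θ i k + 1) := by
        rw [mul_add 2 (d + e) 1, mul_one, pow2_add_two, pow2_add_two, pow2_add_one]
        ring
    _ ≤ goodstein (shift Θ) m (i + 1) + 1 :=
        pow2_add_two_mul_le_goodstein_add_one (Order.lt_add_one_iff.2 zero_le) hp hG

variable (Θ) in
theorem exists_missing_le_goodstein (i : M.Num) :
    ∃ d, i = height Θ i + d ∧
      pow2 (2 * d) * (2 * missing Θ i (height Θ i) + 1) < goodstein (shift Θ) 1 i + 1 := by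
  induction i using sigma_induction with
  | hP => infer_instance
  | zero =>
    refine ⟨0, by rw [height_zero, add_zero], ?_⟩
    rw [height_zero, missing_zero, goodstein_zero, mul_zero, pow2_zero, zero_add, one_mul]
    exact lt_add_one 1
  | succ i ih =>
    obtain ⟨d, hd, h⟩ := ih
    rw [Order.lt_add_one_iff] at h
    simp only [Order.lt_add_one_iff]
    rw [height_add_one]
    rcases (cut_spec Θ i (height Θ i)).1 with hcut | ⟨hcut, -⟩
    · refine ⟨d, ?_, hcut.symm ▸ missing_le_goodstein_of_cut_eq hd hcut h⟩
      rw [hcut, add_right_comm, ← hd]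
    · obtain ⟨e, he⟩ := exists_add_of_le (Order.add_one_le_iff.2 hcut)
      refine ⟨d + e + 1, ?_, missing_le_goodstein_of_cut_lt hd rfl he h⟩
      conv_lhs => rw [hd, he]
      ring

variable (Θ) in
theorem goodstein_shift_ne_zero (i : M.Num) : goodstein (shift Θ) 1 i ≠ 0 := by
  obtain ⟨d, -, h⟩ := exists_missing_le_goodstein Θ i
  exact ((mul_pos (pow2_pos _) (Order.lt_add_one_iff.2 zero_le)).trans_le
    (Order.lt_add_one_iff.1 h)).ne'

end Enumeration

section Decision

variable {M : SecondOrderStructure.{u}} [hM : Fact M.ModelsRCA] (Θ : M.Num → M.Num → Prop)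
  [DeltaOne₂ Θ]

open Classical in
/-- The effect of `shift Θ i` on the distance of an exponent from the bound `2 * i`. -/
noncomputable def coshift (i y : M.Num) : M.Num := if y ≤ keep Θ i then y else y + 2

open Classical in
instance : Recursive₂ (coshift Θ) := ⟨by unfold coshift; infer_instance⟩

theorem coshift_of_le {i y : M.Num} (h : y ≤ keep Θ i) : coshift Θ i y = y := if_pos h

theorem coshift_of_lt {i y : M.Num} (h : keep Θ i < y) : coshift Θ i y = y + 2 := if_neg h.not_ge

variable {Θ}

theorem le_coshift (i y : M.Num) : y ≤ coshift Θ i y := by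
  rcases le_or_gt y (keep Θ i) with h | h
  · rw [coshift_of_le Θ h]
  · rw [coshift_of_lt Θ h]
    exact le_self_add

theorem shift_add_coshift {i x y : M.Num} (h : x + y = 2 * i) :
    shift Θ i x + coshift Θ i y = 2 * (i + 1) := by
  rw [mul_add, mul_one, ← h]
  rcases le_or_gt y (keep Θ i) with hy | hy
  · rw [coshift_of_le Θ hy, shift_of_le Θ (by rw [← h]; gcongr), add_right_comm]
  · rw [coshift_of_lt Θ hy, shift_of_lt Θ (by rw [← h]; gcongr), add_assoc]

theorem iter_shift_add_iter_coshift {i x y : M.Num} (h : x + y = 2 * i) (d : M.Num) :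
    iter (shift Θ) i x (i + d) + iter (coshift Θ) i y (i + d) = 2 * (i + d) := by
  induction d using sigma_induction with
  | hP => infer_instance
  | zero => rwa [add_zero, iter_of_le le_rfl, iter_of_le le_rfl]
  | succ d ih =>
    rw [← add_assoc, iter_add_one le_self_add, iter_add_one le_self_add, shift_add_coshift ih]

theorem le_iter_coshift (i y d : M.Num) : y ≤ iter (coshift Θ) i y (i + d) := by
  induction d using sigma_induction with
  | hP => infer_instance
  | zero => rw [add_zero, iter_of_le le_rfl]
  | succ d ih =>
    rw [← add_assoc, iter_add_one le_self_add]
    exact ih.trans (le_coshift _ _)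

theorem coshift_eq_of_height_lt {i y : M.Num} (h : 2 * height Θ i < y) :
    coshift Θ i y = y + 2 ∧ 2 * height Θ (i + 1) < y + 2 := by
  refine ⟨coshift_of_lt Θ ((keep_le Θ i).trans_lt h), ?_⟩
  calc 2 * height Θ (i + 1) ≤ 2 * (height Θ i + 1) := by gcongr; exact height_add_one_le Θ i
    _ = 2 * height Θ i + 2 := by ring
    _ < y + 2 := by gcongr

theorem iter_coshift_of_height_lt {i y : M.Num} (h : 2 * height Θ i < y) (d : M.Num) :
    iter (coshift Θ) i y (i + d) = y + 2 * d ∧ 2 * height Θ (i + d) < y + 2 * d := by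
  induction d using sigma_induction with
  | hP => infer_instance
  | zero =>
    rw [add_zero, iter_of_le le_rfl, mul_zero, add_zero]
    exact ⟨rfl, h⟩
  | succ d ih =>
    rw [← add_assoc, iter_add_one le_self_add, ih.1, mul_add, mul_one, ← add_assoc]
    exact coshift_eq_of_height_lt ih.2

theorem height_add_one_lt_coshift_of_cut_le {i y n : M.Num} (hn : n < height Θ i)
    (hy : 2 * n + 1 < y) (hcut : cut Θ i (height Θ i) ≤ n) :
    2 * height Θ (i + 1) < coshift Θ i y := by
  have hlt : 2 * cut Θ i (height Θ i) + 1 < y := lt_of_le_of_lt (by gcongr) hy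
  rw [height_add_one, coshift_of_lt Θ (by rwa [keep_of_lt Θ (hcut.trans_lt hn)])]
  calc 2 * (cut Θ i (height Θ i) + 1) = 2 * cut Θ i (height Θ i) + 1 + 1 := by ring
    _ < y + 2 := add_lt_add hlt one_lt_two

theorem iter_coshift_of_not_listed {i y n : M.Num} (hn : n < height Θ i) (hy : 2 * n + 1 < y)
    (hlisted : ¬ ListedBefore Θ i n) (d : M.Num) :
    2 * height Θ (i + d) < iter (coshift Θ) i y (i + d) ∨
      n < height Θ (i + d) ∧ ¬ ListedBefore Θ (i + d) n ∧
        2 * n + 1 < iter (coshift Θ) i y (i + d) := by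
  induction d using sigma_induction with
  | hP => infer_instance
  | zero =>
    rw [add_zero, iter_of_le le_rfl]
    exact .inr ⟨hn, hlisted, hy⟩
  | succ d ih =>
    rw [← add_assoc, iter_add_one le_self_add]
    rcases ih with h | ⟨hn, hlisted, hy⟩
    · obtain ⟨heq, hlt⟩ := coshift_eq_of_height_lt h
      exact .inl (heq ▸ hlt)
    · rcases lt_or_ge n (cut Θ (i + d) (height Θ (i + d))) with hcut | hcut
      · refine .inr ⟨?_,
          fun h ↦ hlisted ((cut_spec Θ _ _).2 n hcut h), hy.trans_le (le_coshift _ _)⟩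
        rw [height_add_one]
        exact hcut.trans (lt_add_one _)
      · exact .inl (height_add_one_lt_coshift_of_cut_le hn hy hcut)

namespace IsBadSequence

variable {D : M.Num → M.Num} {Y : M.sets}

theorem add_tsub_eq (h : IsBadSequence (fun i ↦ 2 * i + 1) (shift Θ) D Y) (i : M.Num) :
    D i + (2 * i - D i) = 2 * i :=
  add_tsub_cancel_of_le (Order.lt_add_one_iff.1 (h.lt i))

theorem iter_coshift_lt (h : IsBadSequence (fun i ↦ 2 * i + 1) (shift Θ) D Y) {i d : M.Num}
    (hi : i ∈ (Y : Set M.Num)) (hid : i + d ∈ (Y : Set M.Num)) (hd : 0 < d) :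
    iter (coshift Θ) i (2 * i - D i) (i + d) < 2 * (i + d) - D (i + d) := by
  refine lt_of_add_lt_add_left (a := D (i + d)) ?_
  rw [h.add_tsub_eq, ← iter_shift_add_iter_coshift (Θ := Θ) (h.add_tsub_eq i)]
  exact add_lt_add_left (h.lt_iter i hi _ hid (lt_add_of_pos_right i hd)) _

theorem exists_add_mem (h : IsBadSequence (fun i ↦ 2 * i + 1) (shift Θ) D Y) (i e : M.Num) :
    ∃ d, e < d ∧ i + d ∈ (Y : Set M.Num) := by
  obtain ⟨j, hj, hij⟩ := h.isInfinite.2 (i + e)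
  obtain ⟨d, rfl⟩ := exists_add_of_le (le_self_add.trans hij.le)
  exact ⟨d, lt_of_add_lt_add_left hij, hj⟩

/- From an index where the distance `2 * i - D i` exceeds `2 * height Θ i`, the exponent never moves
again, so that the values of `D` at later elements of `Y` would have to descend forever. -/
theorem tsub_le_height [Recursive₁ D] (h : IsBadSequence (fun i ↦ 2 * i + 1) (shift Θ) D Y)
    {i : M.Num} (hi : i ∈ (Y : Set M.Num)) : 2 * i - D i ≤ 2 * height Θ i := by
  by_contra! hlt
  obtain ⟨a, ⟨i, hi, hlt, rfl⟩, hmin⟩ := sigma_exists_least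
    (P := fun a ↦ ∃ i, i ∈ (Y : Set M.Num) ∧ 2 * height Θ i < 2 * i - D i ∧ D i = a)
    (by infer_instance) ⟨_, i, hi, hlt, rfl⟩
  obtain ⟨d, hd, hid⟩ := h.exists_add_mem i 0
  obtain ⟨hiter, hheight⟩ := iter_coshift_of_height_lt hlt d
  have hdist := h.iter_coshift_lt hi hid hd
  rw [hiter] at hdist
  refine hmin (D (i + d)) ?_ ⟨i + d, hid, hheight.trans hdist, rfl⟩
  refine lt_of_add_lt_add_right (a := 2 * i - D i + 2 * d) ?_
  calc D (i + d) + (2 * i - D i + 2 * d) < D (i + d) + (2 * (i + d) - D (i + d)) := by gcongr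
    _ = D i + (2 * i - D i + 2 * d) := by rw [h.add_tsub_eq, mul_add, ← add_assoc, h.add_tsub_eq]

theorem exists_lt_tsub [Recursive₁ D] (h : IsBadSequence (fun i ↦ 2 * i + 1) (shift Θ) D Y)
    (n : M.Num) : ∃ i, i ∈ (Y : Set M.Num) ∧ n < 2 * i - D i := by
  induction n using sigma_induction with
  | hP => infer_instance
  | zero =>
    obtain ⟨i, -, hi⟩ := h.exists_add_mem 0 0
    obtain ⟨d, hd, hid⟩ := h.exists_add_mem (0 + i) 0
    exact ⟨_, hid, zero_le.trans_lt (h.iter_coshift_lt hi hid hd)⟩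
  | succ n ih =>
    obtain ⟨i, hi, hn⟩ := ih
    obtain ⟨d, hd, hid⟩ := h.exists_add_mem i 0
    exact ⟨_, hid, (Order.add_one_le_iff.2 hn).trans_lt
      ((le_iter_coshift _ _ _).trans_lt (h.iter_coshift_lt hi hid hd))⟩

theorem not_exists_of_not_listedBefore [Recursive₁ D]
    (h : IsBadSequence (fun i ↦ 2 * i + 1) (shift Θ) D Y) {i n : M.Num} (hi : i ∈ (Y : Set M.Num))
    (hn : 2 * n + 1 < 2 * i - D i) (hlisted : ¬ ListedBefore Θ i n) : ¬ ∃ w, Θ n w := by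
  rintro ⟨w, hw⟩
  have hheight : n < height Θ i :=
    lt_of_mul_lt_mul_left ((lt_add_one _).trans (hn.trans_le (h.tsub_le_height hi))) zero_le
  obtain ⟨d, hd, hid⟩ := h.exists_add_mem i w
  rcases iter_coshift_of_not_listed hheight hn hlisted d with hlt | ⟨-, hlisted, -⟩
  · exact (hlt.trans (h.iter_coshift_lt hi hid (zero_le.trans_lt hd))).not_ge (h.tsub_le_height hid)
  · exact hlisted ⟨w, hd.trans_le le_add_self, hw⟩

theorem setOf_exists_mem_sets [Recursive₁ D]
    (h : IsBadSequence (fun i ↦ 2 * i + 1) (shift Θ) D Y) : {n | ∃ w, Θ n w} ∈ M.sets := by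
  refine delta_comprehension ⟨inferInstance, ?_⟩
  refine SigmaOne.congr
    (P := fun v : Fin 1 → M.Num ↦
      ∃ i, i ∈ (Y : Set M.Num) ∧ 2 * v 0 + 1 < 2 * i - D i ∧ ¬ ListedBefore Θ i (v 0))
    (by infer_instance) fun v ↦ ⟨fun hΘ ↦ ?_, ?_⟩
  · obtain ⟨i, hi, hlt⟩ := h.exists_lt_tsub (2 * v 0 + 1)
    exact ⟨i, hi, hlt, fun ⟨w, _, hw⟩ ↦ hΘ ⟨w, hw⟩⟩
  · rintro ⟨i, hi, hlt, hlisted⟩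
    exact h.not_exists_of_not_listedBefore hi hlt hlisted

end IsBadSequence

theorem ExtendedGoodstein.setOf_exists_mem_sets (h : M.ExtendedGoodstein) :
    {n | ∃ w, Θ n w} ∈ M.sets := by
  have : Recursive₁ (M := M) fun i ↦ 2 * i + 1 := ⟨inferInstance⟩
  obtain ⟨D, Y, _, hbad⟩ := h.exists_isBadSequence (B := fun i ↦ 2 * i + 1) (C := shift Θ) (m := 1)
    (fun i j hij ↦ by dsimp only; gcongr) (Order.lt_add_one_iff.2 zero_le) (fun _ _ ↦ shift_lt Θ)
    (shift_strictMono Θ) (by rw [mul_zero, zero_add, pow2_one]; exact one_lt_two)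
    (goodstein_shift_ne_zero Θ)
  exact hbad.setOf_exists_mem_sets

theorem ExtendedGoodstein.sigmaOneComprehension (h : M.ExtendedGoodstein) :
    M.SigmaOneComprehension := by
  intro P hP
  obtain ⟨Q, hQ, hPQ⟩ := hP.exists_isBounded
  have : DeltaOne₂ fun n w ↦ Q (snoc (fun _ : Fin 1 ↦ n) w) :=
    ⟨(hQ.subst_snoc (fun _ ↦ .var 0) (.var 1)).sigmaOne,
      (hQ.not.subst_snoc (fun _ ↦ .var 0) (.var 1)).sigmaOne⟩
  have hset : {n | P n} = {n | ∃ w, Q (snoc (fun _ : Fin 1 ↦ n) w)} :=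
    Set.ext fun n ↦ hPQ fun _ ↦ n
  exact hset ▸ h.setOf_exists_mem_sets

end Decision

/-! ## Arithmetical comprehension and `Σ⁰₁` comprehension -/

section ArithmeticalComprehension

variable {M : SecondOrderStructure.{u}} {n : ℕ}

theorem isArithmetical_of_isBounded {φ : Formula} (h : φ.IsBounded) : φ.IsArithmetical := by
  induction h <;> simp_all only [Formula.IsArithmetical, and_self]

theorem ArithmeticalComprehension.sigmaOneComprehension (h : M.ArithmeticalComprehension) :
    M.SigmaOneComprehension := by
  intro P hP
  obtain ⟨x, θ, l, hθ, hPθ⟩ := hP.exists_formula 0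
  obtain ⟨e, E, hl⟩ := exists_listsParams 0 l
  obtain ⟨X, hX, hXθ⟩ := h (.ex x θ) (isArithmetical_of_isBounded (φ := θ) hθ) 0 e E
  rwa [show {n | P n} = X from Set.ext fun a ↦ ((hXθ a).trans (hPθ e E hl a)).symm]

theorem SigmaOneComprehension.deltaOne [hM : Fact M.ModelsRCA] (h : M.SigmaOneComprehension)
    {P : (Fin (n + 1) → M.Num) → Prop} (hP : SigmaOne M P) : DeltaOne M P := by
  induction n with
  | zero =>
    have hmem : {a | P fun _ ↦ a} ∈ M.sets :=
      h _ (hP.comp (f := fun _ v ↦ v 0) fun _ ↦ inferInstance)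
    refine (DeltaOne.mem (f := fun v : Fin 1 → M.Num ↦ v 0) ⟨_, hmem⟩).congr fun v ↦ ?_
    exact iff_of_eq (congrArg P (funext fun i ↦ congrArg v (Subsingleton.elim i 0)))
  | succ n ih =>
    have hP' : SigmaOne M fun w : Fin (n + 3) → M.Num ↦
        P (snoc (snoc (fun i : Fin n ↦ w i.castSucc.castSucc.castSucc)
          (w (Fin.last (n + 1)).castSucc)) (w (Fin.last (n + 2)))) :=
      hP.subst_snoc (.snoc (fun _ ↦ .var _) (.var _)) (.var _)
    have hpaired : DeltaOne M fun w : Fin (n + 1) → M.Num ↦ ∃ a b, w (Fin.last n) = M.pair a b ∧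
        P (snoc (snoc (fun i : Fin n ↦ w i.castSucc) a) b) := ih inferInstance
    have hpair : IsPolynomial M fun v : Fin (n + 2) → M.Num ↦
        M.pair (v (Fin.last n).castSucc) (v (Fin.last (n + 1))) :=
      .add (.mul (.add (.var _) (.var _)) (.add (.var _) (.var _))) (.var _)
    refine (hpaired.comp fun i ↦ (IsPolynomial.snoc (g := fun (i : Fin n) v ↦ v i.castSucc.castSucc)
      (fun _ ↦ .var _) hpair i).recursive).congr fun v ↦ ?_
    have hv : snoc (snoc (fun i ↦ v i.castSucc.castSucc) (v (Fin.last n).castSucc))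
        (v (Fin.last (n + 1))) = v :=
      (congrArg (snoc · _) (Fin.snoc_init_self fun i ↦ v i.castSucc)).trans (Fin.snoc_init_self v)
    simp only [Fin.snoc_last, Fin.snoc_castSucc, pair_inj]
    constructor
    · exact fun h ↦ ⟨_, _, ⟨rfl, rfl⟩, hv.symm ▸ h⟩
    · rintro ⟨a, b, ⟨rfl, rfl⟩, h⟩
      rwa [hv] at h

theorem isPolynomial_value {w : ℕ → (Fin n → M.Num) → M.Num} (hw : ∀ k, IsPolynomial M (w k))
    (t : Term) : IsPolynomial M fun v ↦ M.value (fun k ↦ w k v) t := by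
  induction t with
  | var x => exact hw x
  | zero => exact .const 0
  | one => exact .const 1
  | add s t hs ht => exact .add hs ht
  | mul s t hs ht => exact .mul hs ht

theorem isPolynomial_update {w : ℕ → (Fin n → M.Num) → M.Num} (hw : ∀ k, IsPolynomial M (w k))
    {f : (Fin n → M.Num) → M.Num} (hf : IsPolynomial M f) (x k : ℕ) :
    IsPolynomial M (Function.update w x f k) := by
  rcases eq_or_ne k x with rfl | hk
  · rwa [Function.update_self]
  · rw [Function.update_of_ne hk]
    exact hw k

theorem update_apply_eq (w : ℕ → (Fin n → M.Num) → M.Num) (x : ℕ) (f : (Fin n → M.Num) → M.Num)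
    (v : Fin n → M.Num) :
    (fun k ↦ Function.update w x f k v) = Function.update (fun k ↦ w k v) x (f v) :=
  funext fun k ↦ Function.apply_update (fun _ g ↦ g v) w x f k

variable [hM : Fact M.ModelsRCA]

theorem SigmaOneComprehension.deltaOne_exists_sat (h : M.SigmaOneComprehension) {E : ℕ → M.sets}
    {φ : Formula} {w : ℕ → (Fin (n + 1) → M.Num) → M.Num} {x : ℕ}
    (hφ : DeltaOne M fun v : Fin (n + 2) → M.Num ↦ M.Sat (fun k ↦ Function.update
      (fun k v ↦ w k fun i ↦ v i.castSucc) x (fun v ↦ v (Fin.last (n + 1))) k v) E φ) :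
    DeltaOne M fun v ↦ ∃ a, M.Sat (Function.update (fun k ↦ w k v) x a) E φ :=
  (h.deltaOne hφ.sigmaOne.exSnoc).congr fun v ↦ by
    simp only [update_apply_eq, Fin.snoc_last, Fin.snoc_castSucc]

theorem SigmaOneComprehension.deltaOne_sat (h : M.SigmaOneComprehension) (E : ℕ → M.sets)
    {φ : Formula} (hφ : φ.IsArithmetical) {w : ℕ → (Fin (n + 1) → M.Num) → M.Num}
    (hw : ∀ k, IsPolynomial M (w k)) : DeltaOne M fun v ↦ M.Sat (fun k ↦ w k v) E φ := by
  have hvalue {n : ℕ} {w : ℕ → (Fin (n + 1) → M.Num) → M.Num} (hw : ∀ k, IsPolynomial M (w k))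
      (t : Term) := (isPolynomial_value hw t).recursive
  induction φ generalizing n with
  | eq s t =>
    have := hvalue hw s
    have := hvalue hw t
    exact DeltaOne.eq
  | lt s t =>
    have := hvalue hw s
    have := hvalue hw t
    exact DeltaOne.lt
  | mem t X =>
    have := hvalue hw t
    exact DeltaOne.mem _
  | not φ ih =>
    have := ih hφ hw
    exact DeltaOne.not
  | and φ ψ ih ih' =>
    have := ih hφ.1 hw
    have := ih' hφ.2 hw
    exact DeltaOne.and
  | or φ ψ ih ih' =>
    have := ih hφ.1 hw
    have := ih' hφ.2 hw
    exact DeltaOne.or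
  | imp φ ψ ih ih' =>
    have := ih hφ.1 hw
    have := ih' hφ.2 hw
    exact DeltaOne.imp
  | all x φ ih =>
    have := ih hφ (isPolynomial_update (fun k ↦ (hw k).weaken) (.var (Fin.last (n + 1))) x)
    have hnot : DeltaOne M fun v ↦ ∃ a, M.Sat (Function.update (fun k ↦ w k v) x a) E (.not φ) :=
      h.deltaOne_exists_sat DeltaOne.not
    exact (DeltaOne.not (hP := hnot)).congr fun v ↦ by simp only [Sat, not_exists, not_not]
  | ex x φ ih =>
    exact h.deltaOne_exists_sat (ih hφ (isPolynomial_update (fun k ↦ (hw k).weaken) (.var _) x))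
  | allSet => exact hφ.elim
  | exSet => exact hφ.elim

theorem SigmaOneComprehension.arithmeticalComprehension (h : M.SigmaOneComprehension) :
    M.ArithmeticalComprehension := by
  intro φ hφ x e E
  refine ⟨{a | M.Sat (Function.update e x a) E φ}, delta_comprehension ?_, fun n ↦ .rfl⟩
  refine (h.deltaOne_sat E hφ (isPolynomial_update (w := fun k _ ↦ e k) (fun _ ↦ .const _)
    (.var (0 : Fin 1)) x)).congr fun v ↦ ?_
  rw [update_apply_eq]

end ArithmeticalComprehension

end SecondOrderStructure

/-- Over `RCA₀`, arithmetical comprehension is equivalent to the extended Goodstein theorem for the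
binary representation: the two have the same truth value in every model of `RCA₀` (including
models with non-standard numbers). -/
theorem theorem2 (M : SecondOrderStructure.{u}) (hM : M.ModelsRCA) :
    M.ArithmeticalComprehension ↔ M.ExtendedGoodstein := by
  have : Fact M.ModelsRCA := ⟨hM⟩
  exact ⟨fun h ↦ h.sigmaOneComprehension.extendedGoodstein,
    fun h ↦ h.sigmaOneComprehension.arithmeticalComprehension⟩
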